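/- Let $T>0$, $\Omega=(0,1)$, $Q=(0,T)\times\Omega$. Let $a\in C([0,1])\cap C^1((0,1])$ with $a(0)=0$, $a>0$ on $(0,1]$ and $xa'(x)\le\tau a(x)$ on $(0,1]$ for some $\tau\in[0,1)$. Let $F\in C^2(\mathbb R\times\mathbb R)$ be globally Lipschitz with $F(0,0)=0$ and bounded partial derivatives of first and second order. Let $\omega,\omega_1,\omega_2,\omega_{1,d},\omega_{2,d}\subset\Omega$ be measurable, $y^0\in L^2(\Omega)$, $h\in L^2((0,T)\times\omega)$, $y_{i,d}\in L^2((0,T)\times\omega_{i,d})$, $\alpha_i>0$ and $\mu_i>0$ ($i=1,2$). Let $\mathcal H=L^2((0,T)\times\omega_1)\times L^2((0,T)\times\omega_2)$. Let $$H^1_a(\Omega)=\{u\in L^2(\Omega):\ u \text{ absolutely continuous on }[0,1],\ \sqrt a\,u_x\in L^2(\Omega),\ u(0)=u(1)=0\},$$ $$\mathbb H=L^2((0,T);H^1_a(\Omega))\cap C([0,T];L^2(\Omega)).$$ For $(v^1,v^2)\in\mathcal H$ let $y\in\mathbb H$ be the weak solution of $$y_t-(a y_x)_x+F(y,y_x)=h\chi_\omega+v^1\chi_{\omega_1}+v^2\chi_{\omega_2}\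 \text{in }Q,\quad y(t,0)=y(t,1)=0,\quad y(0,\cdot)=y^0,$$ i.e. for all $\phi\in\mathbb H$ with $\phi_t\in L^2(Q)$ and $\phi(T,\cdot)=0$, $$-\int_Q y\phi_t+\int_Q a\,y_x\phi_x+\int_Q F(y,y_x)\phi=\int_Q(h\chi_\omega+v^1\chi_{\omega_1}+v^2\chi_{\omega_2})\phi+\int_\Omega y^0\phi(0,\cdot),$$ and put $$J_i(h;v^1,v^2)=\frac{\alpha_i}2\int_0^T\!\!\int_{\omega_{i,d}}|y-y_{i,d}|^2\,dx\,dt+\frac{\mu_i}2\int_0^T\!\!\int_{\omega_i}|v^i|^2\,dx\,dt .$$ A pair $(\hat v^1,\hat v^2)\in\mathcal H$ is a Nash quasi-equilibrium if, for $i=1,2$, the directional derivative of $J_i$ at $(\hat v^1,\hat v^2)$ with respect to $v^i$ exists and is zero in every direction $w\in L^2((0,T)\times\omega_i)$. Then $(\hat v^1,\hat v^2)\in\mathcal H$ is a Nash quasi-equilibrium if and only if there exist $y,p^1,p^2\in\mathbb H$ such that $$\hat v^i=-\frac1{\mu_i}p^i\quad\text{a.e. in }(0,T)\times\omega_i,\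 i=1,2,$$ and $(y,p^1,p^2)$ is a weak solution of the optimality system $$y_t-(a y_x)_x+F(y,y_x)=h\chi_\omega-\tfrac1{\mu_1}p^1\chi_{\omega_1}-\tfrac1{\mu_2}p^2\chi_{\omega_2}\ \text{in }Q,\quad y(t,0)=y(t,1)=0,\quad y(0,\cdot)=y^0,$$ $$-p^i_t-(a p^i_x)_x+D_1F(y,y_x)p^i-\big(D_2F(y,y_x)p^i\big)_x=\alpha_i(y-y_{i,d})\chi_{\omega_{i,d}}\ \text{in }Q,\quad p^i(t,0)=p^i(t,1)=0,\quad p^i(T,\cdot)=0,$$ where the equation for $p^i$ means that, for all $\phi\in\mathbb H$ with $\phi_t\in L^2(Q)$ and $\phi(0,\cdot)=0$, $$\int_Q p^i\phi_t+\int_Q a\,p^i_x\phi_x+\int_Q D_1F(y,y_x)p^i\phi+\int_Q D_2F(y,y_x)p^i\phi_x=\int_Q\alpha_i(y-y_{i,d})\chi_{\omega_{i,d}}\phi .$$ In particular this holds for all sufficiently large $\mu_1,\mu_2$. -/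

import Mathlib

open Set Filter Topology MeasureTheory

noncomputable section

namespace StackelbergNash

/-- Lebesgue measure on the space domain `Ω = (0,1)`. -/
abbrev volΩ : Measure ℝ := volume.restrict (Ioo 0 1)

/-- Lebesgue measure on the cylinder `(0,T) × A`; a point is a pair `(t, x)`. -/
abbrev volCyl (T : ℝ) (A : Set ℝ) : Measure (ℝ × ℝ) := volume.restrict (Ioo 0 T ×ˢ A)

/-- Lebesgue measure on `Q = (0,T) × (0,1)`. -/
abbrev volQ (T : ℝ) : Measure (ℝ × ℝ) := volCyl T (Ioo 0 1)

/-- The space `L²((0,T) × A) = L²((0,T); L²(A))`. -/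
abbrev L2Cyl (T : ℝ) (A : Set ℝ) : Type := Lp ℝ 2 (volCyl T A)

/-- The weakly degenerate diffusion coefficients: `a ∈ C([0,1]) ∩ C¹((0,1])`, `a > 0` on `(0,1]`,
`a(0) = 0`, and `x a'(x) ≤ τ a(x)` for some `τ ∈ [0,1)`. -/
structure WeaklyDegenerate (a : ℝ → ℝ) : Prop where
  continuousOn : ContinuousOn a (Icc 0 1)
  contDiffOn : ContDiffOn ℝ 1 a (Ioc 0 1)
  pos : ∀ x ∈ Ioc (0 : ℝ) 1, 0 < a x
  zero : a 0 = 0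
  deriv_le : ∃ τ ∈ Ico (0 : ℝ) 1, ∀ x ∈ Ioc (0 : ℝ) 1,
    x * derivWithin a (Ioc 0 1) x ≤ τ * a x

/-- The partial derivative `D_{i+1} G` of `G : ℝ × ℝ → ℝ`, for `i = 0, 1`. -/
def partialD (i : Fin 2) (G : ℝ × ℝ → ℝ) (q : ℝ × ℝ) : ℝ :=
  fderiv ℝ G q ((![(1, 0), (0, 1)] : Fin 2 → ℝ × ℝ) i)

/-- The conditions on the nonlinearity `F = F(s,p)`: it is `C²`, vanishes at the origin, is
globally Lipschitz, and its partial derivatives of first and second order are bounded. -/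
structure AdmissibleNonlinearity (F : ℝ × ℝ → ℝ) : Prop where
  zero : F (0, 0) = 0
  contDiff : ContDiff ℝ 2 F
  lipschitz : ∃ K > 0, ∀ s p s' p' : ℝ, |F (s, p) - F (s', p')| ≤ K * (|s - s'| + |p - p'|)
  bounded : ∃ M > 0, ∀ q : ℝ × ℝ,
    ∑ i, |partialD i F q| + ∑ i, ∑ j, |partialD i (partialD j F) q| ≤ M

/-- `u` is (almost everywhere equal to) an element of the weighted space `H¹ₐ(Ω)`, with
derivative `u'`: it has a representative `w` that is absolutely continuous on `[0,1]` with
`w(0) = w(1) = 0` and `w' = u'`, and `√a u' ∈ L²(Ω)`. -/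
def MemH1a (a u u' : ℝ → ℝ) : Prop :=
  MemLp u 2 volΩ ∧ MemLp (fun x => √(a x) * u' x) 2 volΩ ∧
    ∃ w : ℝ → ℝ, AbsolutelyContinuousOnInterval w 0 1 ∧ w 0 = 0 ∧ w 1 = 0 ∧
      u =ᵐ[volΩ] w ∧ u' =ᵐ[volΩ] deriv w

/-- (Representatives of) elements of `ℍ = L²((0,T); H¹ₐ(Ω)) ∩ C([0,T]; L²(Ω))`: a function
`val t x` together with its space derivative `dx t x`. -/
structure SpaceH (a : ℝ → ℝ) (T : ℝ) where
  val : ℝ → ℝ → ℝ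
  dx : ℝ → ℝ → ℝ
  memLp_val : MemLp (fun z : ℝ × ℝ => val z.1 z.2) 2 (volQ T)
  memLp_dx : MemLp (fun z : ℝ × ℝ => √(a z.2) * dx z.1 z.2) 2 (volQ T)
  memH1a : ∀ᵐ t ∂(volume.restrict (Ioo 0 T)), MemH1a a (val t) (dx t)
  memLp_slice : ∀ t ∈ Icc 0 T, MemLp (val t) 2 volΩ
  continuous_slice : ∀ t₀ ∈ Icc 0 T,
    Tendsto (fun t => eLpNorm (val t - val t₀) 2 volΩ) (𝓝[Icc 0 T] t₀) (𝓝 0)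

/-- The functions `φ ∈ ℍ` with `φ_t ∈ L²(Q)`. The field `dt` is the weak time derivative `φ_t`:
`φ(t) = φ(0) + ∫₀ᵗ φ_t(s) ds` in `L²(Ω)` for every `t ∈ [0,T]`. -/
structure TestFunction (a : ℝ → ℝ) (T : ℝ) extends SpaceH a T where
  dt : ℝ → ℝ → ℝ
  memLp_dt : MemLp (fun z : ℝ × ℝ => dt z.1 z.2) 2 (volQ T)
  eq_integral_dt : ∀ t ∈ Icc 0 T,
    ∀ᵐ x ∂volΩ, val t x = val 0 x + ∫ s in (0 : ℝ)..t, dt s x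

/-- `y` is a weak solution of `y_t - (a y_x)_x + F(y, y_x) = f` in `Q`, `y(t,0) = y(t,1) = 0`,
`y(0) = y⁰`. The test functions are the `φ ∈ ℍ` with `φ_t ∈ L²(Q)` and `φ(T) = 0`. -/
def IsWeakSolution (a : ℝ → ℝ) (F : ℝ × ℝ → ℝ) (T : ℝ) (y₀ : ℝ → ℝ) (f : ℝ × ℝ → ℝ)
    (y : SpaceH a T) : Prop :=
  ∀ φ : TestFunction a T, φ.val T =ᵐ[volΩ] 0 →
    - (∫ z, y.val z.1 z.2 * φ.dt z.1 z.2 ∂(volQ T))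
      + (∫ z, a z.2 * y.dx z.1 z.2 * φ.dx z.1 z.2 ∂(volQ T))
      + (∫ z, F (y.val z.1 z.2, y.dx z.1 z.2) * φ.val z.1 z.2 ∂(volQ T))
    = (∫ z, f z * φ.val z.1 z.2 ∂(volQ T)) + ∫ x, y₀ x * φ.val 0 x ∂volΩ

/-- `p` is a weak solution of the backward linear problem
`-p_t - (a p_x)_x + c p - (b p)_x = f` in `Q`, `p(t,0) = p(t,1) = 0`, `p(T) = 0`.
The test functions are the `φ ∈ ℍ` with `φ_t ∈ L²(Q)` and `φ(0) = 0`. -/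
def IsAdjointWeakSolution (a : ℝ → ℝ) (c b : ℝ × ℝ → ℝ) (T : ℝ) (f : ℝ × ℝ → ℝ)
    (p : SpaceH a T) : Prop :=
  ∀ φ : TestFunction a T, φ.val 0 =ᵐ[volΩ] 0 →
    (∫ z, p.val z.1 z.2 * φ.dt z.1 z.2 ∂(volQ T))
      + (∫ z, a z.2 * p.dx z.1 z.2 * φ.dx z.1 z.2 ∂(volQ T))
      + (∫ z, c z * p.val z.1 z.2 * φ.val z.1 z.2 ∂(volQ T))
      + (∫ z, b z * p.val z.1 z.2 * φ.dx z.1 z.2 ∂(volQ T))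
    = ∫ z, f z * φ.val z.1 z.2 ∂(volQ T)

/-- The data of the bi-objective control problem: the final time, the diffusion coefficient, the
nonlinearity, the control region `ω` of the leader, and, for the two followers, the control
regions `ωf i`, the observation regions `ωd i`, the weights `α i`, `μ i` and the targets `yd i`;
the initial state `y₀` and the leader control `h`. -/
structure Data where
  T : ℝ
  a : ℝ → ℝ
  F : ℝ × ℝ → ℝ
  ω : Set ℝ
  ωf : Fin 2 → Set ℝ
  ωd : Fin 2 → Set ℝ
  α : Fin 2 → ℝ
  μ : Fin 2 → ℝ
  yd : (i : Fin 2) → L2Cyl T (ωd i)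
  y₀ : Lp ℝ 2 volΩ
  h : L2Cyl T ω

namespace Data

variable (P : Data)

/-- The space of pairs of follower controls,
`𝓗 = L²((0,T); L²(ω₁)) × L²((0,T); L²(ω₂))`. -/
abbrev Controls : Type := (i : Fin 2) → L2Cyl P.T (P.ωf i)

/-- The right-hand side `h χ_ω + g¹ χ_{ω₁} + g² χ_{ω₂}`. -/
def source (g : Fin 2 → ℝ × ℝ → ℝ) (z : ℝ × ℝ) : ℝ :=
  P.ω.indicator (fun x => P.h (z.1, x)) z.2
    + ∑ i, (P.ωf i).indicator (fun x => g i (z.1, x)) z.2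

/-- `y` is a weak solution of the state equation with right-hand side
`h χ_ω + g¹ χ_{ω₁} + g² χ_{ω₂}`. -/
def IsState (g : Fin 2 → ℝ × ℝ → ℝ) (y : SpaceH P.a P.T) : Prop :=
  IsWeakSolution P.a P.F P.T P.y₀ (P.source g) y

open Classical in
/-- The state `y(t, x; h; v¹, v²)`, i.e. the weak solution of the state equation. -/
def state (v : P.Controls) : ℝ → ℝ → ℝ :=
  if hy : ∃ y, P.IsState (fun i => v i) y then hy.choose.val else 0

/-- The cost functional of the follower `i`:
`J_i = α_i/2 ∫∫_{(0,T)×ω_{i,d}} |y - y_{i,d}|² + μ_i/2 ∫∫_{(0,T)×ω_i} |vⁱ|²`. -/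
def cost (i : Fin 2) (v : P.Controls) : ℝ :=
  P.α i / 2 * (∫ z, |P.state v z.1 z.2 - P.yd i z| ^ 2 ∂(volCyl P.T (P.ωd i)))
    + P.μ i / 2 * ∫ z, |v i z| ^ 2 ∂(volCyl P.T (P.ωf i))

/-- `v` is a Nash quasi-equilibrium: for each follower `i`, the directional derivatives of
`J_i` at `v` with respect to its own control `vⁱ` exist and vanish,
`∂J_i/∂vⁱ (h; v¹, v²) · w = 0` for all `w ∈ L²((0,T); L²(ω_i))`. -/
def IsNashQuasiEquilibrium (v : P.Controls) : Prop :=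
  ∀ (i : Fin 2) (w : L2Cyl P.T (P.ωf i)),
    HasLineDerivAt ℝ (fun u => P.cost i (Function.update v i u)) 0 (v i) w

/-- `p` is a weak solution of the adjoint equation of the follower `i`,
`-p_t - (a p_x)_x + D₁F(y,y_x) p - (D₂F(y,y_x) p)_x = α_i (y - y_{i,d}) χ_{ω_{i,d}}` in `Q`,
`p(t,0) = p(t,1) = 0`, `p(T) = 0`. -/
def IsAdjointState (i : Fin 2) (y p : SpaceH P.a P.T) : Prop :=
  IsAdjointWeakSolution P.a
    (fun z => partialD 0 P.F (y.val z.1 z.2, y.dx z.1 z.2))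
    (fun z => partialD 1 P.F (y.val z.1 z.2, y.dx z.1 z.2)) P.T
    (fun z => (P.ωd i).indicator (fun x => P.α i * (y.val z.1 x - P.yd i (z.1, x))) z.2) p

/-- `(y, p¹, p²)` solves the coupled optimality system. -/
def SolvesOptimalitySystem (y : SpaceH P.a P.T) (p : Fin 2 → SpaceH P.a P.T) : Prop :=
  P.IsState (fun i z => -(1 / P.μ i) * (p i).val z.1 z.2) y ∧ ∀ i, P.IsAdjointState i y (p i)

end Data

end StackelbergNash

end

/-!
The proof has two halves: the initial value problems for the degenerate operator are well posed,
and the derivative of a cost functional is then computed by duality.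

*Well-posedness.* Because `x a' ≤ τ a` with `τ < 1`, the weight `1/√a` is square-integrable
(`WeaklyDegenerate.memLp_invSqrt`). So `H¹ₐ(Ω)` consists of the primitives of `w/√a`, where
`w = √a u_x ∈ L²(Ω)` and `w/√a` has mean zero; it embeds compactly into `L²(Ω)`, and the Hardy
inequality `∫ u²/a ≤ ε ∫ a u_x² + C_ε ∫ u²` holds for every `ε > 0` (`WeaklyDegenerate.hardy`).
Compactness gives an orthonormal basis of `L²(Ω)` of eigenfunctions of `-(a u_x)_x` (`EigenBasis`).
Evolution equations are tested with the eigenfunctions only (`BalanceLaw`); this is equivalent to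
the weak formulation (`forward_weak_iff`, `backward_weak_iff`), and summing the product rules of the
coefficients gives the formula for `d/dt (u, v)` (`BalanceLaw.duality`). Linear problems are solved
by Duhamel's formula in each mode (`exists_linear_solution`). For the semilinear equation with lower
order terms `Φ(u, u_x) - (b u)_x`, the lower order terms are frozen; the Hardy inequality with small
`ε` and a weight `e^{-2ρt}` with large `ρ` make the resulting map a contraction
(`exists_energy_estimate`, `exists_contraction`). This gives existence, uniqueness and Lipschitz
dependence on the right-hand side for the state equation, and, after a reversal of time, the
existence of adjoint states.

*The derivative of the cost.* Let `y` be the state for `v`, `y_t` the state after `vⁱ` is replaced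
by `vⁱ + t w`, and `pⁱ` the adjoint state. Testing the equation of `y_t - y` with `pⁱ` yields
`α_i ∫ (y - y_{i,d}) (y_t - y) = t ∫ w pⁱ - R_t`, where `R_t` is the pairing of `pⁱ` with the Taylor
error of `F` at `(y, y_x)` (`integral_mul_sub_eq`). As `y_t - y = O(t)`, dominated convergence shows
`R_t = o(t)` (`tendsto_integral_taylorError`), so no linearized state equation is needed. Hence the
derivative of `J_i` in the direction `w` is `∫ (pⁱ + μ_i vⁱ) w` over `(0,T) × ω_i`
(`Data.Admissible.hasLineDerivAt_cost`). It vanishes for all `w` if and only if `vⁱ = -pⁱ/μ_i`, and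
then the state equation is the first equation of the optimality system.
-/

noncomputable section

namespace StackelbergNash

/-! ### Square-integrable functions -/

section L2

variable {α : Type*} [MeasurableSpace α] {ν : Measure α} {f g : α → ℝ}

lemma integrable_mul_of_memLp_two (hf : MemLp f 2 ν) (hg : MemLp g 2 ν) :
    Integrable (fun x => f x * g x) ν :=
  hf.integrable_mul hg

lemma integral_toLp_mul_toLp (hf : MemLp f 2 ν) (hg : MemLp g 2 ν) :
    inner ℝ (hf.toLp f) (hg.toLp g) = ∫ x, f x * g x ∂ν := by
  rw [L2.inner_def]
  refine integral_congr_ae ?_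
  filter_upwards [hf.coeFn_toLp, hg.coeFn_toLp] with x h1 h2
  simp [h1, h2, mul_comm]

lemma norm_toLp_sq (hf : MemLp f 2 ν) : ‖hf.toLp f‖ ^ 2 = ∫ x, f x ^ 2 ∂ν := by
  rw [← real_inner_self_eq_norm_sq, integral_toLp_mul_toLp]
  simp [sq]

lemma norm_toLp_eq_sqrt (hf : MemLp f 2 ν) : ‖hf.toLp f‖ = √(∫ x, f x ^ 2 ∂ν) := by
  rw [← norm_toLp_sq hf, Real.sqrt_sq (norm_nonneg _)]

/-- The Cauchy–Schwarz inequality in `L²`. -/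
lemma abs_integral_mul_le (hf : MemLp f 2 ν) (hg : MemLp g 2 ν) :
    |∫ x, f x * g x ∂ν| ≤ √(∫ x, f x ^ 2 ∂ν) * √(∫ x, g x ^ 2 ∂ν) := by
  rw [← integral_toLp_mul_toLp hf hg, ← norm_toLp_eq_sqrt hf, ← norm_toLp_eq_sqrt hg]
  exact abs_real_inner_le_norm _ _

lemma eLpNorm_two_eq (hf : MemLp f 2 ν) :
    eLpNorm f 2 ν = ENNReal.ofReal (√(∫ x, f x ^ 2 ∂ν)) := by
  rw [← norm_toLp_eq_sqrt hf, Lp.norm_toLp, ENNReal.ofReal_toReal hf.2.ne]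

lemma sqrt_integral_sq_add_le (hf : MemLp f 2 ν) (hg : MemLp g 2 ν) :
    √(∫ x, (f x + g x) ^ 2 ∂ν) ≤ √(∫ x, f x ^ 2 ∂ν) + √(∫ x, g x ^ 2 ∂ν) := by
  have h := norm_add_le (hf.toLp f) (hg.toLp g)
  rw [← MemLp.toLp_add, norm_toLp_eq_sqrt, norm_toLp_eq_sqrt, norm_toLp_eq_sqrt] at h
  simpa using h

lemma memLp_two_of_abs_le (hg : MemLp g 2 ν) (hf : AEStronglyMeasurable f ν) (C : ℝ)
    (h : ∀ᵐ x ∂ν, |f x| ≤ C * |g x|) : MemLp f 2 ν :=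
  hg.of_le_mul (c := C) hf (by simpa using h)

lemma tendsto_eLpNorm_two_iff {ι : Type*} {l : Filter ι} {f : ι → α → ℝ}
    (hf : ∀ i, MemLp (f i) 2 ν) :
    Tendsto (fun i => eLpNorm (f i) 2 ν) l (𝓝 0) ↔
      Tendsto (fun i => ∫ x, f i x ^ 2 ∂ν) l (𝓝 0) := by
  have h0 : ∀ i, 0 ≤ ∫ x, f i x ^ 2 ∂ν := fun i => integral_nonneg fun x => sq_nonneg _
  simp_rw [fun i => eLpNorm_two_eq (hf i)]
  rw [← ENNReal.ofReal_zero]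
  constructor
  · intro h
    have h2 := (ENNReal.tendsto_toReal (by simp)).comp h
    simp only [Function.comp_def, ENNReal.toReal_ofReal (Real.sqrt_nonneg _)] at h2
    have h3 := h2.pow 2
    simpa [Real.sq_sqrt (h0 _)] using h3
  · intro h
    have := ENNReal.tendsto_ofReal (h.sqrt)
    simpa using this

/-- `∫ fₙ g → ∫ f g` if `fₙ → f` in `L²` and `g ∈ L²`. -/
lemma tendsto_integral_mul {ι : Type*} {l : Filter ι} {F : ι → α → ℝ}
    (hF : ∀ i, MemLp (F i) 2 ν) (hf : MemLp f 2 ν) (hg : MemLp g 2 ν)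
    (h : Tendsto (fun i => ∫ x, (F i x - f x) ^ 2 ∂ν) l (𝓝 0)) :
    Tendsto (fun i => ∫ x, F i x * g x ∂ν) l (𝓝 (∫ x, f x * g x ∂ν)) := by
  rw [tendsto_iff_dist_tendsto_zero]
  have h1 : Tendsto (fun i => √(∫ x, (F i x - f x) ^ 2 ∂ν) * √(∫ x, g x ^ 2 ∂ν)) l (𝓝 0) := by
    simpa using h.sqrt.mul_const (√(∫ x, g x ^ 2 ∂ν))
  refine squeeze_zero (fun _ => dist_nonneg) (fun i => ?_) h1
  rw [Real.dist_eq, ← integral_sub (integrable_mul_of_memLp_two (hF i) hg)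
    (integrable_mul_of_memLp_two hf hg)]
  have := abs_integral_mul_le ((hF i).sub hf) hg
  simpa [sub_mul] using this

lemma ae_eq_zero_of_integral_sq (hf : MemLp f 2 ν) (h : ∫ x, f x ^ 2 ∂ν ≤ 0) : f =ᵐ[ν] 0 := by
  have h0 : ∫ x, f x ^ 2 ∂ν = 0 := le_antisymm h (integral_nonneg fun x => sq_nonneg _)
  rw [integral_eq_zero_iff_of_nonneg (fun x => sq_nonneg _) hf.integrable_sq] at h0
  filter_upwards [h0] with x hx
  simpa using hx

end L2

/-! ### The degenerate weight -/

section Weight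

variable {a : ℝ → ℝ}

/-- The weight `1/√a`, which is square-integrable for a weakly degenerate `a`. -/
def invSqrt (a : ℝ → ℝ) (x : ℝ) : ℝ := (√(a x))⁻¹

lemma WeaklyDegenerate.pos_of_mem (ha : WeaklyDegenerate a) {x : ℝ} (hx : x ∈ Ioo (0 : ℝ) 1) :
    0 < a x := ha.pos x ⟨hx.1, hx.2.le⟩

lemma WeaklyDegenerate.sqrt_mul_invSqrt (ha : WeaklyDegenerate a) {x : ℝ}
    (hx : x ∈ Ioo (0 : ℝ) 1) : √(a x) * invSqrt a x = 1 :=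
  mul_inv_cancel₀ (Real.sqrt_ne_zero'.2 (ha.pos_of_mem hx))

/-- Since `x a' ≤ τ a`, the quotient `a(x) / x^τ` is nonincreasing. -/
lemma WeaklyDegenerate.exists_rpow_le (ha : WeaklyDegenerate a) :
    ∃ τ ∈ Ico (0 : ℝ) 1, ∀ x ∈ Ioc (0 : ℝ) 1, a 1 * x ^ τ ≤ a x := by
  obtain ⟨τ, hτ, h⟩ := ha.deriv_le
  refine ⟨τ, hτ, fun x hx => ?_⟩
  have hsub : Icc x 1 ⊆ Ioc (0 : ℝ) 1 := fun y hy => ⟨hx.1.trans_le hy.1, hy.2⟩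
  have hanti : AntitoneOn (fun y => a y * y ^ (-τ)) (Icc x 1) := by
    refine antitoneOn_of_deriv_nonpos (convex_Icc x 1) ?_ ?_ ?_
    · refine (ha.contDiffOn.continuousOn.mono hsub).mul ?_
      exact fun y hy => (Real.continuousAt_rpow_const _ _ (Or.inl (hsub hy).1.ne')).continuousWithinAt
    · intro y hy
      rw [interior_Icc] at hy
      have hy0 : 0 < y := hx.1.trans hy.1
      have hd : DifferentiableAt ℝ a y :=
        (ha.contDiffOn.differentiableOn (by norm_num) y ⟨hy0, hy.2.le⟩).differentiableAt
          (Ioc_mem_nhds hy0 hy.2)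
      exact (hd.mul (Real.differentiableAt_rpow_const_of_ne _ hy0.ne')).differentiableWithinAt
    · intro y hy
      rw [interior_Icc] at hy
      have hy0 : 0 < y := hx.1.trans hy.1
      have hnhds : Ioc (0 : ℝ) 1 ∈ 𝓝 y := Ioc_mem_nhds hy0 hy.2
      have hd : DifferentiableAt ℝ a y :=
        (ha.contDiffOn.differentiableOn (by norm_num) y ⟨hy0, hy.2.le⟩).differentiableAt hnhds
      have hder := hd.hasDerivAt.mul (Real.hasDerivAt_rpow_const (p := -τ) (Or.inl hy0.ne'))
      have hder' : deriv (fun y => a y * y ^ (-τ)) y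
          = deriv a y * y ^ (-τ) + a y * (-τ * y ^ (-τ - 1)) := hder.deriv
      rw [hder']
      have h1 := h y ⟨hy0, hy.2.le⟩
      rw [derivWithin_of_mem_nhds hnhds] at h1
      have h2 : y ^ (-τ) = y * y ^ (-τ - 1) := by
        rw [Real.rpow_sub_one hy0.ne']; field_simp
      rw [h2]
      have h3 : 0 ≤ y ^ (-τ - 1) := Real.rpow_nonneg hy0.le _
      nlinarith
  have := hanti (left_mem_Icc.2 hx.2) (right_mem_Icc.2 hx.2) hx.2
  simp only [Real.one_rpow, mul_one] at this
  calc a 1 * x ^ τ ≤ a x * x ^ (-τ) * x ^ τ :=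
        mul_le_mul_of_nonneg_right this (Real.rpow_nonneg hx.1.le _)
    _ = a x := by rw [mul_assoc, ← Real.rpow_add hx.1]; simp

lemma WeaklyDegenerate.aestronglyMeasurable_sqrt (ha : WeaklyDegenerate a) :
    AEStronglyMeasurable (fun x => √(a x)) volΩ :=
  ((ha.continuousOn.mono Ioo_subset_Icc_self).aestronglyMeasurable measurableSet_Ioo).aemeasurable.sqrt.aestronglyMeasurable

lemma WeaklyDegenerate.memLp_invSqrt (ha : WeaklyDegenerate a) : MemLp (invSqrt a) 2 volΩ := by
  have hm : AEStronglyMeasurable (invSqrt a) volΩ :=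
    ha.aestronglyMeasurable_sqrt.aemeasurable.inv.aestronglyMeasurable
  rw [memLp_two_iff_integrable_sq hm]
  obtain ⟨τ, hτ, h⟩ := ha.exists_rpow_le
  have h1 : Integrable (fun x : ℝ => (a 1)⁻¹ * x ^ (-τ)) volΩ := by
    refine Integrable.const_mul ?_ _
    have := (intervalIntegral.intervalIntegrable_rpow' (a := 0) (b := 1) (r := -τ)
      (by linarith [hτ.2])).1
    exact this.mono_set Ioo_subset_Ioc_self
  refine h1.mono' (hm.pow 2) ?_
  filter_upwards [ae_restrict_mem measurableSet_Ioo] with x hx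
  have hx' : x ∈ Ioc (0 : ℝ) 1 := ⟨hx.1, hx.2.le⟩
  have ha1 : 0 < a 1 := ha.pos 1 ⟨one_pos, le_rfl⟩
  rw [Real.norm_of_nonneg (sq_nonneg _), invSqrt, inv_pow, Real.sq_sqrt (ha.pos x hx').le,
    Real.rpow_neg hx.1.le, ← mul_inv]
  exact inv_anti₀ (mul_pos ha1 (Real.rpow_pos_of_pos hx.1 _)) (h x hx')

end Weight

/-! ### The weighted space `H¹ₐ` -/

section H1a

variable {a : ℝ → ℝ}

lemma intervalIntegrable_of_integrable {g : ℝ → ℝ} (hg : Integrable g volΩ) {x y : ℝ}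
    (hx : x ∈ Icc (0 : ℝ) 1) (hy : y ∈ Icc (0 : ℝ) 1) : IntervalIntegrable g volume x y := by
  have h01 : IntervalIntegrable g volume 0 1 :=
    (intervalIntegrable_iff_integrableOn_Ioo_of_le zero_le_one).2 hg
  refine h01.mono_set ?_
  rw [uIcc_of_le zero_le_one]
  exact uIcc_subset_Icc hx hy

lemma integral_volΩ_eq (g : ℝ → ℝ) : ∫ x, g x ∂volΩ = ∫ x in (0 : ℝ)..1, g x := by
  rw [intervalIntegral.integral_of_le zero_le_one, integral_Ioc_eq_integral_Ioo]

lemma ae_volΩ_mem : ∀ᵐ x ∂volΩ, x ∈ Ioo (0 : ℝ) 1 := ae_restrict_mem measurableSet_Ioo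

lemma WeaklyDegenerate.integrable_of_memLp (ha : WeaklyDegenerate a) {u' : ℝ → ℝ}
    (h : MemLp (fun x => √(a x) * u' x) 2 volΩ) : Integrable u' volΩ := by
  refine (integrable_mul_of_memLp_two h ha.memLp_invSqrt).congr ?_
  filter_upwards [ae_volΩ_mem] with x hx
  rw [mul_right_comm, ha.sqrt_mul_invSqrt hx, one_mul]

lemma continuousOn_primitive_volΩ {g : ℝ → ℝ} (hg : Integrable g volΩ) :
    ContinuousOn (fun x => ∫ s in (0 : ℝ)..x, g s) (Icc 0 1) := by
  have := intervalIntegral.continuousOn_primitive_interval (μ := volume) (f := g) (a := 0) (b := 1)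
    (by
      rw [uIcc_of_le zero_le_one, integrableOn_Icc_iff_integrableOn_Ioo]; exact hg)
  rwa [uIcc_of_le zero_le_one] at this

lemma memLp_primitive {g : ℝ → ℝ} (hg : Integrable g volΩ) :
    MemLp (fun x => ∫ s in (0 : ℝ)..x, g s) 2 volΩ := by
  have hc := continuousOn_primitive_volΩ hg
  obtain ⟨C, hC⟩ := isCompact_Icc.exists_bound_of_continuousOn hc
  refine MemLp.of_bound ((hc.mono Ioo_subset_Icc_self).aestronglyMeasurable measurableSet_Ioo) C ?_
  filter_upwards [ae_volΩ_mem] with x hx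
  exact hC x (Ioo_subset_Icc_self hx)

/-- Elements of `H¹ₐ(Ω)` are the primitives of the mean-zero functions `u'` with `√a u' ∈ L²`. -/
lemma WeaklyDegenerate.memH1a_iff (ha : WeaklyDegenerate a) {u u' : ℝ → ℝ} :
    MemH1a a u u' ↔ MemLp (fun x => √(a x) * u' x) 2 volΩ ∧ ∫ x, u' x ∂volΩ = 0 ∧
      u =ᵐ[volΩ] fun x => ∫ s in (0 : ℝ)..x, u' s := by
  constructor
  · rintro ⟨-, h2, w, hw, hw0, hw1, huw, hu'⟩
    refine ⟨h2, ?_, ?_⟩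
    · rw [integral_congr_ae hu', integral_volΩ_eq, hw.integral_deriv_eq_sub, hw0, hw1, sub_zero]
    · filter_upwards [huw, ae_volΩ_mem] with x hx hx1
      have hsub : Ioo 0 x ⊆ Ioo (0 : ℝ) 1 := Ioo_subset_Ioo_right hx1.2.le
      have h3 : ∫ s in (0 : ℝ)..x, u' s = ∫ s in (0 : ℝ)..x, deriv w s := by
        rw [intervalIntegral.integral_of_le hx1.1.le, intervalIntegral.integral_of_le hx1.1.le,
          integral_Ioc_eq_integral_Ioo, integral_Ioc_eq_integral_Ioo]
        exact integral_congr_ae (ae_restrict_of_ae_restrict_of_subset hsub hu')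
      rw [h3, hx, (hw.mono (c := 0) (d := x) _).integral_deriv_eq_sub, hw0, sub_zero]
      rw [uIcc_of_le hx1.1.le, uIcc_of_le zero_le_one]
      exact Icc_subset_Icc_right hx1.2.le
  · rintro ⟨h2, h0, hu⟩
    have hint := ha.integrable_of_memLp h2
    have hii := intervalIntegrable_of_integrable hint (left_mem_Icc.2 zero_le_one)
      (right_mem_Icc.2 zero_le_one)
    refine ⟨(memLp_congr_ae hu).2 (memLp_primitive hint), h2, fun x => ∫ s in (0 : ℝ)..x, u' s,
      hii.absolutelyContinuousOnInterval_intervalIntegral (by simp), by simp, ?_, hu, ?_⟩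
    · exact (integral_volΩ_eq u').symm.trans h0
    · rw [EventuallyEq, ae_restrict_iff' measurableSet_Ioo]
      filter_upwards [hii.ae_hasDerivAt_integral] with x hx hx1
      rw [uIcc_of_le zero_le_one] at hx
      exact ((hx (Ioo_subset_Icc_self hx1) 0 (by simp)).deriv).symm

lemma WeaklyDegenerate.memH1a_primitive (ha : WeaklyDegenerate a) {u' : ℝ → ℝ}
    (h : MemLp (fun x => √(a x) * u' x) 2 volΩ) (h0 : ∫ x, u' x ∂volΩ = 0) :
    MemH1a a (fun x => ∫ s in (0 : ℝ)..x, u' s) u' :=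
  ha.memH1a_iff.2 ⟨h, h0, EventuallyEq.rfl⟩

lemma intervalIntegral_eq_integral_indicator {g : ℝ → ℝ} {x y : ℝ} (hy : 0 ≤ y) (hyx : y ≤ x)
    (hx : x ≤ 1) : ∫ s in y..x, g s = ∫ s, (Ioo y x).indicator g s ∂volΩ := by
  rw [intervalIntegral.integral_of_le hyx, integral_Ioc_eq_integral_Ioo,
    integral_indicator measurableSet_Ioo, Measure.restrict_restrict measurableSet_Ioo,
    inter_eq_self_of_subset_left (Ioo_subset_Ioo hy hx)]

lemma intervalIntegral_congr_volΩ {g₁ g₂ : ℝ → ℝ} (h : g₁ =ᵐ[volΩ] g₂) {x y : ℝ} (hy : 0 ≤ y)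
    (hyx : y ≤ x) (hx : x ≤ 1) : ∫ s in y..x, g₁ s = ∫ s in y..x, g₂ s := by
  rw [intervalIntegral_eq_integral_indicator hy hyx hx,
    intervalIntegral_eq_integral_indicator hy hyx hx]
  refine integral_congr_ae ?_
  filter_upwards [h] with s hs
  simp only [indicator]
  split_ifs <;> simp [hs]

/-- `|u(x) - u(y)| ≤ ‖1/√a‖_{L²(y,x)} ‖√a u'‖_{L²}` for the primitive `u` of `u'`. -/
lemma WeaklyDegenerate.abs_intervalIntegral_le (ha : WeaklyDegenerate a) {u' : ℝ → ℝ}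
    (h : MemLp (fun x => √(a x) * u' x) 2 volΩ) {x y : ℝ} (hy : 0 ≤ y) (hyx : y ≤ x)
    (hx : x ≤ 1) : |∫ s in y..x, u' s| ≤
      √(∫ s in y..x, invSqrt a s ^ 2) * √(∫ s, (√(a s) * u' s) ^ 2 ∂volΩ) := by
  rw [intervalIntegral_eq_integral_indicator hy hyx hx,
    intervalIntegral_eq_integral_indicator hy hyx hx]
  have hr : MemLp ((Ioo y x).indicator (invSqrt a)) 2 volΩ :=
    ha.memLp_invSqrt.indicator measurableSet_Ioo
  have h1 : ∫ s, (Ioo y x).indicator u' s ∂volΩ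
      = ∫ s, (Ioo y x).indicator (invSqrt a) s * (√(a s) * u' s) ∂volΩ := by
    refine integral_congr_ae ?_
    filter_upwards [ae_volΩ_mem] with s hs
    by_cases hsx : s ∈ Ioo y x
    · rw [indicator_of_mem hsx, indicator_of_mem hsx, ← mul_assoc, mul_comm (invSqrt a s),
        ha.sqrt_mul_invSqrt hs, one_mul]
    · rw [indicator_of_notMem hsx, indicator_of_notMem hsx, zero_mul]
  have h2 : (fun s => (Ioo y x).indicator (invSqrt a) s ^ 2)
      = (Ioo y x).indicator fun s => invSqrt a s ^ 2 := by
    ext s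
    by_cases hsx : s ∈ Ioo y x
    · simp [indicator_of_mem hsx]
    · simp [indicator_of_notMem hsx]
  rw [h1, ← h2]
  exact abs_integral_mul_le hr h

/-- `H¹ₐ` embeds into the bounded functions. -/
lemma WeaklyDegenerate.abs_primitive_le (ha : WeaklyDegenerate a) {u' : ℝ → ℝ}
    (h : MemLp (fun x => √(a x) * u' x) 2 volΩ) {x : ℝ} (hx : x ∈ Ioo (0 : ℝ) 1) :
    |∫ s in (0 : ℝ)..x, u' s| ≤
      √(∫ s, invSqrt a s ^ 2 ∂volΩ) * √(∫ s, (√(a s) * u' s) ^ 2 ∂volΩ) := by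
  refine (ha.abs_intervalIntegral_le h le_rfl hx.1.le hx.2.le).trans ?_
  refine mul_le_mul_of_nonneg_right (Real.sqrt_le_sqrt ?_) (Real.sqrt_nonneg _)
  rw [intervalIntegral_eq_integral_indicator le_rfl hx.1.le hx.2.le]
  refine integral_mono (ha.memLp_invSqrt.integrable_sq.indicator measurableSet_Ioo)
    ha.memLp_invSqrt.integrable_sq fun s => ?_
  exact indicator_le_self' (fun _ _ => sq_nonneg _) s

lemma WeaklyDegenerate.ae_sq_le (ha : WeaklyDegenerate a) {u u' : ℝ → ℝ} (h : MemH1a a u u') :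
    ∀ᵐ x ∂volΩ, u x ^ 2 ≤ (∫ s, invSqrt a s ^ 2 ∂volΩ) * ∫ s, (√(a s) * u' s) ^ 2 ∂volΩ := by
  obtain ⟨h2, -, hu⟩ := ha.memH1a_iff.1 h
  filter_upwards [hu, ae_volΩ_mem] with x hx hx1
  rw [hx, ← sq_abs, ← Real.sq_sqrt (integral_nonneg fun s => sq_nonneg (invSqrt a s)),
    ← Real.sq_sqrt (integral_nonneg fun s => sq_nonneg (√(a s) * u' s)), ← mul_pow]
  exact pow_le_pow_left₀ (abs_nonneg _) (ha.abs_primitive_le h2 hx1) 2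

/-- A Hardy inequality with arbitrarily small constant in front of the gradient term:
`∫ u²/a ≤ ε ∫ a u'² + C ∫ u²`. It holds since `u` is bounded by its gradient and `1/a` is
integrable. -/
lemma WeaklyDegenerate.hardy (ha : WeaklyDegenerate a) {ε : ℝ} (hε : 0 < ε) :
    ∃ C : ℝ, 0 ≤ C ∧ ∀ u u' : ℝ → ℝ, MemH1a a u u' →
      MemLp (fun x => u x * invSqrt a x) 2 volΩ ∧
      ∫ x, (u x * invSqrt a x) ^ 2 ∂volΩ ≤
        ε * (∫ x, (√(a x) * u' x) ^ 2 ∂volΩ) + C * ∫ x, u x ^ 2 ∂volΩ := by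
  set R := ∫ s, invSqrt a s ^ 2 ∂volΩ with hR
  have hR0 : 0 ≤ R := integral_nonneg fun s => sq_nonneg _
  have hri := ha.memLp_invSqrt.integrable_sq
  -- the part of `1/a` above a high level has small integral
  let tail : ℕ → ℝ → ℝ := fun n x => if (n : ℝ) < invSqrt a x ^ 2 then invSqrt a x ^ 2 else 0
  have htm : ∀ n, AEStronglyMeasurable (tail n) volΩ := fun n => by
    have : AEMeasurable ((fun y : ℝ => if (n : ℝ) < y then y else 0) ∘
        fun x => invSqrt a x ^ 2) volΩ :=
      (Measurable.ite (measurableSet_lt measurable_const measurable_id) measurable_id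
        measurable_const).comp_aemeasurable hri.1.aemeasurable
    exact this.aestronglyMeasurable
  have htle : ∀ n x, ‖tail n x‖ ≤ invSqrt a x ^ 2 := fun n x => by
    simp only [tail]
    split_ifs <;> simp [sq_nonneg]
  have htail : Tendsto (fun n : ℕ => ∫ x, tail n x ∂volΩ) atTop (𝓝 (∫ _, (0 : ℝ) ∂volΩ)) := by
    refine tendsto_integral_of_dominated_convergence (fun x => invSqrt a x ^ 2) htm hri
      (fun n => Eventually.of_forall (htle n)) (Eventually.of_forall fun x => ?_)
    obtain ⟨N, hN⟩ := exists_nat_ge (invSqrt a x ^ 2)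
    refine tendsto_const_nhds.congr' ?_
    filter_upwards [eventually_ge_atTop N] with n hn
    have : (N : ℝ) ≤ n := by exact_mod_cast hn
    exact (if_neg (by linarith)).symm
  rw [integral_zero] at htail
  obtain ⟨n, hn⟩ := ((tendsto_order.1 htail).2 (ε / (R + 1)) (by positivity)).exists
  have hti : Integrable (tail n) volΩ := hri.mono' (htm n) (Eventually.of_forall (htle n))
  refine ⟨n, n.cast_nonneg, fun u u' hu => ?_⟩
  have hb := ha.ae_sq_le hu
  rw [← hR] at hb
  set W := ∫ s, (√(a s) * u' s) ^ 2 ∂volΩ with hW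
  have hW0 : 0 ≤ W := integral_nonneg fun s => sq_nonneg _
  have hm : AEStronglyMeasurable (fun x => u x * invSqrt a x) volΩ :=
    hu.1.1.mul ha.memLp_invSqrt.1
  have hdom : Integrable (fun x => (R * W) * tail n x + n * u x ^ 2) volΩ :=
    (hti.const_mul _).add (hu.1.integrable_sq.const_mul _)
  have hle : ∀ᵐ x ∂volΩ, (u x * invSqrt a x) ^ 2 ≤ (R * W) * tail n x + n * u x ^ 2 := by
    filter_upwards [hb] with x hx
    rw [mul_pow]
    simp only [tail]
    split_ifs with h
    · have := mul_le_mul_of_nonneg_right hx (sq_nonneg (invSqrt a x))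
      have h2 : 0 ≤ (n : ℝ) * u x ^ 2 := by positivity
      linarith
    · have := mul_le_mul_of_nonneg_left (not_lt.1 h) (sq_nonneg (u x))
      linarith
  have hint : Integrable (fun x => (u x * invSqrt a x) ^ 2) volΩ := by
    refine hdom.mono' (hm.pow 2) ?_
    filter_upwards [hle] with x hx
    rwa [Real.norm_of_nonneg (sq_nonneg _)]
  refine ⟨(memLp_two_iff_integrable_sq hm).2 hint, ?_⟩
  refine (integral_mono_ae hint hdom hle).trans ?_
  rw [integral_add (hti.const_mul _) (hu.1.integrable_sq.const_mul _), integral_const_mul,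
    integral_const_mul]
  refine add_le_add_left ?_ _
  have h2 : R * (ε / (R + 1)) ≤ ε := by
    rw [mul_div_assoc', div_le_iff₀ (by positivity)]; nlinarith
  calc R * W * ∫ x, tail n x ∂volΩ ≤ R * W * (ε / (R + 1)) := by gcongr
    _ = R * (ε / (R + 1)) * W := by ring
    _ ≤ ε * W := by gcongr

lemma MemH1a.sub (ha : WeaklyDegenerate a) {u u' v v' : ℝ → ℝ} (hu : MemH1a a u u')
    (hv : MemH1a a v v') : MemH1a a (fun x => u x - v x) (fun x => u' x - v' x) := by
  obtain ⟨h1, h2, h3⟩ := ha.memH1a_iff.1 hu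
  obtain ⟨k1, k2, k3⟩ := ha.memH1a_iff.1 hv
  have i1 := ha.integrable_of_memLp h1
  have i2 := ha.integrable_of_memLp k1
  refine ha.memH1a_iff.2 ⟨?_, ?_, ?_⟩
  · simpa [mul_sub, Pi.sub_def] using h1.sub k1
  · rw [integral_sub i1 i2, h2, k2, sub_zero]
  · filter_upwards [h3, k3, ae_volΩ_mem] with x e1 e2 hx
    have h0 : (0 : ℝ) ∈ Icc (0 : ℝ) 1 := left_mem_Icc.2 zero_le_one
    rw [e1, e2, intervalIntegral.integral_sub
      (intervalIntegrable_of_integrable i1 h0 (Ioo_subset_Icc_self hx))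
      (intervalIntegrable_of_integrable i2 h0 (Ioo_subset_Icc_self hx))]

lemma MemH1a.const_mul (ha : WeaklyDegenerate a) {u u' : ℝ → ℝ} (hu : MemH1a a u u') (c : ℝ) :
    MemH1a a (fun x => c * u x) (fun x => c * u' x) := by
  obtain ⟨h1, h2, h3⟩ := ha.memH1a_iff.1 hu
  refine ha.memH1a_iff.2 ⟨?_, ?_, ?_⟩
  · simpa [mul_left_comm] using h1.const_mul c
  · rw [integral_const_mul, h2, mul_zero]
  · filter_upwards [h3] with x e1
    rw [e1, intervalIntegral.integral_const_mul]

lemma MemH1a.finset_sum (ha : WeaklyDegenerate a) {ι : Type*} (s : Finset ι)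
    {u u' : ι → ℝ → ℝ} (hu : ∀ i, MemH1a a (u i) (u' i)) :
    MemH1a a (fun x => ∑ i ∈ s, u i x) (fun x => ∑ i ∈ s, u' i x) := by
  have h1 := fun i => (ha.memH1a_iff.1 (hu i)).1
  have h2 := fun i => (ha.memH1a_iff.1 (hu i)).2.1
  have h3 := fun i => (ha.memH1a_iff.1 (hu i)).2.2
  have i1 := fun i => ha.integrable_of_memLp (h1 i)
  refine ha.memH1a_iff.2 ⟨?_, ?_, ?_⟩
  · simpa [Finset.mul_sum] using memLp_finsetSum s fun i _ => h1 i
  · rw [integral_finsetSum s fun i _ => i1 i]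
    exact Finset.sum_eq_zero fun i _ => h2 i
  · have h4 : ∀ᵐ x ∂volΩ, ∀ i ∈ s, u i x = ∫ y in (0 : ℝ)..x, u' i y :=
      (s.eventually_all).2 fun i _ => h3 i
    filter_upwards [h4, ae_volΩ_mem] with x e1 hx
    have h0 : (0 : ℝ) ∈ Icc (0 : ℝ) 1 := left_mem_Icc.2 zero_le_one
    rw [intervalIntegral.integral_finsetSum fun i _ =>
      intervalIntegrable_of_integrable (i1 i) h0 (Ioo_subset_Icc_self hx)]
    exact Finset.sum_congr rfl e1

end H1a

/-! ### Diagonalization of a compact embedding of Hilbert spaces -/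

section CompactEmbedding

lemma _root_.Orthonormal.countable_index {ι H : Type*} [NormedAddCommGroup H]
    [InnerProductSpace ℝ H] [TopologicalSpace.SeparableSpace H] {v : ι → H}
    (hv : Orthonormal ℝ v) : Countable ι := by
  refine Pairwise.countable_of_isOpen_disjoint (s := fun i => Metric.ball (v i) (1 / 2)) ?_
    (fun _ => Metric.isOpen_ball) fun i => ⟨v i, Metric.mem_ball_self (by norm_num)⟩
  intro i j hij
  refine Metric.ball_disjoint_ball ?_
  have h : ‖v i - v j‖ ^ 2 = 2 := by
    rw [norm_sub_sq_real, hv.1 i, hv.1 j, hv.2 hij]; norm_num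
  rw [dist_eq_norm]
  nlinarith [norm_nonneg (v i - v j)]

variable {H W : Type} [NormedAddCommGroup H] [InnerProductSpace ℝ H] [CompleteSpace H]
  [NormedAddCommGroup W] [InnerProductSpace ℝ W] [CompleteSpace W]

/-- A compact self-adjoint operator on a separable Hilbert space has a countable Hilbert basis of
eigenvectors. -/
theorem exists_hilbertBasis_eigenvectors [TopologicalSpace.SeparableSpace H] {S : H →L[ℝ] H}
    (hc : IsCompactOperator S) (hs : S.IsSymmetric) :
    ∃ (ι : Type) (_ : Countable ι) (e : HilbertBasis ι ℝ H) (ν : ι → ℝ),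
      ∀ i, S (e i) = ν i • e i := by
  have hcl : ∀ μ : ℝ, IsClosed (Module.End.eigenspace (S : Module.End ℝ H) μ : Set H) := fun μ => by
    have : (Module.End.eigenspace (S : Module.End ℝ H) μ : Set H) = {x | S x = μ • x} := by
      ext x; simp
    rw [this]
    exact isClosed_eq S.continuous (continuous_const_smul μ)
  have : ∀ μ : ℝ, CompleteSpace (Module.End.eigenspace (S : Module.End ℝ H) μ) :=
    fun μ => (hcl μ).completeSpace_coe
  choose s b hb using fun μ : ℝ =>
    exists_hilbertBasis ℝ (Module.End.eigenspace (S : Module.End ℝ H) μ)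
  let v : (Σ μ : ℝ, s μ) → H := fun p => (p.2 : Module.End.eigenspace (S : Module.End ℝ H) p.1)
  have hv : Orthonormal ℝ v := by
    have := hs.orthogonalFamily_eigenspaces.orthonormal_sigma_orthonormal
      (v_family := fun μ => (b μ : s μ → _)) fun μ => (b μ).orthonormal
    simpa [hb, v] using this
  have hsp : (Submodule.span ℝ (Set.range v))ᗮ = ⊥ := by
    rw [eq_bot_iff, ← ContinuousLinearMap.orthogonalComplement_iSup_eigenspaces_eq_bot hc hs]
    intro h hh
    rw [Submodule.mem_orthogonal] at hh ⊢
    intro u hu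
    refine Submodule.iSup_induction _ (motive := fun u => inner ℝ u h = 0) hu (fun μ x hx => ?_)
      (by simp) (fun x y hx hy => by rw [inner_add_left, hx, hy, add_zero])
    have hsum := (b μ).hasSum_repr ⟨x, hx⟩
    have hsum2 := (hsum.mapL (Submodule.subtypeL _)).mapL (innerSL ℝ h)
    have hz : ∀ i : s μ, (innerSL ℝ h) ((Submodule.subtypeL
        (Module.End.eigenspace (S : Module.End ℝ H) μ)) ((b μ).repr ⟨x, hx⟩ i • b μ i)) = 0 := by
      intro i
      have h1 := hh (v ⟨μ, i⟩) (Submodule.subset_span ⟨_, rfl⟩)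
      rw [map_smul, map_smul, hb, innerSL_apply_apply, real_inner_comm]
      rw [show ((Submodule.subtypeL (Module.End.eigenspace (S : Module.End ℝ H) μ))
        ((fun x : s μ => (x : Module.End.eigenspace (S : Module.End ℝ H) μ)) i) : H) = v ⟨μ, i⟩
        from rfl, h1, smul_zero]
    simp_rw [hz] at hsum2
    rw [real_inner_comm]
    exact (hsum2.unique hasSum_zero)
  refine ⟨_, hv.countable_index, HilbertBasis.mkOfOrthogonalEqBot hv hsp, fun p => p.1, fun p => ?_⟩
  rw [HilbertBasis.coe_mkOfOrthogonalEqBot]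
  exact Module.End.mem_eigenspace_iff.1
    ((p.2 : Module.End.eigenspace (S : Module.End ℝ H) p.1)).2

/-- Simultaneous diagonalization of the inner products of `H` and of a densely and compactly
embedded Hilbert space `T : W → H`. -/
theorem exists_hilbertBasis_of_compact_embedding [TopologicalSpace.SeparableSpace H]
    {T : W →L[ℝ] H} (hc : IsCompactOperator T)
    (hinj : ∀ ψ, T ψ = 0 → ψ = 0) (hdense : ∀ h, (∀ ψ, inner ℝ h (T ψ) = 0) → h = 0) :
    ∃ (ι : Type) (_ : Countable ι) (e : HilbertBasis ι ℝ H) (lam : ι → ℝ) (f : HilbertBasis ι ℝ W),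
      (∀ i, 0 < lam i) ∧ (∀ i, T (√(lam i) • f i) = e i) ∧
      ∀ i ψ, inner ℝ (√(lam i) • f i) ψ = lam i * inner ℝ (e i) (T ψ) := by
  have hSc : IsCompactOperator (T ∘L T.adjoint) := hc.comp_clm T.adjoint
  have hSs : (T ∘L T.adjoint).IsSymmetric := fun x y => by
    change inner ℝ (T (T.adjoint x)) y = inner ℝ x (T (T.adjoint y))
    rw [← ContinuousLinearMap.adjoint_inner_right, ContinuousLinearMap.adjoint_inner_left]
  obtain ⟨ι, hι, e, ν, he⟩ := exists_hilbertBasis_eigenvectors hSc hSs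
  have hν : ∀ i, ν i = ‖T.adjoint (e i)‖ ^ 2 := fun i => by
    have h1 : inner ℝ (e i) ((T ∘L T.adjoint) (e i)) = ν i := by
      rw [he, inner_smul_right, real_inner_self_eq_norm_sq, e.orthonormal.1 i]; simp
    rw [← h1, ContinuousLinearMap.comp_apply, ← ContinuousLinearMap.adjoint_inner_left,
      real_inner_self_eq_norm_sq]
  have hpos : ∀ i, 0 < ν i := fun i => by
    rw [hν]
    refine pow_pos (norm_pos_iff.2 fun h0 => ?_) 2
    have : e i = 0 := hdense _ fun ψ => by
      rw [← ContinuousLinearMap.adjoint_inner_left, h0, inner_zero_left]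
    have h2 := e.orthonormal.1 i
    rw [this, norm_zero] at h2
    exact zero_ne_one h2
  have hsq : ∀ i, √(ν i) * √(ν i) = ν i := fun i => Real.mul_self_sqrt (hpos i).le
  have hsp : ∀ i, 0 < √(ν i) := fun i => Real.sqrt_pos.2 (hpos i)
  let f : ι → W := fun i => (√(ν i))⁻¹ • T.adjoint (e i)
  have hf : ∀ i ψ, inner ℝ (f i) ψ = (√(ν i))⁻¹ * inner ℝ (e i) (T ψ) := fun i ψ => by
    rw [real_inner_smul_left, ContinuousLinearMap.adjoint_inner_left]
  have hTf : ∀ i, T (f i) = √(ν i) • e i := fun i => by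
    have : T (T.adjoint (e i)) = ν i • e i := he i
    rw [map_smul, this, smul_smul]
    congr 1
    rw [inv_mul_eq_iff_eq_mul₀ (hsp i).ne', hsq]
  have hfo : Orthonormal ℝ f := by
    classical
    rw [orthonormal_iff_ite]
    intro i j
    rw [hf, hTf, inner_smul_right, (orthonormal_iff_ite.1 e.orthonormal) i j]
    split_ifs with h
    · subst h
      rw [mul_one, inv_mul_cancel₀ (hsp _).ne']
    · simp
  have hfs : (Submodule.span ℝ (Set.range f))ᗮ = ⊥ := by
    rw [eq_bot_iff]
    intro ψ hψ
    rw [Submodule.mem_orthogonal] at hψ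
    refine hinj ψ ?_
    have h0 : ∀ i, inner ℝ (e i) (T ψ) = 0 := fun i => by
      have := hψ (f i) (Submodule.subset_span ⟨i, rfl⟩)
      rw [hf] at this
      exact (mul_eq_zero.1 this).resolve_left (inv_ne_zero (hsp i).ne')
    have := e.hasSum_repr (T ψ)
    simp_rw [HilbertBasis.repr_apply_apply, h0, zero_smul] at this
    exact this.unique hasSum_zero
  have hl : ∀ i, √((ν i)⁻¹) = (√(ν i))⁻¹ := fun i => Real.sqrt_inv _
  refine ⟨ι, hι, e, fun i => (ν i)⁻¹, HilbertBasis.mkOfOrthogonalEqBot hfo hfs,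
    fun i => inv_pos.2 (hpos i), fun i => ?_, fun i ψ => ?_⟩
  · rw [HilbertBasis.coe_mkOfOrthogonalEqBot, map_smul, hTf, smul_smul, hl,
      inv_mul_cancel₀ (hsp i).ne', one_smul]
  · rw [HilbertBasis.coe_mkOfOrthogonalEqBot, real_inner_smul_left, hf, hl, ← mul_assoc, ← mul_inv,
      hsq]

end CompactEmbedding

lemma isCompactOperator_smulRight {H W : Type} [NormedAddCommGroup H] [InnerProductSpace ℝ H]
    [NormedAddCommGroup W] [InnerProductSpace ℝ W] (ℓ : W →L[ℝ] ℝ) (h : H) :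
    IsCompactOperator (ℓ.smulRight h) := by
  have h1 : IsCompactOperator (id ∘ ℓ : W → ℝ) := isCompactOperator_id.comp_clm ℓ
  exact h1.clm_comp (ContinuousLinearMap.toSpanSingleton ℝ h)

/-! ### Compactness of the embedding of `H¹ₐ(Ω)` into `L²(Ω)` -/

section Primitive

variable {a : ℝ → ℝ}

lemma WeaklyDegenerate.sqrt_mul_mul_invSqrt (ha : WeaklyDegenerate a) (g : ℝ → ℝ) :
    (fun x => √(a x) * (g x * invSqrt a x)) =ᵐ[volΩ] g := by
  filter_upwards [ae_volΩ_mem] with x hx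
  rw [mul_left_comm, ha.sqrt_mul_invSqrt hx, mul_one]

lemma WeaklyDegenerate.memLp_sqrt_mul (ha : WeaklyDegenerate a) {g : ℝ → ℝ}
    (hg : MemLp g 2 volΩ) : MemLp (fun x => √(a x) * (g x * invSqrt a x)) 2 volΩ :=
  (memLp_congr_ae (ha.sqrt_mul_mul_invSqrt g)).2 hg

lemma WeaklyDegenerate.integral_sqrt_mul_sq (ha : WeaklyDegenerate a) (g : ℝ → ℝ) :
    ∫ x, (√(a x) * (g x * invSqrt a x)) ^ 2 ∂volΩ = ∫ x, g x ^ 2 ∂volΩ := by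
  refine integral_congr_ae ?_
  filter_upwards [ha.sqrt_mul_mul_invSqrt g] with x hx
  rw [hx]

lemma WeaklyDegenerate.integrable_mul_invSqrt (ha : WeaklyDegenerate a) (g : Lp ℝ 2 volΩ) :
    Integrable (fun x => g x * invSqrt a x) volΩ :=
  integrable_mul_of_memLp_two (Lp.memLp g) ha.memLp_invSqrt

lemma integral_coeFn_sq {α : Type*} [MeasurableSpace α] {ν : Measure α} (g : Lp ℝ 2 ν) :
    ∫ x, g x ^ 2 ∂ν = ‖g‖ ^ 2 := by
  rw [← norm_toLp_sq (Lp.memLp g), Lp.toLp_coeFn]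

lemma inner_eq_integral {α : Type*} [MeasurableSpace α] {ν : Measure α} (f g : Lp ℝ 2 ν) :
    inner ℝ f g = ∫ x, f x * g x ∂ν := by
  rw [← integral_toLp_mul_toLp (Lp.memLp f) (Lp.memLp g), Lp.toLp_coeFn, Lp.toLp_coeFn]

lemma norm_le_of_ae_bound_volΩ {g : Lp ℝ 2 volΩ} {C : ℝ} (hC : 0 ≤ C) (h : ∀ᵐ x ∂volΩ, |g x| ≤ C) :
    ‖g‖ ≤ C := by
  have h1 : measureUnivNNReal volΩ = 1 := by
    rw [measureUnivNNReal, Measure.restrict_apply_univ, Real.volume_Ioo]; simp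
  have := Lp.norm_le_of_ae_bound (f := g) hC (by simpa using h)
  rwa [h1, NNReal.coe_one, Real.one_rpow, one_mul] at this

/-- The operator `g ↦ ∫₀ˣ g/√a` on `L²(Ω)`. On the orthogonal complement of `1/√a` it is the
parametrization of `H¹ₐ(Ω)` by `g = √a u'`. -/
def primitiveOp (ha : WeaklyDegenerate a) : Lp ℝ 2 volΩ →L[ℝ] Lp ℝ 2 volΩ :=
  LinearMap.mkContinuous
    { toFun := fun g => (memLp_primitive (ha.integrable_mul_invSqrt g)).toLp _
      map_add' := fun f g => by
        rw [← MemLp.toLp_add, MemLp.toLp_eq_toLp_iff]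
        filter_upwards [ae_volΩ_mem] with x hx
        have h0 : (0 : ℝ) ∈ Icc (0 : ℝ) 1 := left_mem_Icc.2 zero_le_one
        rw [Pi.add_apply, ← intervalIntegral.integral_add
          (intervalIntegrable_of_integrable (ha.integrable_mul_invSqrt f) h0
            (Ioo_subset_Icc_self hx))
          (intervalIntegrable_of_integrable (ha.integrable_mul_invSqrt g) h0
            (Ioo_subset_Icc_self hx))]
        refine intervalIntegral_congr_volΩ ?_ le_rfl hx.1.le hx.2.le
        filter_upwards [Lp.coeFn_add f g] with s hs
        rw [hs, Pi.add_apply, add_mul]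
      map_smul' := fun c g => by
        rw [RingHom.id_apply, ← MemLp.toLp_const_smul, MemLp.toLp_eq_toLp_iff]
        filter_upwards [ae_volΩ_mem] with x hx
        rw [Pi.smul_apply, smul_eq_mul, ← intervalIntegral.integral_const_mul]
        refine intervalIntegral_congr_volΩ ?_ le_rfl hx.1.le hx.2.le
        filter_upwards [Lp.coeFn_smul c g] with s hs
        rw [hs, Pi.smul_apply, smul_eq_mul, mul_assoc] }
    (√(∫ s, invSqrt a s ^ 2 ∂volΩ)) fun g => by
      change ‖(memLp_primitive (ha.integrable_mul_invSqrt g)).toLp _‖ ≤ _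
      refine norm_le_of_ae_bound_volΩ (by positivity) ?_
      filter_upwards [MemLp.coeFn_toLp (memLp_primitive (ha.integrable_mul_invSqrt g)),
        ae_volΩ_mem] with x hx hx1
      rw [hx]
      have := ha.abs_primitive_le (ha.memLp_sqrt_mul (Lp.memLp g)) hx1
      rwa [ha.integral_sqrt_mul_sq, integral_coeFn_sq, Real.sqrt_sq (norm_nonneg _)] at this

lemma primitiveOp_apply (ha : WeaklyDegenerate a) (g : Lp ℝ 2 volΩ) :
    primitiveOp ha g =ᵐ[volΩ] fun x => ∫ s in (0 : ℝ)..x, g s * invSqrt a s :=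
  MemLp.coeFn_toLp (memLp_primitive (ha.integrable_mul_invSqrt g))

/-- The function `1_{(0,y)}/√a`, which represents the functional `g ↦ ∫₀ʸ g/√a`. -/
def cutoffWeight (ha : WeaklyDegenerate a) (y : ℝ) : Lp ℝ 2 volΩ :=
  (ha.memLp_invSqrt.indicator (measurableSet_Ioo (a := 0) (b := y))).toLp _

lemma coeFn_cutoffWeight (ha : WeaklyDegenerate a) (y : ℝ) :
    cutoffWeight ha y =ᵐ[volΩ] (Ioo 0 y).indicator (invSqrt a) :=
  MemLp.coeFn_toLp _

lemma inner_cutoffWeight (ha : WeaklyDegenerate a) {y : ℝ} (hy : y ∈ Icc (0 : ℝ) 1)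
    (g : Lp ℝ 2 volΩ) :
    inner ℝ (cutoffWeight ha y) g = ∫ s in (0 : ℝ)..y, g s * invSqrt a s := by
  rw [inner_eq_integral, intervalIntegral_eq_integral_indicator le_rfl hy.1 hy.2]
  refine integral_congr_ae ?_
  filter_upwards [coeFn_cutoffWeight ha y] with s hs
  rw [hs]
  simp only [indicator]
  split_ifs <;> ring

/-- The indicator function of `[j/n, (j+1)/n)`. -/
def stepLp (n j : ℕ) : Lp ℝ 2 volΩ :=
  indicatorConstLp 2 (s := Ico ((j : ℝ) / n) ((j + 1 : ℝ) / n)) measurableSet_Ico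
    (measure_ne_top _ _) (1 : ℝ)

/-- The finite rank approximation of `primitiveOp` that rounds the upper endpoint of the integral
down to a multiple of `1/n`. -/
def roundedPrimitiveOp (ha : WeaklyDegenerate a) (n : ℕ) : Lp ℝ 2 volΩ →L[ℝ] Lp ℝ 2 volΩ :=
  ∑ j ∈ Finset.range n, (innerSL ℝ (cutoffWeight ha (j / n))).smulRight (stepLp n j)

lemma isCompactOperator_roundedPrimitiveOp (ha : WeaklyDegenerate a) (n : ℕ) :
    IsCompactOperator (roundedPrimitiveOp ha n) := by
  have : roundedPrimitiveOp ha n ∈ compactOperator (RingHom.id ℝ) (Lp ℝ 2 volΩ) (Lp ℝ 2 volΩ) :=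
    Submodule.sum_mem _ fun j _ => isCompactOperator_smulRight _ _
  exact this

lemma roundedPrimitiveOp_apply (ha : WeaklyDegenerate a) {n : ℕ} (hn : 0 < n) (g : Lp ℝ 2 volΩ) :
    ∀ᵐ x ∂volΩ, roundedPrimitiveOp ha n g x
      = ∫ s in (0 : ℝ)..(⌊n * x⌋₊ / n : ℝ), g s * invSqrt a s := by
  have hn' : (0 : ℝ) < n := by exact_mod_cast hn
  let c : ℕ → ℝ := fun j => inner ℝ (cutoffWeight ha (j / n)) g
  have h1 : roundedPrimitiveOp ha n g = ∑ j ∈ Finset.range n, c j • stepLp n j := by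
    simp only [roundedPrimitiveOp, _root_.sum_apply,
      ContinuousLinearMap.smulRight_apply, innerSL_apply_apply, c]
  have h2 : ∀ᵐ x ∂volΩ, ∀ j ∈ Finset.range n,
      stepLp n j x = (Ico ((j : ℝ) / n) ((j + 1 : ℝ) / n)).indicator (fun _ => (1 : ℝ)) x :=
    (Finset.eventually_all _).2 fun j _ => indicatorConstLp_coeFn
  have h3 : ∀ᵐ x ∂volΩ, ∀ j ∈ Finset.range n, (c j • stepLp n j : Lp ℝ 2 volΩ) x
      = c j * stepLp n j x :=
    (Finset.eventually_all _).2 fun j _ => Lp.coeFn_smul _ _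
  have h4 := Lp.coeFn_finsetSum (Finset.range n) (fun j => c j • stepLp n j)
  rw [h1]
  filter_upwards [h2, h3, h4, ae_volΩ_mem] with x e2 e3 e4 hx
  have hnx : (0 : ℝ) ≤ n * x := by have := hx.1; positivity
  have hfl : (⌊n * x⌋₊ : ℝ) ≤ n * x := Nat.floor_le hnx
  have hfl2 : (n * x : ℝ) < ⌊n * x⌋₊ + 1 := Nat.lt_floor_add_one _
  have hj : ⌊n * x⌋₊ < n := by
    rw [Nat.floor_lt hnx]
    nlinarith [hx.2]
  rw [e4, Finset.sum_apply, Finset.sum_eq_single ⌊n * x⌋₊]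
  · rw [e3 _ (Finset.mem_range.2 hj), e2 _ (Finset.mem_range.2 hj), indicator_of_mem, mul_one]
    · refine inner_cutoffWeight ha ⟨by positivity, ?_⟩ g
      rw [div_le_one hn']
      exact_mod_cast hj.le
    · refine ⟨?_, ?_⟩
      · rw [div_le_iff₀ hn']; linarith
      · rw [lt_div_iff₀ hn']; linarith
  · intro j hjn hne
    rw [e3 _ hjn, e2 _ hjn, indicator_of_notMem, mul_zero]
    rintro ⟨h5, h6⟩
    rw [div_le_iff₀ hn'] at h5
    rw [lt_div_iff₀ hn'] at h6
    refine hne (Eq.symm ((Nat.floor_eq_iff hnx).2 ⟨?_, ?_⟩)) <;> linarith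
  · intro h
    exact absurd (Finset.mem_range.2 hj) h

/-- The finite rank approximations `roundedPrimitiveOp` converge in operator norm, because
`x ↦ ∫₀ˣ 1/a` is uniformly continuous. -/
theorem isCompactOperator_primitiveOp (ha : WeaklyDegenerate a) :
    IsCompactOperator (primitiveOp ha) := by
  refine isCompactOperator_of_tendsto (F := roundedPrimitiveOp ha) (l := atTop) ?_
    (Eventually.of_forall (isCompactOperator_roundedPrimitiveOp ha))
  rw [Metric.tendsto_atTop]
  intro ε hε
  have huc := isCompact_Icc.uniformContinuousOn_of_continuous
    (continuousOn_primitive_volΩ ha.memLp_invSqrt.integrable_sq)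
  rw [Metric.uniformContinuousOn_iff] at huc
  obtain ⟨δ, hδ, huc⟩ := huc ((ε / 2) ^ 2) (by positivity)
  obtain ⟨N, hN⟩ := exists_nat_gt (1 / δ)
  refine ⟨N + 1, fun n hn => ?_⟩
  have hn0 : 0 < n := by omega
  have hn' : (0 : ℝ) < n := by exact_mod_cast hn0
  have hnδ : 1 / δ < n := hN.trans (by exact_mod_cast hn)
  rw [dist_comm, dist_eq_norm]
  refine lt_of_le_of_lt (ContinuousLinearMap.opNorm_le_bound _ (M := ε / 2) (by positivity)
    fun g => ?_) (half_lt_self hε)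
  refine norm_le_of_ae_bound_volΩ (by positivity) ?_
  rw [_root_.sub_apply]
  filter_upwards [Lp.coeFn_sub (primitiveOp ha g) (roundedPrimitiveOp ha n g),
    primitiveOp_apply ha g, roundedPrimitiveOp_apply ha hn0 g,
    ae_volΩ_mem] with x e1 e2 e3 hx
  have hfl : (⌊n * x⌋₊ : ℝ) ≤ n * x := Nat.floor_le (by have := hx.1; positivity)
  have hfl2 : (n * x : ℝ) < ⌊n * x⌋₊ + 1 := Nat.lt_floor_add_one _
  set y : ℝ := ⌊n * x⌋₊ / n with hy
  have hy0 : 0 ≤ y := by positivity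
  have hyx : y ≤ x := by rw [hy, div_le_iff₀ hn']; linarith
  have hxy : x - y < δ := by
    have h5 : x - y < 1 / n := by
      rw [sub_lt_iff_lt_add', hy, ← add_div, lt_div_iff₀ hn']; linarith
    have h6 : 1 / (n : ℝ) < δ := by
      rw [div_lt_iff₀ hn', ← div_lt_iff₀' hδ]; exact hnδ
    exact h5.trans h6
  have h0 : (0 : ℝ) ∈ Icc (0 : ℝ) 1 := left_mem_Icc.2 zero_le_one
  have hyI : y ∈ Icc (0 : ℝ) 1 := ⟨hy0, hyx.trans hx.2.le⟩
  have hxI : x ∈ Icc (0 : ℝ) 1 := Ioo_subset_Icc_self hx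
  have hgi := ha.integrable_mul_invSqrt g
  rw [e1, Pi.sub_apply, e2, e3, intervalIntegral.integral_interval_sub_left
    (intervalIntegrable_of_integrable hgi h0 hxI) (intervalIntegrable_of_integrable hgi h0 hyI)]
  have h7 := ha.abs_intervalIntegral_le (ha.memLp_sqrt_mul (Lp.memLp g)) hy0 hyx hx.2.le
  rw [ha.integral_sqrt_mul_sq, integral_coeFn_sq, Real.sqrt_sq (norm_nonneg _)] at h7
  refine h7.trans (mul_le_mul_of_nonneg_right ?_ (norm_nonneg _))
  have h8 := huc x hxI y hyI (by rw [Real.dist_eq, abs_of_nonneg (by linarith)]; exact hxy)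
  have hri := ha.memLp_invSqrt.integrable_sq
  rw [Real.dist_eq, intervalIntegral.integral_interval_sub_left
    (intervalIntegrable_of_integrable hri h0 hxI) (intervalIntegrable_of_integrable hri h0 hyI)] at h8
  rw [Real.sqrt_le_left (by positivity)]
  exact (le_abs_self _).trans h8.le

end Primitive

/-! ### The eigenfunctions of the degenerate operator -/

section Eigenfunctions

variable {a : ℝ → ℝ}

lemma ae_eq_zero_of_primitive_ae_const {g : ℝ → ℝ} (hg : Integrable g volΩ) {c : ℝ}
    (h : (fun x => ∫ s in (0 : ℝ)..x, g s) =ᵐ[volΩ] fun _ => c) : g =ᵐ[volΩ] 0 := by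
  have heq := Measure.eqOn_open_of_ae_eq h isOpen_Ioo
    ((continuousOn_primitive_volΩ hg).mono Ioo_subset_Icc_self) continuousOn_const
  have hii := intervalIntegrable_of_integrable hg (left_mem_Icc.2 zero_le_one)
      (right_mem_Icc.2 zero_le_one)
  rw [EventuallyEq, ae_restrict_iff' measurableSet_Ioo]
  filter_upwards [hii.ae_hasDerivAt_integral] with x hx hx1
  rw [uIcc_of_le zero_le_one] at hx
  have h1 := hx (Ioo_subset_Icc_self hx1) 0 (by simp)
  have h2 : HasDerivAt (fun x => ∫ s in (0 : ℝ)..x, g s) 0 x :=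
    (hasDerivAt_const x c).congr_of_eventuallyEq (heq.eventuallyEq_of_mem (Ioo_mem_nhds hx1.1 hx1.2))
  exact h1.unique h2

/-- The space of the functions `√a u'` for `u ∈ H¹ₐ(Ω)`: the orthogonal complement of `1/√a`
in `L²(Ω)`. With the norm of `L²(Ω)`, it is the model of the Hilbert space `H¹ₐ(Ω)`. -/
def gradSpace (ha : WeaklyDegenerate a) : Submodule ℝ (Lp ℝ 2 volΩ) :=
  (ℝ ∙ (ha.memLp_invSqrt.toLp (invSqrt a)))ᗮ

instance (ha : WeaklyDegenerate a) : CompleteSpace (gradSpace ha) :=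
  inferInstanceAs (CompleteSpace (ℝ ∙ (ha.memLp_invSqrt.toLp (invSqrt a)))ᗮ)

lemma mem_gradSpace_iff (ha : WeaklyDegenerate a) {g : Lp ℝ 2 volΩ} :
    g ∈ gradSpace ha ↔ ∫ x, g x * invSqrt a x ∂volΩ = 0 := by
  rw [gradSpace, Submodule.mem_orthogonal_singleton_iff_inner_left]
  have : inner ℝ g (ha.memLp_invSqrt.toLp (invSqrt a)) = ∫ x, g x * invSqrt a x ∂volΩ := by
    rw [← integral_toLp_mul_toLp (Lp.memLp g) ha.memLp_invSqrt, Lp.toLp_coeFn]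
  rw [this]

/-- The embedding of `H¹ₐ(Ω)` into `L²(Ω)`, which maps `√a u'` to `u`. -/
def embedding (ha : WeaklyDegenerate a) : gradSpace ha →L[ℝ] Lp ℝ 2 volΩ :=
  primitiveOp ha ∘L (gradSpace ha).subtypeL

lemma isCompactOperator_embedding (ha : WeaklyDegenerate a) : IsCompactOperator (embedding ha) :=
  (isCompactOperator_primitiveOp ha).comp_clm _

lemma embedding_apply (ha : WeaklyDegenerate a) (ψ : gradSpace ha) :
    embedding ha ψ =ᵐ[volΩ] fun x => ∫ s in (0 : ℝ)..x, (ψ : Lp ℝ 2 volΩ) s * invSqrt a s :=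
  primitiveOp_apply ha ψ

lemma memH1a_embedding (ha : WeaklyDegenerate a) (ψ : gradSpace ha) :
    MemH1a a (embedding ha ψ) fun x => (ψ : Lp ℝ 2 volΩ) x * invSqrt a x :=
  ha.memH1a_iff.2 ⟨ha.memLp_sqrt_mul (Lp.memLp _), (mem_gradSpace_iff ha).1 ψ.2,
    embedding_apply ha ψ⟩

/-- The element `√a u'` of `gradSpace` for `u ∈ H¹ₐ(Ω)`. -/
def MemH1a.grad (ha : WeaklyDegenerate a) {u u' : ℝ → ℝ} (h : MemH1a a u u') : gradSpace ha :=
  ⟨h.2.1.toLp _, (mem_gradSpace_iff ha).2 (by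
    refine (integral_congr_ae ?_).trans (ha.memH1a_iff.1 h).2.1
    filter_upwards [h.2.1.coeFn_toLp, ae_volΩ_mem] with x hx hx1
    rw [hx, mul_right_comm, ha.sqrt_mul_invSqrt hx1, one_mul])⟩

lemma MemH1a.coeFn_grad (ha : WeaklyDegenerate a) {u u' : ℝ → ℝ} (h : MemH1a a u u') :
    (h.grad ha : Lp ℝ 2 volΩ) =ᵐ[volΩ] fun x => √(a x) * u' x :=
  h.2.1.coeFn_toLp

lemma MemH1a.coeFn_embedding_grad (ha : WeaklyDegenerate a) {u u' : ℝ → ℝ} (h : MemH1a a u u') :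
    embedding ha (h.grad ha) =ᵐ[volΩ] u := by
  filter_upwards [embedding_apply ha (h.grad ha), (ha.memH1a_iff.1 h).2.2, ae_volΩ_mem]
    with x h1 h2 hx
  rw [h1, h2]
  refine intervalIntegral_congr_volΩ ?_ le_rfl hx.1.le hx.2.le
  filter_upwards [h.coeFn_grad ha, ae_volΩ_mem] with s hs hs1
  rw [hs, mul_right_comm, ha.sqrt_mul_invSqrt hs1, one_mul]

lemma embedding_injective (ha : WeaklyDegenerate a) (ψ : gradSpace ha)
    (h : embedding ha ψ = 0) : ψ = 0 := by
  have h1 : (fun x => ∫ s in (0 : ℝ)..x, (ψ : Lp ℝ 2 volΩ) s * invSqrt a s) =ᵐ[volΩ]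
      fun _ => (0 : ℝ) := by
    refine (embedding_apply ha ψ).symm.trans ?_
    rw [h]
    exact Lp.coeFn_zero _ _ _
  have h2 := ae_eq_zero_of_primitive_ae_const (ha.integrable_mul_invSqrt _) h1
  refine Subtype.ext (Lp.ext ?_)
  refine EventuallyEq.trans ?_ (Lp.coeFn_zero ℝ 2 volΩ).symm
  filter_upwards [h2, ha.sqrt_mul_mul_invSqrt (ψ : Lp ℝ 2 volΩ)] with x e1 e2
  rw [← e2, e1]; simp

/-- `H¹ₐ(Ω)` is dense in `L²(Ω)`: if `h` is orthogonal to it, then testing with the primitive of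
`(H - m)/a`, where `H` is the primitive of `h` and `m` its mean with weight `1/a`, shows that `H`
is constant. -/
lemma embedding_dense (ha : WeaklyDegenerate a) (h : Lp ℝ 2 volΩ)
    (hh : ∀ ψ, inner ℝ h (embedding ha ψ) = 0) : h = 0 := by
  have hhi : Integrable h volΩ := (Lp.memLp h).integrable (by norm_num)
  set P : ℝ → ℝ := fun x => ∫ s in (0 : ℝ)..x, h s with hP
  have hPc : ContinuousOn P (Icc 0 1) := continuousOn_primitive_volΩ hhi
  set R := ∫ x, invSqrt a x ^ 2 ∂volΩ with hR
  have hri := ha.memLp_invSqrt.integrable_sq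
  have hR0 : R ≠ 0 := by
    intro h0
    have h1 := ae_eq_zero_of_integral_sq ha.memLp_invSqrt h0.le
    have h2 : ∀ᵐ x ∂volΩ, False := by
      filter_upwards [h1, ae_volΩ_mem] with x e1 hx
      have := ha.sqrt_mul_invSqrt hx
      rw [e1] at this
      simp at this
    rw [eventually_false_iff_eq_bot, ae_eq_bot, Measure.restrict_eq_zero, Real.volume_Ioo] at h2
    simp at h2
  obtain ⟨C, hC⟩ := isCompact_Icc.exists_bound_of_continuousOn hPc
  have hPm : AEStronglyMeasurable P volΩ :=
    (hPc.mono Ioo_subset_Icc_self).aestronglyMeasurable measurableSet_Ioo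
  have hPr : MemLp (fun x => P x * invSqrt a x) 2 volΩ := by
    refine memLp_two_of_abs_le ha.memLp_invSqrt (hPm.mul ha.memLp_invSqrt.1) C ?_
    filter_upwards [ae_volΩ_mem] with x hx
    rw [abs_mul]
    exact mul_le_mul_of_nonneg_right (hC x (Ioo_subset_Icc_self hx)) (abs_nonneg _)
  set m := (∫ x, P x * invSqrt a x * invSqrt a x ∂volΩ) / R with hm
  have hψ : MemLp (fun x => (P x - m) * invSqrt a x) 2 volΩ := by
    simpa [sub_mul, Pi.sub_def] using hPr.sub (ha.memLp_invSqrt.const_mul m)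
  set u' : ℝ → ℝ := fun x => (P x - m) * invSqrt a x * invSqrt a x with hu'
  have hu'2 : MemLp (fun x => √(a x) * u' x) 2 volΩ := ha.memLp_sqrt_mul hψ
  have hu'i : Integrable u' volΩ := ha.integrable_of_memLp hu'2
  have hPri : Integrable (fun x => P x * invSqrt a x * invSqrt a x) volΩ :=
    integrable_mul_of_memLp_two hPr ha.memLp_invSqrt
  have hu'0 : ∫ x, u' x ∂volΩ = 0 := by
    have h1 : ∀ x, u' x = P x * invSqrt a x * invSqrt a x - m * invSqrt a x ^ 2 := fun x => by
      simp only [hu']; ring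
    simp_rw [h1]
    rw [integral_sub hPri (hri.const_mul m), integral_const_mul, ← hR, hm, div_mul_cancel₀ _ hR0,
      sub_self]
  have hmem := ha.memH1a_primitive hu'2 hu'0
  set u : ℝ → ℝ := fun x => ∫ s in (0 : ℝ)..x, u' s with hu
  have horth : ∫ x, h x * u x ∂volΩ = 0 := by
    rw [← hh (hmem.grad ha), inner_eq_integral]
    refine integral_congr_ae ?_
    filter_upwards [hmem.coeFn_embedding_grad ha] with x hx
    rw [hx]
  have h0I : (0 : ℝ) ∈ Icc (0 : ℝ) 1 := left_mem_Icc.2 zero_le_one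
  have h1I : (1 : ℝ) ∈ Icc (0 : ℝ) 1 := right_mem_Icc.2 zero_le_one
  have hhii := intervalIntegrable_of_integrable hhi h0I h1I
  have huii := intervalIntegrable_of_integrable hu'i h0I h1I
  have hu1 : u 1 = 0 := (integral_volΩ_eq u').symm.trans hu'0
  have hparts := AbsolutelyContinuousOnInterval.integral_mul_deriv_eq_deriv_mul
    (huii.absolutelyContinuousOnInterval_intervalIntegral (c := 0) (by simp))
    (hhii.absolutelyContinuousOnInterval_intervalIntegral (c := 0) (by simp))
  have hd1 : deriv P =ᵐ[volΩ] h := by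
    rw [EventuallyEq, ae_restrict_iff' measurableSet_Ioo]
    filter_upwards [hhii.ae_hasDerivAt_integral] with x hx hx1
    rw [uIcc_of_le zero_le_one] at hx
    exact (hx (Ioo_subset_Icc_self hx1) 0 (by simp)).deriv
  have hd2 : deriv u =ᵐ[volΩ] u' := by
    rw [EventuallyEq, ae_restrict_iff' measurableSet_Ioo]
    filter_upwards [huii.ae_hasDerivAt_integral] with x hx hx1
    rw [uIcc_of_le zero_le_one] at hx
    exact (hx (Ioo_subset_Icc_self hx1) 0 (by simp)).deriv
  change ∫ x in (0 : ℝ)..1, u x * deriv P x = u 1 * P 1 - u 0 * P 0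
    - ∫ x in (0 : ℝ)..1, deriv u x * P x at hparts
  have hu0 : u 0 = 0 := by simp [hu]
  have e1 : ∫ x in (0 : ℝ)..1, u x * deriv P x = 0 := by
    rw [← integral_volΩ_eq, ← horth]
    refine integral_congr_ae ?_
    filter_upwards [hd1] with x hx
    rw [hx, mul_comm]
  rw [e1, hu0, hu1, ← integral_volΩ_eq] at hparts
  have e2 : ∫ x, u' x * P x ∂volΩ = 0 := by
    have : ∫ x, u' x * P x ∂volΩ = ∫ x, deriv u x * P x ∂volΩ := by
      refine integral_congr_ae ?_
      filter_upwards [hd2] with x hx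
      rw [hx]
    rw [this]; linarith
  have hu'P : Integrable (fun x => u' x * P x) volΩ := by
    refine (integrable_mul_of_memLp_two hψ hPr).congr (Eventually.of_forall fun x => ?_)
    simp only [hu']; ring
  have e3 : ∫ x, ((P x - m) * invSqrt a x) ^ 2 ∂volΩ = 0 := by
    have h1 : ∀ x, ((P x - m) * invSqrt a x) ^ 2 = u' x * P x - m * u' x := fun x => by
      simp only [hu']; ring
    simp_rw [h1]
    rw [integral_sub hu'P (hu'i.const_mul m), integral_const_mul, e2, hu'0]; ring
  have e4 := ae_eq_zero_of_integral_sq hψ e3.le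
  have e5 : P =ᵐ[volΩ] fun _ => m := by
    filter_upwards [e4, ae_volΩ_mem] with x hx hx1
    have hr : invSqrt a x ≠ 0 := right_ne_zero_of_mul_eq_one (ha.sqrt_mul_invSqrt hx1)
    have := (mul_eq_zero.1 hx).resolve_right hr
    linarith
  refine Lp.ext ((ae_eq_zero_of_primitive_ae_const hhi e5).trans (Lp.coeFn_zero _ _ _).symm)

/-- The map `u ↦ u/√a` from `H¹ₐ(Ω)` to `L²(Ω)`, bounded by the Hardy inequality. -/
def hardyOp (ha : WeaklyDegenerate a) : gradSpace ha →L[ℝ] Lp ℝ 2 volΩ :=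
  LinearMap.mkContinuous
    { toFun := fun ψ => (((ha.hardy one_pos).choose_spec.2 _ _ (memH1a_embedding ha ψ)).1).toLp _
      map_add' := fun ψ φ => by
        rw [← MemLp.toLp_add, MemLp.toLp_eq_toLp_iff, map_add]
        filter_upwards [Lp.coeFn_add (embedding ha ψ) (embedding ha φ)] with x hx
        rw [hx, Pi.add_apply, Pi.add_apply, add_mul]
      map_smul' := fun c ψ => by
        rw [RingHom.id_apply, ← MemLp.toLp_const_smul, MemLp.toLp_eq_toLp_iff, map_smul]
        filter_upwards [Lp.coeFn_smul c (embedding ha ψ)] with x hx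
        rw [hx, Pi.smul_apply, Pi.smul_apply, smul_eq_mul, smul_eq_mul, mul_assoc] }
    (√(1 + (ha.hardy one_pos).choose * ‖embedding ha‖ ^ 2)) fun ψ => by
      have hC := (ha.hardy one_pos).choose_spec.1
      have h := ((ha.hardy one_pos).choose_spec.2 _ _ (memH1a_embedding ha ψ))
      change ‖h.1.toLp _‖ ≤ _
      rw [norm_toLp_eq_sqrt, ← Real.sqrt_sq (norm_nonneg ψ), ← Real.sqrt_mul (by positivity)]
      refine Real.sqrt_le_sqrt (h.2.trans ?_)
      rw [ha.integral_sqrt_mul_sq, integral_coeFn_sq, integral_coeFn_sq, add_mul, mul_assoc,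
        ← mul_pow]
      have := (embedding ha).le_opNorm ψ
      have e : ‖(ψ : Lp ℝ 2 volΩ)‖ = ‖ψ‖ := rfl
      rw [e]
      gcongr

lemma hardyOp_apply (ha : WeaklyDegenerate a) (ψ : gradSpace ha) :
    hardyOp ha ψ =ᵐ[volΩ] fun x => embedding ha ψ x * invSqrt a x :=
  (((ha.hardy one_pos).choose_spec.2 _ _ (memH1a_embedding ha ψ)).1).coeFn_toLp

/-- The functional `u ↦ ∫ M u/√a + ∫ G √a u'` on `H¹ₐ(Ω)`, for `M, G ∈ L²(Ω)`. -/
def pairing (ha : WeaklyDegenerate a) (M G : Lp ℝ 2 volΩ) : gradSpace ha →L[ℝ] ℝ :=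
  innerSL ℝ M ∘L hardyOp ha + innerSL ℝ G ∘L (gradSpace ha).subtypeL

/-- The constant in the bound `norm_pairing_sq_le`. -/
def pairingConst (ha : WeaklyDegenerate a) : ℝ := 2 * (‖hardyOp ha‖ ^ 2 + 1)

lemma norm_pairing_sq_le (ha : WeaklyDegenerate a) (M G : Lp ℝ 2 volΩ) :
    ‖pairing ha M G‖ ^ 2 ≤ pairingConst ha * (‖M‖ ^ 2 + ‖G‖ ^ 2) := by
  have h : ‖pairing ha M G‖ ≤ ‖M‖ * ‖hardyOp ha‖ + ‖G‖ := by
    have h1 := (innerSL ℝ M).opNorm_comp_le (hardyOp ha)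
    have h2 := (innerSL ℝ G).opNorm_comp_le (gradSpace ha).subtypeL
    rw [innerSL_apply_norm] at h1 h2
    have h3 := mul_le_of_le_one_right (norm_nonneg G) (Submodule.norm_subtypeL_le (gradSpace ha))
    exact (norm_add_le (innerSL ℝ M ∘L hardyOp ha) (innerSL ℝ G ∘L (gradSpace ha).subtypeL)).trans
      (add_le_add h1 (h2.trans h3))
  have h0 := norm_nonneg (pairing ha M G)
  have h1 : ‖pairing ha M G‖ ^ 2 ≤ (‖M‖ * ‖hardyOp ha‖ + ‖G‖) ^ 2 := pow_le_pow_left₀ h0 h 2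
  unfold pairingConst
  nlinarith [sq_nonneg (‖M‖ * ‖hardyOp ha‖ - ‖G‖), sq_nonneg ‖M‖, sq_nonneg ‖G‖,
    mul_nonneg (sq_nonneg ‖G‖) (sq_nonneg ‖hardyOp ha‖)]

lemma pairing_apply (ha : WeaklyDegenerate a) {u u' M G : ℝ → ℝ} (h : MemH1a a u u')
    (hM : MemLp M 2 volΩ) (hG : MemLp G 2 volΩ) :
    pairing ha (hM.toLp M) (hG.toLp G) (h.grad ha)
      = ∫ x, (M x * (u x * invSqrt a x) + G x * (√(a x) * u' x)) ∂volΩ := by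
  have hh := ((ha.hardy one_pos).choose_spec.2 _ _ h).1
  have e1 : hardyOp ha (h.grad ha) = hh.toLp _ := by
    refine Lp.ext ?_
    filter_upwards [hardyOp_apply ha (h.grad ha), h.coeFn_embedding_grad ha, hh.coeFn_toLp]
      with x h1 h2 h3
    rw [h1, h2, h3]
  have e2 : pairing ha (hM.toLp M) (hG.toLp G) (h.grad ha)
      = inner ℝ (hM.toLp M) (hardyOp ha (h.grad ha))
        + inner ℝ (hG.toLp G) (h.2.1.toLp (fun x => √(a x) * u' x)) := rfl
  rw [e2, e1, integral_toLp_mul_toLp, integral_toLp_mul_toLp, integral_add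
    (integrable_mul_of_memLp_two hM hh) (integrable_mul_of_memLp_two hG h.2.1)]

/-- The eigenfunctions of `u ↦ -(a u')'` on `H¹ₐ(Ω)` with their eigenvalues `lam`: they form a
Hilbert basis `basis` of `L²(Ω)` and, after normalization, a Hilbert basis of `H¹ₐ(Ω)`, here
`gradBasis` in the model `gradSpace`. -/
structure EigenBasis (ha : WeaklyDegenerate a) where
  ι : Type
  countable : Countable ι
  basis : HilbertBasis ι ℝ (Lp ℝ 2 volΩ)
  gradBasis : HilbertBasis ι ℝ (gradSpace ha)
  lam : ι → ℝ
  lam_pos : ∀ i, 0 < lam i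
  embedding_grad : ∀ i, embedding ha (√(lam i) • gradBasis i) = basis i
  inner_grad : ∀ i ψ, inner ℝ (√(lam i) • gradBasis i) ψ = lam i * inner ℝ (basis i) (embedding ha ψ)

instance (ha : WeaklyDegenerate a) : Nonempty (EigenBasis ha) := by
  have : Fact ((2 : ENNReal) ≠ ⊤) := ⟨by norm_num⟩
  obtain ⟨ι, hι, e, lam, f, h1, h2, h3⟩ := exists_hilbertBasis_of_compact_embedding
    (isCompactOperator_embedding ha) (embedding_injective ha) (embedding_dense ha)
  exact ⟨⟨ι, hι, e, f, lam, h1, h2, h3⟩⟩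

namespace EigenBasis

variable {ha : WeaklyDegenerate a} (B : EigenBasis ha)

instance : Countable B.ι := B.countable

/-- The `i`-th eigenfunction. -/
def e (i : B.ι) : ℝ → ℝ := B.basis i

/-- The function `√a e'` for the `i`-th eigenfunction `e`. -/
def w (i : B.ι) : ℝ → ℝ := (√(B.lam i) • B.gradBasis i : gradSpace ha).1

lemma memLp_e (i : B.ι) : MemLp (B.e i) 2 volΩ := Lp.memLp _

lemma memLp_w (i : B.ι) : MemLp (B.w i) 2 volΩ := Lp.memLp _

lemma memH1a_e (i : B.ι) : MemH1a a (B.e i) (fun x => B.w i x * invSqrt a x) := by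
  have := memH1a_embedding ha (√(B.lam i) • B.gradBasis i)
  rwa [B.embedding_grad] at this

lemma memLp_e_mul (i : B.ι) : MemLp (fun x => B.e i x * invSqrt a x) 2 volΩ :=
  ((ha.hardy one_pos).choose_spec.2 _ _ (B.memH1a_e i)).1

lemma grad_e (i : B.ι) : (B.memH1a_e i).grad ha = √(B.lam i) • B.gradBasis i := by
  refine Subtype.ext (Lp.ext ?_)
  refine ((B.memH1a_e i).coeFn_grad ha).trans ?_
  exact ha.sqrt_mul_mul_invSqrt _

lemma toLp_e (i : B.ι) : (B.memLp_e i).toLp (B.e i) = B.basis i := Lp.toLp_coeFn _ _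

lemma toLp_w (i : B.ι) :
    (B.memLp_w i).toLp (B.w i) = (√(B.lam i) • B.gradBasis i : gradSpace ha).1 :=
  Lp.toLp_coeFn _ _

/-- The eigenvalue equation `∫ a u' eᵢ' = λᵢ ∫ u eᵢ`. -/
lemma integral_grad_mul_w {u u' : ℝ → ℝ} (h : MemH1a a u u') (i : B.ι) :
    ∫ x, √(a x) * u' x * B.w i x ∂volΩ = B.lam i * ∫ x, u x * B.e i x ∂volΩ := by
  have h1 := B.inner_grad i (h.grad ha)
  have h2 : embedding ha (h.grad ha) = h.1.toLp u :=
    Lp.ext ((h.coeFn_embedding_grad ha).trans h.1.coeFn_toLp.symm)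
  rw [h2, ← B.toLp_e, integral_toLp_mul_toLp, Submodule.coe_inner, ← toLp_w] at h1
  have h3 : inner ℝ ((B.memLp_w i).toLp (B.w i)) (h.2.1.toLp (fun x => √(a x) * u' x))
    = B.lam i * ∫ x, B.e i x * u x ∂volΩ := h1
  rw [integral_toLp_mul_toLp] at h3
  simpa only [mul_comm] using h3

lemma integral_e_mul_e [DecidableEq B.ι] (i j : B.ι) :
    ∫ x, B.e i x * B.e j x ∂volΩ = if i = j then 1 else 0 := by
  rw [← integral_toLp_mul_toLp (B.memLp_e i) (B.memLp_e j), toLp_e, toLp_e]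
  exact orthonormal_iff_ite.1 B.basis.orthonormal i j

/-- Parseval's identity for the eigenfunctions. -/
lemma hasSum_parseval {f g : ℝ → ℝ} (hf : MemLp f 2 volΩ) (hg : MemLp g 2 volΩ) :
    HasSum (fun i => (∫ x, f x * B.e i x ∂volΩ) * ∫ x, g x * B.e i x ∂volΩ)
      (∫ x, f x * g x ∂volΩ) := by
  have := B.basis.hasSum_inner_mul_inner (hf.toLp f) (hg.toLp g)
  simp_rw [← toLp_e, integral_toLp_mul_toLp] at this
  simpa only [mul_comm (B.e _ _)] using this

lemma coef_smul_grad_e {u u' : ℝ → ℝ} (h : MemH1a a u u') (i : B.ι) :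
    (∫ x, u x * B.e i x ∂volΩ) • (B.memH1a_e i).grad ha
      = inner ℝ (B.gradBasis i) (h.grad ha) • B.gradBasis i := by
  have h1 := (real_inner_smul_left (B.gradBasis i) (h.grad ha) (√(B.lam i))).symm.trans
    (B.inner_grad i (h.grad ha))
  have h2 : embedding ha (h.grad ha) = h.1.toLp u :=
    Lp.ext ((h.coeFn_embedding_grad ha).trans h.1.coeFn_toLp.symm)
  rw [h2, ← B.toLp_e, integral_toLp_mul_toLp] at h1
  have hs : 0 < √(B.lam i) := Real.sqrt_pos.2 (B.lam_pos i)
  have hs2 : √(B.lam i) * √(B.lam i) = B.lam i := Real.mul_self_sqrt (B.lam_pos i).le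
  have h3 : inner ℝ (B.gradBasis i) (h.grad ha) = √(B.lam i) * ∫ x, B.e i x * u x ∂volΩ := by
    refine mul_left_cancel₀ hs.ne' ?_
    rw [h1, ← mul_assoc, hs2]
  rw [grad_e, smul_smul, h3]
  simp only [mul_comm]

lemma hasSum_grad {u u' : ℝ → ℝ} (h : MemH1a a u u') :
    HasSum (fun i => (∫ x, u x * B.e i x ∂volΩ) • (B.memH1a_e i).grad ha) (h.grad ha) := by
  simp_rw [B.coef_smul_grad_e h, ← HilbertBasis.repr_apply_apply]
  exact B.gradBasis.hasSum_repr (h.grad ha)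

/-- The `i`-th coefficient of the functional `u ↦ ∫ M u/√a + ∫ G √a u'`. -/
def dualCoef (M G : ℝ → ℝ) (i : B.ι) : ℝ :=
  ∫ x, (M x * (B.e i x * invSqrt a x) + G x * B.w i x) ∂volΩ

lemma pairing_e {M G : ℝ → ℝ} (hM : MemLp M 2 volΩ) (hG : MemLp G 2 volΩ) (i : B.ι) :
    pairing ha (hM.toLp M) (hG.toLp G) ((B.memH1a_e i).grad ha) = B.dualCoef M G i := by
  rw [pairing_apply, dualCoef]
  refine integral_congr_ae ?_
  filter_upwards [ha.sqrt_mul_mul_invSqrt (B.w i)] with x hx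
  rw [hx]

/-- The eigenfunction expansion of a pairing between `H¹ₐ(Ω)` and its dual. -/
lemma hasSum_pairing {u u' M G : ℝ → ℝ} (h : MemH1a a u u') (hM : MemLp M 2 volΩ)
    (hG : MemLp G 2 volΩ) :
    HasSum (fun i => (∫ x, u x * B.e i x ∂volΩ) * B.dualCoef M G i)
      (∫ x, (M x * (u x * invSqrt a x) + G x * (√(a x) * u' x)) ∂volΩ) := by
  have := (B.hasSum_grad h).mapL (pairing ha (hM.toLp M) (hG.toLp G))
  simpa only [map_smul, pairing_e, smul_eq_mul, pairing_apply] using this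

lemma norm_partial_grad_le {u u' : ℝ → ℝ} (h : MemH1a a u u') (s : Finset B.ι) :
    ‖∑ i ∈ s, (∫ x, u x * B.e i x ∂volΩ) • (B.memH1a_e i).grad ha‖ ≤ ‖h.grad ha‖ := by
  simp_rw [B.coef_smul_grad_e h]
  have h1 := B.gradBasis.orthonormal.sum_inner_products_le (h.grad ha) (s := s)
  have h2 : ‖∑ i ∈ s, inner ℝ (B.gradBasis i) (h.grad ha) • B.gradBasis i‖ ^ 2
      = ∑ i ∈ s, ‖inner ℝ (B.gradBasis i) (h.grad ha)‖ ^ 2 := by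
    rw [← real_inner_self_eq_norm_sq, B.gradBasis.orthonormal.inner_sum]
    simp [sq]
  rw [← h2] at h1
  exact le_of_sq_le_sq h1 (norm_nonneg _)

lemma abs_sum_pairing_le {u u' M G : ℝ → ℝ} (h : MemH1a a u u') (hM : MemLp M 2 volΩ)
    (hG : MemLp G 2 volΩ) (s : Finset B.ι) :
    |∑ i ∈ s, (∫ x, u x * B.e i x ∂volΩ) * B.dualCoef M G i| ≤
      pairingConst ha * ((∫ x, M x ^ 2 ∂volΩ) + ∫ x, G x ^ 2 ∂volΩ)
        + ∫ x, (√(a x) * u' x) ^ 2 ∂volΩ := by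
  have h1 : ∑ i ∈ s, (∫ x, u x * B.e i x ∂volΩ) * B.dualCoef M G i
      = pairing ha (hM.toLp M) (hG.toLp G)
        (∑ i ∈ s, (∫ x, u x * B.e i x ∂volΩ) • (B.memH1a_e i).grad ha) := by
    simp only [map_sum, map_smul, pairing_e, smul_eq_mul]
  have h2 := (pairing ha (hM.toLp M) (hG.toLp G)).le_opNorm
    (∑ i ∈ s, (∫ x, u x * B.e i x ∂volΩ) • (B.memH1a_e i).grad ha)
  rw [← h1, Real.norm_eq_abs] at h2
  have h3 := norm_pairing_sq_le ha (hM.toLp M) (hG.toLp G)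
  rw [norm_toLp_sq, norm_toLp_sq] at h3
  have h4 := B.norm_partial_grad_le h s
  have h5 : ‖h.grad ha‖ ^ 2 = ∫ x, (√(a x) * u' x) ^ 2 ∂volΩ := norm_toLp_sq h.2.1
  rw [← h5]
  refine h2.trans ((mul_le_mul_of_nonneg_left h4
    (norm_nonneg (pairing ha (hM.toLp M) (hG.toLp G)))).trans ?_)
  nlinarith [sq_nonneg (‖pairing ha (hM.toLp M) (hG.toLp G)‖ - ‖h.grad ha‖),
    sq_nonneg ‖pairing ha (hM.toLp M) (hG.toLp G)‖, sq_nonneg ‖h.grad ha‖]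

/-- Bessel's inequality for the coefficients of a functional on `H¹ₐ(Ω)`. -/
lemma sum_dualCoef_sq_le {M G : ℝ → ℝ} (hM : MemLp M 2 volΩ) (hG : MemLp G 2 volΩ)
    (s : Finset B.ι) :
    ∑ i ∈ s, B.dualCoef M G i ^ 2 / B.lam i ≤
      pairingConst ha * ((∫ x, M x ^ 2 ∂volΩ) + ∫ x, G x ^ 2 ∂volΩ) := by
  set ℓ := pairing ha (hM.toLp M) (hG.toLp G) with hℓ
  have h3 := norm_pairing_sq_le ha (hM.toLp M) (hG.toLp G)
  rw [norm_toLp_sq, norm_toLp_sq] at h3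
  refine le_trans ?_ h3
  have h1 : ∀ i, B.dualCoef M G i ^ 2 / B.lam i = ℓ (B.gradBasis i) ^ 2 := fun i => by
    rw [← B.pairing_e hM hG, grad_e, map_smul, smul_eq_mul, mul_pow,
      Real.sq_sqrt (B.lam_pos i).le, mul_div_cancel_left₀ _ (B.lam_pos i).ne']
  simp_rw [h1]
  set ψ := ∑ i ∈ s, ℓ (B.gradBasis i) • B.gradBasis i with hψ
  have h4 : ‖ψ‖ ^ 2 = ∑ i ∈ s, ℓ (B.gradBasis i) ^ 2 := by
    rw [← real_inner_self_eq_norm_sq, hψ, B.gradBasis.orthonormal.inner_sum]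
    simp [sq]
  have h5 : ℓ ψ = ∑ i ∈ s, ℓ (B.gradBasis i) ^ 2 := by
    rw [hψ, map_sum]
    simp [sq]
  have h6 := ℓ.le_opNorm ψ
  rw [h5, ← h4, Real.norm_of_nonneg (sq_nonneg _)] at h6
  rw [← h4]
  rcases (norm_nonneg ψ).eq_or_lt with h7 | h7
  · rw [← h7, zero_pow two_ne_zero]; exact sq_nonneg ‖ℓ‖
  · have : ‖ψ‖ ≤ ‖ℓ‖ := by
      refine le_of_mul_le_mul_right ?_ h7
      rwa [← sq]
    exact pow_le_pow_left₀ h7.le this 2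

end EigenBasis

end Eigenfunctions

/-! ### Functions of time and space -/

section Cylinder

variable {a : ℝ → ℝ} {T : ℝ}

lemma volQ_eq_prod (T : ℝ) : volQ T = (volume.restrict (Ioo 0 T)).prod volΩ :=
  (Measure.prod_restrict _ _).symm

lemma ae_volQ_of_ae {p : ℝ × ℝ → Prop} (h : ∀ᵐ z ∂volQ T, p z) :
    ∀ᵐ t ∂(volume.restrict (Ioo 0 T)), ∀ᵐ x ∂volΩ, p (t, x) := by
  rw [volQ_eq_prod] at h
  exact Measure.ae_ae_of_ae_prod h

lemma ae_volQ_mem : ∀ᵐ z ∂volQ T, z.1 ∈ Ioo 0 T ∧ z.2 ∈ Ioo (0 : ℝ) 1 := by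
  filter_upwards [ae_restrict_mem (measurableSet_Ioo.prod measurableSet_Ioo)] with z hz using hz

lemma integral_volQ {f : ℝ × ℝ → ℝ} (hf : Integrable f (volQ T)) :
    ∫ z, f z ∂volQ T = ∫ t in Ioo 0 T, ∫ x, f (t, x) ∂volΩ := by
  rw [volQ_eq_prod] at hf ⊢
  exact integral_prod f hf

lemma integrable_slice_integral {f : ℝ × ℝ → ℝ} (hf : Integrable f (volQ T)) :
    Integrable (fun t => ∫ x, f (t, x) ∂volΩ) (volume.restrict (Ioo 0 T)) := by
  rw [volQ_eq_prod] at hf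
  exact hf.integral_prod_left

lemma ae_integrable_slice {f : ℝ × ℝ → ℝ} (hf : Integrable f (volQ T)) :
    ∀ᵐ t ∂(volume.restrict (Ioo 0 T)), Integrable (fun x => f (t, x)) volΩ := by
  rw [volQ_eq_prod] at hf
  exact hf.prod_right_ae

lemma ae_memLp_slice {f : ℝ × ℝ → ℝ} (hf : MemLp f 2 (volQ T)) :
    ∀ᵐ t ∂(volume.restrict (Ioo 0 T)), MemLp (fun x => f (t, x)) 2 volΩ := by
  have hm := hf.1
  rw [volQ_eq_prod] at hm
  filter_upwards [ae_integrable_slice hf.integrable_sq, hm.prodMk_left] with t h1 h2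
  exact (memLp_two_iff_integrable_sq h2).2 h1

lemma memLp_tensor {θ g : ℝ → ℝ} (hθ : MemLp θ 2 (volume.restrict (Ioo 0 T)))
    (hg : MemLp g 2 volΩ) : MemLp (fun z : ℝ × ℝ => θ z.1 * g z.2) 2 (volQ T) := by
  rw [volQ_eq_prod]
  have hm : AEStronglyMeasurable (fun z : ℝ × ℝ => θ z.1 * g z.2)
      ((volume.restrict (Ioo 0 T)).prod volΩ) := hθ.1.comp_fst.mul hg.1.comp_snd
  rw [memLp_two_iff_integrable_sq hm]
  simp_rw [mul_pow]
  exact hθ.integrable_sq.mul_prod hg.integrable_sq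

lemma memLp_of_snd {g : ℝ → ℝ} (hg : MemLp g 2 volΩ) :
    MemLp (fun z : ℝ × ℝ => g z.2) 2 (volQ T) := by
  simpa using memLp_tensor (T := T) (θ := fun _ => 1) (memLp_const 1) hg

lemma aestronglyMeasurable_of_snd {g : ℝ → ℝ} (hg : AEStronglyMeasurable g volΩ) :
    AEStronglyMeasurable (fun z : ℝ × ℝ => g z.2) (volQ T) := by
  rw [volQ_eq_prod]; exact hg.comp_snd

lemma memLp_bounded_time_mul {θ : ℝ → ℝ} (hθ : Continuous θ) {f : ℝ × ℝ → ℝ}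
    (hf : MemLp f 2 (volQ T)) : MemLp (fun z : ℝ × ℝ => θ z.1 * f z) 2 (volQ T) := by
  obtain ⟨C, hC⟩ := isCompact_Icc.exists_bound_of_continuousOn (hθ.continuousOn (s := Icc 0 T))
  refine memLp_two_of_abs_le hf ((hθ.comp continuous_fst).aestronglyMeasurable.mul hf.1) C ?_
  filter_upwards [ae_volQ_mem] with z hz
  rw [abs_mul]
  exact mul_le_mul_of_nonneg_right (hC z.1 (Ioo_subset_Icc_self hz.1)) (abs_nonneg _)

lemma integrable_bounded_time_mul {θ : ℝ → ℝ} (hθ : Continuous θ) {f : ℝ × ℝ → ℝ}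
    (hf : Integrable f (volQ T)) : Integrable (fun z : ℝ × ℝ => θ z.1 * f z) (volQ T) := by
  obtain ⟨C, hC⟩ := isCompact_Icc.exists_bound_of_continuousOn (hθ.continuousOn (s := Icc 0 T))
  refine hf.bdd_mul (c := C) (hθ.comp continuous_fst).aestronglyMeasurable ?_
  filter_upwards [ae_volQ_mem] with z hz
  exact hC z.1 (Ioo_subset_Icc_self hz.1)

/-! ### The space `ℍ` -/

namespace SpaceH

/-- The values of `u ∈ ℍ` as a function on `Q`. -/
def fn (u : SpaceH a T) (z : ℝ × ℝ) : ℝ := u.val z.1 z.2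

/-- The weighted gradient `√a u_x` of `u ∈ ℍ`. -/
def grad (u : SpaceH a T) (z : ℝ × ℝ) : ℝ := √(a z.2) * u.dx z.1 z.2

/-- The function `u/√a`, which is in `L²(Q)` for `u ∈ ℍ`. -/
def hardy (u : SpaceH a T) (z : ℝ × ℝ) : ℝ := u.val z.1 z.2 * invSqrt a z.2

lemma memLp_fn (u : SpaceH a T) : MemLp u.fn 2 (volQ T) := u.memLp_val

lemma memLp_grad (u : SpaceH a T) : MemLp u.grad 2 (volQ T) := u.memLp_dx

lemma aestronglyMeasurable_hardy (ha : WeaklyDegenerate a) (u : SpaceH a T) :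
    AEStronglyMeasurable u.hardy (volQ T) :=
  u.memLp_val.1.mul (aestronglyMeasurable_of_snd ha.memLp_invSqrt.1)

lemma memLp_hardy (ha : WeaklyDegenerate a) (u : SpaceH a T) : MemLp u.hardy 2 (volQ T) := by
  obtain ⟨C, -, hC⟩ := ha.hardy one_pos
  have hm := u.aestronglyMeasurable_hardy ha
  rw [memLp_two_iff_integrable_sq hm]
  have hm2 : AEStronglyMeasurable (fun z => u.hardy z ^ 2)
      ((volume.restrict (Ioo 0 T)).prod volΩ) := by
    rw [← volQ_eq_prod]; exact hm.pow 2
  rw [volQ_eq_prod, integrable_prod_iff hm2]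
  constructor
  · filter_upwards [u.memH1a] with t ht
    exact (hC _ _ ht).1.integrable_sq
  · have hdom := ((integrable_slice_integral u.memLp_grad.integrable_sq).const_mul 1).add
      ((integrable_slice_integral u.memLp_fn.integrable_sq).const_mul C)
    refine hdom.mono' hm2.norm.integral_prod_right' ?_
    filter_upwards [u.memH1a] with t ht
    simp only [norm_pow, Real.norm_eq_abs, sq_abs]
    rw [abs_of_nonneg (integral_nonneg fun x => sq_nonneg _)]
    exact (hC _ _ ht).2

/-- The Hardy inequality, integrated with a weight in time. -/
lemma integral_hardy_le (ha : WeaklyDegenerate a) {ε : ℝ} (hε : 0 < ε) :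
    ∃ C : ℝ, 0 ≤ C ∧ ∀ (T : ℝ) (u : SpaceH a T) (θ : ℝ → ℝ), Continuous θ → (∀ t, 0 ≤ θ t) →
      ∫ z, θ z.1 * u.hardy z ^ 2 ∂volQ T ≤
        ε * (∫ z, θ z.1 * u.grad z ^ 2 ∂volQ T) + C * ∫ z, θ z.1 * u.fn z ^ 2 ∂volQ T := by
  obtain ⟨C, hC0, hC⟩ := ha.hardy hε
  refine ⟨C, hC0, fun T u θ hθ hθ0 => ?_⟩
  have i1 := integrable_bounded_time_mul hθ (u.memLp_hardy ha).integrable_sq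
  have i2 := integrable_bounded_time_mul hθ u.memLp_grad.integrable_sq
  have i3 := integrable_bounded_time_mul hθ u.memLp_fn.integrable_sq
  rw [integral_volQ i1, integral_volQ i2, integral_volQ i3, ← integral_const_mul,
    ← integral_const_mul, ← integral_add ((integrable_slice_integral i2).const_mul _)
      ((integrable_slice_integral i3).const_mul _)]
  refine integral_mono_ae (integrable_slice_integral i1)
    (((integrable_slice_integral i2).const_mul _).add ((integrable_slice_integral i3).const_mul _)) ?_
  filter_upwards [u.memH1a] with t ht
  simp only [integral_const_mul]
  have := mul_le_mul_of_nonneg_left (hC _ _ ht).2 (hθ0 t)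
  calc _ ≤ _ := this
    _ = _ := by simp only [fn, grad]; ring

/-- The difference of two elements of `ℍ`. -/
def sub (ha : WeaklyDegenerate a) (u v : SpaceH a T) : SpaceH a T where
  val t x := u.val t x - v.val t x
  dx t x := u.dx t x - v.dx t x
  memLp_val := u.memLp_val.sub v.memLp_val
  memLp_dx := by simpa [mul_sub, Pi.sub_def] using u.memLp_dx.sub v.memLp_dx
  memH1a := by
    filter_upwards [u.memH1a, v.memH1a] with t h1 h2 using h1.sub ha h2
  memLp_slice t ht := (u.memLp_slice t ht).sub (v.memLp_slice t ht)
  continuous_slice t₀ ht₀ := by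
    have h := (u.continuous_slice t₀ ht₀).add (v.continuous_slice t₀ ht₀)
    rw [add_zero] at h
    refine tendsto_of_tendsto_of_tendsto_of_le_of_le' tendsto_const_nhds h
      (Eventually.of_forall fun _ => zero_le) ?_
    filter_upwards [self_mem_nhdsWithin] with t ht
    have e : ((fun x => u.val t x - v.val t x) - fun x => u.val t₀ x - v.val t₀ x)
        = (u.val t - u.val t₀) - (v.val t - v.val t₀) := by
      ext x; simp only [Pi.sub_apply]; ring
    rw [e]
    exact eLpNorm_sub_le ((u.memLp_slice t ht).sub (u.memLp_slice t₀ ht₀)).1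
      ((v.memLp_slice t ht).sub (v.memLp_slice t₀ ht₀)).1 (by norm_num)

lemma fn_sub (ha : WeaklyDegenerate a) (u v : SpaceH a T) (z : ℝ × ℝ) :
    (u.sub ha v).fn z = u.fn z - v.fn z := rfl

lemma grad_sub (ha : WeaklyDegenerate a) (u v : SpaceH a T) (z : ℝ × ℝ) :
    (u.sub ha v).grad z = u.grad z - v.grad z := mul_sub _ _ _

lemma hardy_sub (ha : WeaklyDegenerate a) (u v : SpaceH a T) (z : ℝ × ℝ) :
    (u.sub ha v).hardy z = u.hardy z - v.hardy z := sub_mul _ _ _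

/-- The restriction of an element of `ℍ` to a shorter time interval. -/
def restrict {S : ℝ} (hS : S ≤ T) (u : SpaceH a T) : SpaceH a S where
  val := u.val
  dx := u.dx
  memLp_val := u.memLp_val.mono_measure
    (Measure.restrict_mono (prod_mono (Ioo_subset_Ioo_right hS) Subset.rfl) le_rfl)
  memLp_dx := u.memLp_dx.mono_measure
    (Measure.restrict_mono (prod_mono (Ioo_subset_Ioo_right hS) Subset.rfl) le_rfl)
  memH1a := ae_restrict_of_ae_restrict_of_subset (Ioo_subset_Ioo_right hS) u.memH1a
  memLp_slice t ht := u.memLp_slice t ⟨ht.1, ht.2.trans hS⟩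
  continuous_slice t₀ ht₀ := (u.continuous_slice t₀ ⟨ht₀.1, ht₀.2.trans hS⟩).mono_left
    (nhdsWithin_mono _ (Icc_subset_Icc_right hS))

variable {ha : WeaklyDegenerate a} (B : EigenBasis ha)

/-- The `i`-th eigenfunction coefficient of `u(t)`. -/
def coef (u : SpaceH a T) (i : B.ι) (t : ℝ) : ℝ := ∫ x, u.val t x * B.e i x ∂volΩ

lemma continuousOn_coef (u : SpaceH a T) (i : B.ι) : ContinuousOn (u.coef B i) (Icc 0 T) := by
  intro t₀ ht₀
  have h1 := ENNReal.tendsto_toReal ENNReal.zero_ne_top |>.comp (u.continuous_slice t₀ ht₀)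
  have h2 : Tendsto (fun t => (eLpNorm (u.val t - u.val t₀) 2 volΩ).toReal
      * √(∫ x, B.e i x ^ 2 ∂volΩ)) (𝓝[Icc 0 T] t₀) (𝓝 0) := by
    simpa using h1.mul_const (√(∫ x, B.e i x ^ 2 ∂volΩ))
  rw [ContinuousWithinAt, tendsto_iff_dist_tendsto_zero]
  refine squeeze_zero' (Eventually.of_forall fun _ => dist_nonneg) ?_ h2
  filter_upwards [self_mem_nhdsWithin] with t ht
  have hs := (u.memLp_slice t ht).sub (u.memLp_slice t₀ ht₀)
  rw [Real.dist_eq, coef, coef, ← integral_sub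
    (integrable_mul_of_memLp_two (u.memLp_slice t ht) (B.memLp_e i))
    (integrable_mul_of_memLp_two (u.memLp_slice t₀ ht₀) (B.memLp_e i)), eLpNorm_two_eq hs,
    ENNReal.toReal_ofReal (Real.sqrt_nonneg _)]
  have := abs_integral_mul_le hs (B.memLp_e i)
  simpa [sub_mul] using this

lemma coef_sub (u v : SpaceH a T) (i : B.ι) {t : ℝ} (ht : t ∈ Icc 0 T) :
    (u.sub ha v).coef B i t = u.coef B i t - v.coef B i t := by
  simp only [coef, sub, sub_mul]
  exact integral_sub (integrable_mul_of_memLp_two (u.memLp_slice t ht) (B.memLp_e i))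
    (integrable_mul_of_memLp_two (v.memLp_slice t ht) (B.memLp_e i))

end SpaceH

end Cylinder

/-! ### Evolution equations in the dual of `H¹ₐ(Ω)` -/

section BalanceLaw

variable {a : ℝ → ℝ} {T : ℝ} {ha : WeaklyDegenerate a} (B : EigenBasis ha)

/-- The equation `u_t + M/√a - (√a G)_x = 0` in the dual of `H¹ₐ(Ω)`, integrated in time and tested
with the eigenfunctions. -/
def BalanceLaw (u : SpaceH a T) (M G : ℝ × ℝ → ℝ) : Prop :=
  ∀ i, ∀ t ∈ Icc 0 T, u.coef B i t = u.coef B i 0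
    - ∫ s in (0 : ℝ)..t, B.dualCoef (fun x => M (s, x)) (fun x => G (s, x)) i

variable {B}

lemma integrable_dual_mul {M G : ℝ × ℝ → ℝ} (hM : MemLp M 2 (volQ T)) (hG : MemLp G 2 (volQ T))
    (i : B.ι) : Integrable (fun z : ℝ × ℝ => M z * (B.e i z.2 * invSqrt a z.2) + G z * B.w i z.2)
      (volQ T) :=
  (integrable_mul_of_memLp_two hM (memLp_of_snd (B.memLp_e_mul i))).add
    (integrable_mul_of_memLp_two hG (memLp_of_snd (B.memLp_w i)))

lemma integrable_dualCoef {M G : ℝ × ℝ → ℝ} (hM : MemLp M 2 (volQ T)) (hG : MemLp G 2 (volQ T))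
    (i : B.ι) : Integrable (fun s => B.dualCoef (fun x => M (s, x)) (fun x => G (s, x)) i)
      (volume.restrict (Ioo 0 T)) :=
  integrable_slice_integral (integrable_dual_mul hM hG i)

lemma intervalIntegrable_of_Ioo {f : ℝ → ℝ} (hf : Integrable f (volume.restrict (Ioo 0 T)))
    {s t : ℝ} (hs : s ∈ Icc 0 T) (ht : t ∈ Icc 0 T) : IntervalIntegrable f volume s t := by
  have h0T : (0 : ℝ) ≤ T := hs.1.trans hs.2
  have h1 : IntervalIntegrable f volume 0 T :=
    (intervalIntegrable_iff_integrableOn_Ioo_of_le h0T).2 hf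
  refine h1.mono_set ?_
  rw [uIcc_of_le h0T]
  exact uIcc_subset_Icc hs ht

lemma intervalIntegral_eq_Ioo (hT : 0 ≤ T) (f : ℝ → ℝ) :
    ∫ t in (0 : ℝ)..T, f t = ∫ t in Ioo 0 T, f t := by
  rw [intervalIntegral.integral_of_le hT, integral_Ioc_eq_integral_Ioo]

lemma BalanceLaw.sub {u v : SpaceH a T} {M G M' G' : ℝ × ℝ → ℝ} (hu : BalanceLaw B u M G)
    (hv : BalanceLaw B v M' G') (hM : MemLp M 2 (volQ T)) (hG : MemLp G 2 (volQ T))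
    (hM' : MemLp M' 2 (volQ T)) (hG' : MemLp G' 2 (volQ T)) :
    BalanceLaw B (u.sub ha v) (fun z => M z - M' z) (fun z => G z - G' z) := by
  intro i t ht
  have h0T : (0 : ℝ) ∈ Icc 0 T := left_mem_Icc.2 (ht.1.trans ht.2)
  have h1 := integrable_dualCoef hM hG i
  have h2 := integrable_dualCoef hM' hG' i
  rw [SpaceH.coef_sub B u v i ht, SpaceH.coef_sub B u v i h0T, hu i t ht, hv i t ht]
  have h3 : ∫ s in (0 : ℝ)..t, B.dualCoef (fun x => M (s, x) - M' (s, x))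
        (fun x => G (s, x) - G' (s, x)) i
      = (∫ s in (0 : ℝ)..t, B.dualCoef (fun x => M (s, x)) (fun x => G (s, x)) i)
        - ∫ s in (0 : ℝ)..t, B.dualCoef (fun x => M' (s, x)) (fun x => G' (s, x)) i := by
    rw [← intervalIntegral.integral_sub (intervalIntegrable_of_Ioo h1 h0T ht)
      (intervalIntegrable_of_Ioo h2 h0T ht), intervalIntegral.integral_of_le ht.1,
      intervalIntegral.integral_of_le ht.1, integral_Ioc_eq_integral_Ioo,
      integral_Ioc_eq_integral_Ioo]
    refine integral_congr_ae (ae_restrict_of_ae_restrict_of_subset (Ioo_subset_Ioo_right ht.2) ?_)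
    filter_upwards [ae_integrable_slice (integrable_dual_mul hM hG i),
      ae_integrable_slice (integrable_dual_mul hM' hG' i)] with s i1 i2
    simp only [EigenBasis.dualCoef]
    rw [← integral_sub i1 i2]
    congr 1
    ext x; ring
  rw [h3]; ring

lemma BalanceLaw.congr {u : SpaceH a T} {M G M' G' : ℝ × ℝ → ℝ} (hu : BalanceLaw B u M G)
    (hM : M =ᵐ[volQ T] M') (hG : G =ᵐ[volQ T] G') : BalanceLaw B u M' G' := by
  intro i t ht
  rw [hu i t ht]
  congr 1
  rw [intervalIntegral.integral_of_le ht.1, intervalIntegral.integral_of_le ht.1,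
    integral_Ioc_eq_integral_Ioo, integral_Ioc_eq_integral_Ioo]
  refine integral_congr_ae (ae_restrict_of_ae_restrict_of_subset (Ioo_subset_Ioo_right ht.2) ?_)
  filter_upwards [ae_volQ_of_ae hM, ae_volQ_of_ae hG] with s h1 h2
  refine integral_congr_ae ?_
  filter_upwards [h1, h2] with x e1 e2
  rw [e1, e2]

lemma BalanceLaw.restrict {u : SpaceH a T} {M G : ℝ × ℝ → ℝ} (hu : BalanceLaw B u M G) {S : ℝ}
    (hS : S ≤ T) : BalanceLaw B (u.restrict hS) M G :=
  fun i t ht => hu i t ⟨ht.1, ht.2.trans hS⟩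

/-- The product rule for `θ C D`, where `C`, `D` are absolutely continuous. -/
lemma mul_primitive_eq_integral (hT : 0 ≤ T) {θ m n : ℝ → ℝ} (hθ : ContDiff ℝ 1 θ)
    (hm : Integrable m (volume.restrict (Ioo 0 T))) (hn : Integrable n (volume.restrict (Ioo 0 T)))
    {C D : ℝ → ℝ} (hC : ∀ t ∈ Icc 0 T, C t = C 0 - ∫ s in (0 : ℝ)..t, m s)
    (hD : ∀ t ∈ Icc 0 T, D t = D 0 - ∫ s in (0 : ℝ)..t, n s) :
    θ T * (C T * D T) - θ 0 * (C 0 * D 0)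
      = ∫ t in Ioo 0 T, (deriv θ t * (C t * D t) - θ t * (D t * m t + C t * n t)) := by
  have h0 : (0 : ℝ) ∈ Icc 0 T := left_mem_Icc.2 hT
  have hTT : T ∈ Icc 0 T := right_mem_Icc.2 hT
  have him := intervalIntegrable_of_Ioo hm h0 hTT
  have hin := intervalIntegrable_of_Ioo hn h0 hTT
  set C' : ℝ → ℝ := fun t => C 0 - ∫ s in (0 : ℝ)..t, m s
  set D' : ℝ → ℝ := fun t => D 0 - ∫ s in (0 : ℝ)..t, n s
  have hconst : ∀ c : ℝ, AbsolutelyContinuousOnInterval (fun _ => c) 0 T := fun c =>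
    (contDiff_const (n := 1)).contDiffOn.absolutelyContinuousOnInterval
  have hCa : AbsolutelyContinuousOnInterval C' 0 T :=
    (hconst _).sub (him.absolutelyContinuousOnInterval_intervalIntegral (by simp))
  have hDa : AbsolutelyContinuousOnInterval D' 0 T :=
    (hconst _).sub (hin.absolutelyContinuousOnInterval_intervalIntegral (by simp))
  have hθa : AbsolutelyContinuousOnInterval θ 0 T :=
    hθ.contDiffOn.absolutelyContinuousOnInterval
  have h1 := (hθa.fun_mul (hCa.fun_mul hDa)).integral_deriv_eq_sub
  have e0 : C' 0 = C 0 ∧ D' 0 = D 0 := by simp [C', D']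
  rw [hC T hTT, hD T hTT]
  change θ T * (C' T * D' T) - _ = _
  rw [← e0.1, ← e0.2, ← h1, intervalIntegral_eq_Ioo hT]
  refine integral_congr_ae ?_
  rw [EventuallyEq, ae_restrict_iff' measurableSet_Ioo]
  filter_upwards [him.ae_hasDerivAt_integral, hin.ae_hasDerivAt_integral] with t k1 k2 ht
  have htI : t ∈ Icc 0 T := Ioo_subset_Icc_self ht
  have htI' : t ∈ uIcc 0 T := by rwa [uIcc_of_le hT]
  have d1 : HasDerivAt C' (-m t) t := (k1 htI' 0 (by simp)).const_sub (C 0)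
  have d2 : HasDerivAt D' (-n t) t := (k2 htI' 0 (by simp)).const_sub (D 0)
  have d3 : HasDerivAt θ (deriv θ t) t :=
    ((hθ.differentiable (by norm_num)) t).hasDerivAt
  have d4 := (d3.mul (d1.mul d2)).deriv
  have e1 : C t = C' t := hC t htI
  have e2 : D t = D' t := hD t htI
  rw [e1, e2]
  refine Eq.trans d4 ?_
  simp only [Pi.mul_apply]
  ring

lemma ae_mem_Icc_of_Ioo : ∀ᵐ t ∂(volume.restrict (Ioo 0 T)), t ∈ Icc 0 T := by
  filter_upwards [ae_restrict_mem measurableSet_Ioo] with t ht using Ioo_subset_Icc_self ht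

/-- The duality identity for two evolution equations, with a weight `θ` in time:
`d/dt (θ (u, v)) = θ' (u, v) + θ ⟨u_t, v⟩ + θ ⟨u, v_t⟩`. It is the product rule for each
eigenfunction coefficient, summed up. -/
theorem BalanceLaw.duality (hT : 0 ≤ T) {u v : SpaceH a T} {M G M' G' : ℝ × ℝ → ℝ}
    (hu : BalanceLaw B u M G) (hv : BalanceLaw B v M' G')
    (hM : MemLp M 2 (volQ T)) (hG : MemLp G 2 (volQ T))
    (hM' : MemLp M' 2 (volQ T)) (hG' : MemLp G' 2 (volQ T)) {θ : ℝ → ℝ} (hθ : ContDiff ℝ 1 θ) :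
    θ T * (∫ x, u.val T x * v.val T x ∂volΩ) - θ 0 * ∫ x, u.val 0 x * v.val 0 x ∂volΩ
      = ∫ z, (deriv θ z.1 * (u.fn z * v.fn z) - θ z.1 * ((M z * v.hardy z + G z * v.grad z)
          + (M' z * u.hardy z + G' z * u.grad z))) ∂volQ T := by
  have h0 : (0 : ℝ) ∈ Icc 0 T := left_mem_Icc.2 hT
  have hTT : T ∈ Icc 0 T := right_mem_Icc.2 hT
  have hθc := hθ.continuous
  have hθc' : Continuous (deriv θ) := hθ.continuous_deriv (by norm_num)
  obtain ⟨Cθ, hCθ⟩ := isCompact_Icc.exists_bound_of_continuousOn (hθc.continuousOn (s := Icc 0 T))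
  obtain ⟨Cθ', hCθ'⟩ :=
    isCompact_Icc.exists_bound_of_continuousOn (hθc'.continuousOn (s := Icc 0 T))
  set m : B.ι → ℝ → ℝ := fun i s => B.dualCoef (fun x => M (s, x)) (fun x => G (s, x)) i
  set n : B.ι → ℝ → ℝ := fun i s => B.dualCoef (fun x => M' (s, x)) (fun x => G' (s, x)) i
  have hm : ∀ i, Integrable (m i) (volume.restrict (Ioo 0 T)) := integrable_dualCoef hM hG
  have hn : ∀ i, Integrable (n i) (volume.restrict (Ioo 0 T)) := integrable_dualCoef hM' hG'
  set f : Finset B.ι → ℝ → ℝ := fun s t =>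
    deriv θ t * (∑ i ∈ s, u.coef B i t * v.coef B i t)
      - θ t * ((∑ i ∈ s, v.coef B i t * m i t) + ∑ i ∈ s, u.coef B i t * n i t) with hf
  have hfsum : ∀ s : Finset B.ι, (∑ i ∈ s, (θ T * (u.coef B i T * v.coef B i T)
      - θ 0 * (u.coef B i 0 * v.coef B i 0))) = ∫ t in Ioo 0 T, f s t := fun s => by
    have hii : ∀ i, Integrable (fun t => deriv θ t * (u.coef B i t * v.coef B i t)
        - θ t * (v.coef B i t * m i t + u.coef B i t * n i t)) (volume.restrict (Ioo 0 T)) := by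
      intro i
      have hcu := u.continuousOn_coef B i
      have hcv := v.continuousOn_coef B i
      have hI : ∀ {g k : ℝ → ℝ}, ContinuousOn g (Icc 0 T) →
          Integrable k (volume.restrict (Ioo 0 T)) →
          Integrable (fun t => g t * k t) (volume.restrict (Ioo 0 T)) := fun {g k} hg hk => by
        obtain ⟨C, hC⟩ := isCompact_Icc.exists_bound_of_continuousOn hg
        refine hk.bdd_mul (c := C)
          ((hg.mono Ioo_subset_Icc_self).aestronglyMeasurable measurableSet_Ioo) ?_
        filter_upwards [ae_mem_Icc_of_Ioo] with t ht using hC t ht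
      have h1 : Integrable (fun _ : ℝ => (1 : ℝ)) (volume.restrict (Ioo 0 T)) := integrable_const 1
      refine Integrable.sub ?_ (hI hθc.continuousOn ((hI hcv (hm i)).add (hI hcu (hn i))))
      have := hI (hθc'.continuousOn.mul (hcu.mul hcv)) h1
      simpa using this
    rw [Finset.sum_congr rfl fun i _ => mul_primitive_eq_integral hT hθ (hm i) (hn i) (hu i) (hv i),
      ← integral_finsetSum s fun i _ => hii i]
    refine integral_congr_ae (Eventually.of_forall fun t => ?_)
    simp only [hf, Finset.sum_sub_distrib, Finset.mul_sum, mul_add, Finset.sum_add_distrib]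
  have hlim : Tendsto (fun s : Finset B.ι => ∫ t in Ioo 0 T, f s t) atTop
      (𝓝 (∫ t in Ioo 0 T, ∫ x, (deriv θ t * (u.fn (t, x) * v.fn (t, x))
        - θ t * ((M (t, x) * v.hardy (t, x) + G (t, x) * v.grad (t, x))
          + (M' (t, x) * u.hardy (t, x) + G' (t, x) * u.grad (t, x)))) ∂volΩ)) := by
    set S : (ℝ × ℝ → ℝ) → ℝ → ℝ := fun g t => ∫ x, g (t, x) ^ 2 ∂volΩ with hS
    have hSi : ∀ {g : ℝ × ℝ → ℝ}, MemLp g 2 (volQ T) →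
        Integrable (S g) (volume.restrict (Ioo 0 T)) := fun {g} hg =>
      integrable_slice_integral hg.integrable_sq
    set K := pairingConst ha
    refine tendsto_integral_filter_of_dominated_convergence
      (fun t => Cθ' * (S u.fn t + S v.fn t) + Cθ * ((K * (S M t + S G t) + S v.grad t)
        + (K * (S M' t + S G' t) + S u.grad t))) ?_ ?_ ?_ ?_
    · refine Eventually.of_forall fun s => ?_
      have hcu := fun i => ((u.continuousOn_coef B i).mono Ioo_subset_Icc_self).aestronglyMeasurable
        (μ := volume) measurableSet_Ioo
      have hcv := fun i => ((v.continuousOn_coef B i).mono Ioo_subset_Icc_self).aestronglyMeasurable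
        (μ := volume) measurableSet_Ioo
      refine (hθc'.aestronglyMeasurable.mul ?_).sub (hθc.aestronglyMeasurable.mul (.add ?_ ?_))
      · exact Finset.aestronglyMeasurable_fun_sum s fun i _ => (hcu i).mul (hcv i)
      · exact Finset.aestronglyMeasurable_fun_sum s fun i _ => (hcv i).mul (hm i).1
      · exact Finset.aestronglyMeasurable_fun_sum s fun i _ => (hcu i).mul (hn i).1
    · refine Eventually.of_forall fun s => ?_
      filter_upwards [ae_mem_Icc_of_Ioo, u.memH1a, v.memH1a, ae_memLp_slice hM, ae_memLp_slice hG,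
        ae_memLp_slice hM', ae_memLp_slice hG'] with t ht k1 k2 k3 k4 k5 k6
      have b1 := B.abs_sum_pairing_le k2 k3 k4 s
      have b2 := B.abs_sum_pairing_le k1 k5 k6 s
      have b3 : |∑ i ∈ s, u.coef B i t * v.coef B i t| ≤ S u.fn t + S v.fn t := by
        have p1 := sum_le_hasSum s (fun i _ => mul_self_nonneg _) (B.hasSum_parseval k1.1 k1.1)
        have p2 := sum_le_hasSum s (fun i _ => mul_self_nonneg _) (B.hasSum_parseval k2.1 k2.1)
        refine (Finset.abs_sum_le_sum_abs _ _).trans ?_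
        have : ∀ i ∈ s, |u.coef B i t * v.coef B i t| ≤
            u.coef B i t * u.coef B i t + v.coef B i t * v.coef B i t := fun i _ => by
          rw [abs_le]
          constructor <;> nlinarith [sq_nonneg (u.coef B i t - v.coef B i t),
            sq_nonneg (u.coef B i t + v.coef B i t), sq_nonneg (u.coef B i t),
            sq_nonneg (v.coef B i t)]
        refine (Finset.sum_le_sum this).trans ?_
        rw [Finset.sum_add_distrib]
        simp only [hS, sq]
        exact add_le_add p1 p2
      have c1 := hCθ t ht
      have c2 := hCθ' t ht
      rw [Real.norm_eq_abs] at c1 c2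
      have hCθ0 : 0 ≤ Cθ := (abs_nonneg _).trans c1
      have hCθ'0 : 0 ≤ Cθ' := (abs_nonneg _).trans c2
      simp only [hf]
      refine (norm_sub_le _ _).trans ?_
      rw [norm_mul, norm_mul, Real.norm_eq_abs, Real.norm_eq_abs, Real.norm_eq_abs,
        Real.norm_eq_abs]
      refine add_le_add (mul_le_mul c2 b3 (abs_nonneg _) hCθ'0)
        (mul_le_mul c1 ((abs_add_le _ _).trans (add_le_add b1 b2)) (abs_nonneg _) hCθ0)
    · exact (((hSi u.memLp_fn).add (hSi v.memLp_fn)).const_mul _).add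
        ((((((hSi hM).add (hSi hG)).const_mul _).add (hSi v.memLp_grad)).add
          ((((hSi hM').add (hSi hG')).const_mul _).add (hSi u.memLp_grad))).const_mul _)
    · filter_upwards [u.memH1a, v.memH1a, ae_memLp_slice hM, ae_memLp_slice hG,
        ae_memLp_slice hM', ae_memLp_slice hG', ae_memLp_slice (u.memLp_hardy ha),
        ae_memLp_slice (v.memLp_hardy ha)] with t k1 k2 k3 k4 k5 k6 k7 k8
      have p1 := B.hasSum_parseval k1.1 k2.1
      have p2 := B.hasSum_pairing k2 k3 k4
      have p3 := B.hasSum_pairing k1 k5 k6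
      have i1 : Integrable (fun x => u.fn (t, x) * v.fn (t, x)) volΩ :=
        integrable_mul_of_memLp_two k1.1 k2.1
      have i2 : Integrable (fun x => M (t, x) * v.hardy (t, x) + G (t, x) * v.grad (t, x)) volΩ :=
        (integrable_mul_of_memLp_two k3 k8).add (integrable_mul_of_memLp_two k4 k2.2.1)
      have i3 : Integrable (fun x => M' (t, x) * u.hardy (t, x) + G' (t, x) * u.grad (t, x)) volΩ :=
        (integrable_mul_of_memLp_two k5 k7).add (integrable_mul_of_memLp_two k6 k1.2.1)
      have i23 : Integrable (fun x => (M (t, x) * v.hardy (t, x) + G (t, x) * v.grad (t, x))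
        + (M' (t, x) * u.hardy (t, x) + G' (t, x) * u.grad (t, x))) volΩ := i2.add i3
      rw [integral_sub (i1.const_mul _) (i23.const_mul _), integral_const_mul,
        integral_const_mul, integral_add i2 i3]
      exact (Tendsto.const_mul _ p1).sub (Tendsto.const_mul _ (Tendsto.add p2 p3))
  have hlhs : HasSum (fun i => θ T * (u.coef B i T * v.coef B i T)
      - θ 0 * (u.coef B i 0 * v.coef B i 0))
      (θ T * (∫ x, u.val T x * v.val T x ∂volΩ) - θ 0 * ∫ x, u.val 0 x * v.val 0 x ∂volΩ) :=
    ((B.hasSum_parseval (u.memLp_slice T hTT) (v.memLp_slice T hTT)).mul_left _).sub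
      ((B.hasSum_parseval (u.memLp_slice 0 h0) (v.memLp_slice 0 h0)).mul_left _)
  have hlhs' : Tendsto (fun s : Finset B.ι => ∑ i ∈ s, (θ T * (u.coef B i T * v.coef B i T)
      - θ 0 * (u.coef B i 0 * v.coef B i 0))) atTop
      (𝓝 (θ T * (∫ x, u.val T x * v.val T x ∂volΩ) - θ 0 * ∫ x, u.val 0 x * v.val 0 x ∂volΩ)) :=
    hlhs
  simp_rw [hfsum] at hlhs'
  rw [tendsto_nhds_unique hlhs' hlim, integral_volQ]
  refine (integrable_bounded_time_mul hθc' (integrable_mul_of_memLp_two u.memLp_fn v.memLp_fn)).sub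
    (integrable_bounded_time_mul hθc ((Integrable.add ?_ ?_).add (Integrable.add ?_ ?_)))
  · exact integrable_mul_of_memLp_two hM (v.memLp_hardy ha)
  · exact integrable_mul_of_memLp_two hG v.memLp_grad
  · exact integrable_mul_of_memLp_two hM' (u.memLp_hardy ha)
  · exact integrable_mul_of_memLp_two hG' u.memLp_grad

end BalanceLaw

/-! ### Weak formulations -/

section Weak

variable {a : ℝ → ℝ} {T : ℝ} {ha : WeaklyDegenerate a} (B : EigenBasis ha)

/-- The function `θ(t) φ(x)` as an element of `ℍ`. -/
def SpaceH.tensor (T : ℝ) {θ : ℝ → ℝ} (hθ : Continuous θ) {φ φ' : ℝ → ℝ}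
    (ha : WeaklyDegenerate a) (hφ : MemH1a a φ φ') : SpaceH a T where
  val t x := θ t * φ x
  dx t x := θ t * φ' x
  memLp_val := memLp_bounded_time_mul hθ (memLp_of_snd hφ.1)
  memLp_dx := by
    have := memLp_bounded_time_mul (T := T) hθ (memLp_of_snd hφ.2.1)
    simpa only [mul_left_comm] using this
  memH1a := Eventually.of_forall fun t => hφ.const_mul ha (θ t)
  memLp_slice t _ := hφ.1.const_mul (θ t)
  continuous_slice t₀ _ := by
    have e : ∀ t, ((fun x => θ t * φ x) - fun x => θ t₀ * φ x) = (θ t - θ t₀) • φ := fun t => by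
      ext x; simp [sub_mul]
    simp_rw [e, eLpNorm_const_smul]
    have h1 : Tendsto (fun t => θ t - θ t₀) (𝓝[Icc 0 T] t₀) (𝓝 0) := by
      have := (hθ.tendsto t₀).sub_const (θ t₀)
      rw [sub_self] at this
      exact this.mono_left nhdsWithin_le_nhds
    have h2 := (continuous_enorm.tendsto (0 : ℝ)).comp h1
    rw [enorm_zero] at h2
    have h3 := ENNReal.Tendsto.mul_const (b := eLpNorm φ 2 volΩ) h2 (Or.inr hφ.1.2.ne)
    rwa [zero_mul] at h3

/-- The test function `(c + ∫₀ᵗ η) φ(x)`. -/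
def TestFunction.tensor (T : ℝ) {η : ℝ → ℝ} (hη : Continuous η) (c : ℝ) {φ φ' : ℝ → ℝ}
    (ha : WeaklyDegenerate a) (hφ : MemH1a a φ φ') : TestFunction a T where
  toSpaceH := SpaceH.tensor T (θ := fun t => c + ∫ s in (0 : ℝ)..t, η s)
    (continuous_const.add (intervalIntegral.continuous_primitive
      (fun _ _ => hη.intervalIntegrable _ _) 0)) ha hφ
  dt t x := η t * φ x
  memLp_dt := memLp_bounded_time_mul hη (memLp_of_snd hφ.1)
  eq_integral_dt t _ := by
    refine Eventually.of_forall fun x => ?_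
    simp only [SpaceH.tensor, intervalIntegral.integral_same, add_zero,
      intervalIntegral.integral_mul_const]
    ring

variable {B}

lemma SpaceH.sqrt_mul_hardy (ha : WeaklyDegenerate a) (u : SpaceH a T) :
    ∀ᵐ z ∂volQ T, √(a z.2) * u.hardy z = u.fn z := by
  filter_upwards [ae_volQ_mem] with z hz
  rw [SpaceH.hardy, mul_left_comm, ha.sqrt_mul_invSqrt hz.2, mul_one, SpaceH.fn]

lemma WeaklyDegenerate.bounded (ha : WeaklyDegenerate a) :
    ∃ C : ℝ, ∀ x ∈ Icc (0 : ℝ) 1, √(a x) ≤ C := by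
  obtain ⟨C, hC⟩ := isCompact_Icc.exists_bound_of_continuousOn ha.continuousOn.sqrt
  exact ⟨C, fun x hx => (le_abs_self _).trans (hC x hx)⟩

lemma memLp_sqrt_snd_mul (ha : WeaklyDegenerate a) {f : ℝ × ℝ → ℝ} (hf : MemLp f 2 (volQ T)) :
    MemLp (fun z => √(a z.2) * f z) 2 (volQ T) := by
  obtain ⟨C, hC⟩ := ha.bounded
  refine memLp_two_of_abs_le hf
    ((aestronglyMeasurable_of_snd ha.aestronglyMeasurable_sqrt).mul hf.1) C ?_
  filter_upwards [ae_volQ_mem] with z hz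
  rw [abs_mul, abs_of_nonneg (Real.sqrt_nonneg _)]
  exact mul_le_mul_of_nonneg_right (hC z.2 (Ioo_subset_Icc_self hz.2)) (abs_nonneg _)

/-- A test function `φ` solves `φ_t - φ_t = 0` in the dual of `H¹ₐ(Ω)`. -/
lemma TestFunction.balanceLaw (φ : TestFunction a T) :
    BalanceLaw B φ.toSpaceH (fun z => -(√(a z.2) * φ.dt z.1 z.2)) 0 := by
  intro i t ht
  have h0T : (0 : ℝ) ∈ Icc 0 T := left_mem_Icc.2 (ht.1.trans ht.2)
  have hmono : volQ t ≤ volQ T :=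
    Measure.restrict_mono (prod_mono (Ioo_subset_Ioo_right ht.2) Subset.rfl) le_rfl
  have hint : Integrable (fun z : ℝ × ℝ => φ.dt z.1 z.2 * B.e i z.2) (volQ t) :=
    integrable_mul_of_memLp_two (φ.memLp_dt.mono_measure hmono) (memLp_of_snd (B.memLp_e i))
  have h1 : φ.coef B i t - φ.coef B i 0
      = ∫ x, (∫ s in Ioo 0 t, φ.dt s x * B.e i x) ∂volΩ := by
    rw [SpaceH.coef, SpaceH.coef, ← integral_sub
      (integrable_mul_of_memLp_two (φ.memLp_slice t ht) (B.memLp_e i))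
      (integrable_mul_of_memLp_two (φ.memLp_slice 0 h0T) (B.memLp_e i))]
    refine integral_congr_ae ?_
    filter_upwards [φ.eq_integral_dt t ht] with x hx
    rw [hx, intervalIntegral_eq_Ioo ht.1, integral_mul_const]
    ring
  have h2 : ∫ x, (∫ s in Ioo 0 t, φ.dt s x * B.e i x) ∂volΩ
      = ∫ s in Ioo 0 t, ∫ x, φ.dt s x * B.e i x ∂volΩ := by
    rw [volQ_eq_prod] at hint
    exact (integral_integral_swap hint).symm
  have h3 : ∫ s in (0 : ℝ)..t, B.dualCoef (fun x => -(√(a x) * φ.dt s x)) (fun _ => 0) i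
      = -∫ s in Ioo 0 t, ∫ x, φ.dt s x * B.e i x ∂volΩ := by
    rw [intervalIntegral_eq_Ioo ht.1, ← integral_neg]
    congr 1
    ext s
    rw [EigenBasis.dualCoef, ← integral_neg]
    refine integral_congr_ae ?_
    filter_upwards [ae_volΩ_mem] with x hx
    have := ha.sqrt_mul_invSqrt hx
    linear_combination (-(φ.dt s x * B.e i x)) * this
  have h4 : φ.coef B i t = φ.coef B i 0 + ∫ s in Ioo 0 t, ∫ x, φ.dt s x * B.e i x ∂volΩ := by
    rw [← h2, ← h1]; ring
  rw [h4]
  simp only [Pi.zero_apply]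
  rw [h3]; ring

lemma memLp_testFunction_dt (ha : WeaklyDegenerate a) (φ : TestFunction a T) :
    MemLp (fun z : ℝ × ℝ => -(√(a z.2) * φ.dt z.1 z.2)) 2 (volQ T) :=
  (memLp_sqrt_snd_mul ha φ.memLp_dt).neg

/-- An evolution equation may be tested with any test function. -/
lemma BalanceLaw.test (hT : 0 ≤ T) {u : SpaceH a T} {M G : ℝ × ℝ → ℝ} (hu : BalanceLaw B u M G)
    (hM : MemLp M 2 (volQ T)) (hG : MemLp G 2 (volQ T)) (φ : TestFunction a T) :
    (∫ x, u.val T x * φ.val T x ∂volΩ) - ∫ x, u.val 0 x * φ.val 0 x ∂volΩ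
      = (∫ z, u.val z.1 z.2 * φ.dt z.1 z.2 ∂volQ T)
        - ∫ z, (M z * φ.hardy z + G z * φ.grad z) ∂volQ T := by
  have h := hu.duality hT φ.balanceLaw hM hG (memLp_testFunction_dt ha φ) MemLp.zero
    (θ := fun _ => 1) contDiff_const
  rw [one_mul, one_mul] at h
  have i1 : Integrable (fun z : ℝ × ℝ => u.val z.1 z.2 * φ.dt z.1 z.2) (volQ T) :=
    integrable_mul_of_memLp_two u.memLp_val φ.memLp_dt
  rw [h, ← integral_sub i1]
  · refine integral_congr_ae ?_
    filter_upwards [u.sqrt_mul_hardy ha] with z hz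
    simp only [deriv_const, Pi.zero_apply, SpaceH.fn] at hz ⊢
    linear_combination (φ.dt z.1 z.2) * hz
  · exact (integrable_mul_of_memLp_two hM (φ.memLp_hardy ha)).add
      (integrable_mul_of_memLp_two hG φ.memLp_grad)

/-- The fundamental lemma of the calculus of variations for continuous functions on `[0,T]`. -/
lemma eq_zero_of_integral_mul_eq_zero (hT : 0 < T) {q : ℝ → ℝ} (hq : ContinuousOn q (Icc 0 T))
    (h : ∀ η : ℝ → ℝ, Continuous η → ∫ t in Ioo 0 T, η t * q t = 0) : ∀ t ∈ Icc 0 T, q t = 0 := by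
  let η : ℝ → ℝ := IccExtend hT.le (Set.domRestrict (Icc 0 T) q)
  have hη : Continuous η := (continuousOn_iff_continuous_domRestrict.1 hq).Icc_extend'
  have hηq : ∀ t ∈ Icc 0 T, η t = q t := fun t ht => by
    simp only [η]
    rw [IccExtend_of_mem _ _ ht]
    rfl
  have hqm : MemLp q 2 (volume.restrict (Ioo 0 T)) := by
    obtain ⟨C, hC⟩ := isCompact_Icc.exists_bound_of_continuousOn hq
    refine MemLp.of_bound ((hq.mono Ioo_subset_Icc_self).aestronglyMeasurable measurableSet_Ioo) C ?_
    filter_upwards [ae_mem_Icc_of_Ioo] with t ht using hC t ht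
  have h1 : ∫ t in Ioo 0 T, q t ^ 2 = 0 := by
    refine (integral_congr_ae ?_).trans (h η hη)
    filter_upwards [ae_mem_Icc_of_Ioo] with t ht
    rw [hηq t ht, sq]
  have h2 := Measure.eqOn_open_of_ae_eq (ae_eq_zero_of_integral_sq hqm h1.le) isOpen_Ioo
    (hq.mono Ioo_subset_Icc_self) continuousOn_const
  have h3 : EqOn q (fun _ => 0) (Icc 0 T) :=
    EqOn.of_subset_closure h2 hq continuousOn_const Ioo_subset_Icc_self
      (by rw [closure_Ioo hT.ne])
  exact h3

/-- The weak formulation, tested with a function `(c + ∫₀ᵗ η) eᵢ`. -/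
lemma integral_tensor_test (hT : 0 ≤ T) (u : SpaceH a T) {M G : ℝ × ℝ → ℝ}
    (hM : MemLp M 2 (volQ T)) (hG : MemLp G 2 (volQ T)) (i : B.ι) {η : ℝ → ℝ} (hη : Continuous η)
    (c : ℝ) :
    (∫ z, u.val z.1 z.2 * (TestFunction.tensor T hη c ha (B.memH1a_e i)).dt z.1 z.2 ∂volQ T
        = ∫ t in Ioo 0 T, η t * u.coef B i t) ∧
      ∫ z, (M z * (TestFunction.tensor T hη c ha (B.memH1a_e i)).hardy z
          + G z * (TestFunction.tensor T hη c ha (B.memH1a_e i)).grad z) ∂volQ T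
        = (c + ∫ s in (0 : ℝ)..T, η s)
            * (∫ s in (0 : ℝ)..T, B.dualCoef (fun x => M (s, x)) (fun x => G (s, x)) i)
          - ∫ t in Ioo 0 T, η t
            * ∫ s in (0 : ℝ)..t, B.dualCoef (fun x => M (s, x)) (fun x => G (s, x)) i := by
  set φ := TestFunction.tensor T hη c ha (B.memH1a_e i) with hφ
  constructor
  · have i1 : Integrable (fun z : ℝ × ℝ => u.val z.1 z.2 * φ.dt z.1 z.2) (volQ T) :=
      integrable_mul_of_memLp_two u.memLp_val φ.memLp_dt
    rw [integral_volQ i1]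
    congr 1
    ext t
    rw [SpaceH.coef, ← integral_const_mul]
    congr 1
    ext x
    simp only [hφ, TestFunction.tensor]
    ring
  · set m : ℝ → ℝ := fun s => B.dualCoef (fun x => M (s, x)) (fun x => G (s, x)) i with hm
    have hmi : Integrable m (volume.restrict (Ioo 0 T)) := integrable_dualCoef hM hG i
    set θ : ℝ → ℝ := fun t => c + ∫ s in (0 : ℝ)..t, η s with hθ
    have hθd : ∀ t, HasDerivAt θ (η t) t := fun t =>
      (intervalIntegral.integral_hasDerivAt_right (hη.intervalIntegrable _ _)
        (hη.stronglyMeasurableAtFilter _ _) hη.continuousAt).const_add c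
    have hθ' : deriv θ = η := funext fun t => (hθd t).deriv
    have hθC : ContDiff ℝ 1 θ := by
      rw [contDiff_one_iff_deriv]
      exact ⟨fun t => (hθd t).differentiableAt, by rwa [hθ']⟩
    have h1 := mul_primitive_eq_integral hT (m := m) (n := fun _ => 0) hθC hmi (integrable_zero _ _ _)
      (C := fun t => -∫ s in (0 : ℝ)..t, m s) (D := fun _ => 1) (fun t _ => by simp)
      (fun t _ => by simp)
    simp only [intervalIntegral.integral_same, mul_one, one_mul, neg_zero, mul_zero, sub_zero,
      add_zero, hθ'] at h1
    have h2 : ∫ z, (M z * φ.hardy z + G z * φ.grad z) ∂volQ T = ∫ t in Ioo 0 T, θ t * m t := by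
      rw [integral_volQ ((integrable_mul_of_memLp_two hM (φ.memLp_hardy ha)).fun_add
        (integrable_mul_of_memLp_two hG φ.memLp_grad))]
      congr 1
      ext t
      rw [hm]
      simp only [EigenBasis.dualCoef]
      rw [← integral_const_mul]
      refine integral_congr_ae ?_
      filter_upwards [ae_volΩ_mem] with x hx
      have := ha.sqrt_mul_invSqrt hx
      simp only [hφ, TestFunction.tensor, SpaceH.tensor, SpaceH.hardy, SpaceH.grad, hθ]
      linear_combination (G (t, x) * (c + ∫ s in (0 : ℝ)..t, η s) * B.w i x) * this
    have hKc : ContinuousOn (fun t => ∫ s in (0 : ℝ)..t, m s) (Icc 0 T) := by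
      have := intervalIntegral.continuousOn_primitive_interval (μ := volume) (f := m) (a := 0)
        (b := T) (by rw [uIcc_of_le hT, integrableOn_Icc_iff_integrableOn_Ioo]; exact hmi)
      rwa [uIcc_of_le hT] at this
    have hKi : Integrable (fun t => η t * ∫ s in (0 : ℝ)..t, m s) (volume.restrict (Ioo 0 T)) :=
      ((hη.continuousOn.mul hKc).integrableOn_Icc).mono_set Ioo_subset_Icc_self
    have hθm : Integrable (fun t => θ t * m t) (volume.restrict (Ioo 0 T)) := by
      obtain ⟨C, hC⟩ := isCompact_Icc.exists_bound_of_continuousOn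
        (hθC.continuous.continuousOn (s := Icc 0 T))
      refine hmi.bdd_mul (c := C) hθC.continuous.aestronglyMeasurable ?_
      filter_upwards [ae_mem_Icc_of_Ioo] with t ht using hC t ht
    simp only [mul_neg] at h1
    rw [integral_sub hKi.fun_neg hθm, integral_neg] at h1
    rw [h2]
    change _ = θ T * (∫ s in (0 : ℝ)..T, m s) - ∫ t in Ioo 0 T, η t * ∫ s in (0 : ℝ)..t, m s
    linarith

lemma ae_eq_of_coef_eq {f g : ℝ → ℝ} (hf : MemLp f 2 volΩ) (hg : MemLp g 2 volΩ)
    (h : ∀ i, ∫ x, f x * B.e i x ∂volΩ = ∫ x, g x * B.e i x ∂volΩ) : f =ᵐ[volΩ] g := by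
  have hd := hf.sub hg
  have h1 : ∀ i, ∫ x, (f - g) x * B.e i x ∂volΩ = 0 := fun i => by
    simp only [Pi.sub_apply, sub_mul]
    rw [integral_sub (integrable_mul_of_memLp_two hf (B.memLp_e i))
      (integrable_mul_of_memLp_two hg (B.memLp_e i)), h i, sub_self]
  have h2 := B.hasSum_parseval hd hd
  simp_rw [h1, mul_zero] at h2
  have h3 := h2.unique hasSum_zero
  have h4 := ae_eq_zero_of_integral_sq hd (by simpa only [sq] using h3.le)
  filter_upwards [h4] with x hx
  exact sub_eq_zero.1 hx

lemma continuousOn_primitive_dualCoef (hT : 0 ≤ T) {M G : ℝ × ℝ → ℝ} (hM : MemLp M 2 (volQ T))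
    (hG : MemLp G 2 (volQ T)) (i : B.ι) :
    ContinuousOn (fun t => ∫ s in (0 : ℝ)..t,
      B.dualCoef (fun x => M (s, x)) (fun x => G (s, x)) i) (Icc 0 T) := by
  have := intervalIntegral.continuousOn_primitive_interval (μ := volume)
    (f := fun s => B.dualCoef (fun x => M (s, x)) (fun x => G (s, x)) i) (a := 0)
    (b := T) (by
      rw [uIcc_of_le hT, integrableOn_Icc_iff_integrableOn_Ioo]
      exact integrable_dualCoef hM hG i)
  rwa [uIcc_of_le hT] at this

/-- The weak form of an initial value problem is the evolution equation together with the
initial condition. -/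
theorem forward_weak_iff (hT : 0 < T) (u : SpaceH a T) {M G : ℝ × ℝ → ℝ}
    (hM : MemLp M 2 (volQ T)) (hG : MemLp G 2 (volQ T)) {y₀ : ℝ → ℝ} (hy₀ : MemLp y₀ 2 volΩ) :
    (∀ φ : TestFunction a T, φ.val T =ᵐ[volΩ] 0 →
      -(∫ z, u.val z.1 z.2 * φ.dt z.1 z.2 ∂volQ T)
        + ∫ z, (M z * φ.hardy z + G z * φ.grad z) ∂volQ T = ∫ x, y₀ x * φ.val 0 x ∂volΩ) ↔
      BalanceLaw B u M G ∧ u.val 0 =ᵐ[volΩ] y₀ := by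
  have h0 : (0 : ℝ) ∈ Icc 0 T := left_mem_Icc.2 hT.le
  constructor
  · intro h
    have key : ∀ i, ∀ t ∈ Icc 0 T, u.coef B i t = (∫ x, y₀ x * B.e i x ∂volΩ)
        - ∫ s in (0 : ℝ)..t, B.dualCoef (fun x => M (s, x)) (fun x => G (s, x)) i := by
      intro i
      have hKc := continuousOn_primitive_dualCoef hT.le hM hG i
      set K : ℝ → ℝ := fun t => ∫ s in (0 : ℝ)..t,
        B.dualCoef (fun x => M (s, x)) (fun x => G (s, x)) i with hK
      have hcc := u.continuousOn_coef B i
      have hz := eq_zero_of_integral_mul_eq_zero hT (q := fun t => u.coef B i t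
        - (∫ x, y₀ x * B.e i x ∂volΩ) + K t) ((hcc.sub continuousOn_const).add hKc) ?_
      · intro t ht
        have := hz t ht
        linarith
      · intro η hη
        have h1 := integral_tensor_test hT.le u hM hG i hη (-∫ s in (0 : ℝ)..T, η s)
        have h2 := h (TestFunction.tensor T hη (-∫ s in (0 : ℝ)..T, η s) ha (B.memH1a_e i)) (by
          refine Eventually.of_forall fun x => ?_
          simp [TestFunction.tensor, SpaceH.tensor])
        rw [h1.1, h1.2] at h2
        have h3 : ∫ x, y₀ x * (TestFunction.tensor T hη (-∫ s in (0 : ℝ)..T, η s) ha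
            (B.memH1a_e i)).val 0 x ∂volΩ
            = -(∫ s in Ioo 0 T, η s) * ∫ x, y₀ x * B.e i x ∂volΩ := by
          rw [← integral_const_mul]
          congr 1
          ext x
          simp only [TestFunction.tensor, SpaceH.tensor, intervalIntegral.integral_same, add_zero]
          rw [intervalIntegral_eq_Ioo hT.le]
          ring
        rw [h3, neg_add_cancel, zero_mul] at h2
        have i1 : Integrable (fun t => η t * u.coef B i t) (volume.restrict (Ioo 0 T)) :=
          ((hη.continuousOn.mul hcc).integrableOn_Icc).mono_set Ioo_subset_Icc_self
        have i2 : Integrable (fun t => η t * K t) (volume.restrict (Ioo 0 T)) :=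
          ((hη.continuousOn.mul hKc).integrableOn_Icc).mono_set Ioo_subset_Icc_self
        have i3 : Integrable η (volume.restrict (Ioo 0 T)) :=
          (hη.continuousOn.integrableOn_Icc).mono_set Ioo_subset_Icc_self
        have e : ∀ t, η t * (u.coef B i t - (∫ x, y₀ x * B.e i x ∂volΩ) + K t)
            = (η t * u.coef B i t - η t * (∫ x, y₀ x * B.e i x ∂volΩ)) + η t * K t :=
          fun t => by ring
        simp_rw [e]
        have i4 : Integrable (fun t => η t * u.coef B i t - η t * ∫ x, y₀ x * B.e i x ∂volΩ)
            (volume.restrict (Ioo 0 T)) := i1.sub (i3.mul_const _)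
        rw [integral_add i4 i2, integral_sub i1 (i3.mul_const _),
          integral_mul_const]
        linarith
    have hini : ∀ i, u.coef B i 0 = ∫ x, y₀ x * B.e i x ∂volΩ := fun i => by
      rw [key i 0 h0]; simp
    exact ⟨fun i t ht => by rw [key i t ht, hini], ae_eq_of_coef_eq (u.memLp_slice 0 h0) hy₀ hini⟩
  · rintro ⟨h1, h2⟩ φ hφ
    have h3 := h1.test hT.le hM hG φ
    have h4 : ∫ x, u.val T x * φ.val T x ∂volΩ = 0 := by
      refine (integral_congr_ae ?_).trans (integral_zero ℝ ℝ (μ := volΩ))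
      filter_upwards [hφ] with x hx
      rw [hx]; simp
    have h5 : ∫ x, u.val 0 x * φ.val 0 x ∂volΩ = ∫ x, y₀ x * φ.val 0 x ∂volΩ := by
      refine integral_congr_ae ?_
      filter_upwards [h2] with x hx
      rw [hx]
    rw [h4, h5] at h3
    linarith

/-- The weak form of a final value problem is the evolution equation together with the
final condition. -/
theorem backward_weak_iff (hT : 0 < T) (u : SpaceH a T) {M G : ℝ × ℝ → ℝ}
    (hM : MemLp M 2 (volQ T)) (hG : MemLp G 2 (volQ T)) :
    (∀ φ : TestFunction a T, φ.val 0 =ᵐ[volΩ] 0 →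
      (∫ z, u.val z.1 z.2 * φ.dt z.1 z.2 ∂volQ T)
        + ∫ z, (M z * φ.hardy z + G z * φ.grad z) ∂volQ T = 0) ↔
      BalanceLaw B u (fun z => -M z) (fun z => -G z) ∧ u.val T =ᵐ[volΩ] 0 := by
  have h0 : (0 : ℝ) ∈ Icc 0 T := left_mem_Icc.2 hT.le
  have hTT : T ∈ Icc 0 T := right_mem_Icc.2 hT.le
  constructor
  · intro h
    have key : ∀ i, ∀ t ∈ Icc 0 T, u.coef B i t =
        (∫ s in (0 : ℝ)..t, B.dualCoef (fun x => M (s, x)) (fun x => G (s, x)) i)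
        - ∫ s in (0 : ℝ)..T, B.dualCoef (fun x => M (s, x)) (fun x => G (s, x)) i := by
      intro i
      have hKc := continuousOn_primitive_dualCoef hT.le hM hG i
      set K : ℝ → ℝ := fun t => ∫ s in (0 : ℝ)..t,
        B.dualCoef (fun x => M (s, x)) (fun x => G (s, x)) i with hK
      have hcc := u.continuousOn_coef B i
      have hz := eq_zero_of_integral_mul_eq_zero hT (q := fun t => u.coef B i t + K T - K t)
        ((hcc.add continuousOn_const).sub hKc) ?_
      · intro t ht
        have := hz t ht
        change u.coef B i t = K t - K T
        linarith
      · intro η hη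
        have h1 := integral_tensor_test hT.le u hM hG i hη 0
        have h2 := h (TestFunction.tensor T hη 0 ha (B.memH1a_e i)) (by
          refine Eventually.of_forall fun x => ?_
          simp [TestFunction.tensor, SpaceH.tensor])
        rw [h1.1, h1.2, zero_add, intervalIntegral_eq_Ioo hT.le] at h2
        have i1 : Integrable (fun t => η t * u.coef B i t) (volume.restrict (Ioo 0 T)) :=
          ((hη.continuousOn.mul hcc).integrableOn_Icc).mono_set Ioo_subset_Icc_self
        have i2 : Integrable (fun t => η t * K t) (volume.restrict (Ioo 0 T)) :=
          ((hη.continuousOn.mul hKc).integrableOn_Icc).mono_set Ioo_subset_Icc_self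
        have i3 : Integrable η (volume.restrict (Ioo 0 T)) :=
          (hη.continuousOn.integrableOn_Icc).mono_set Ioo_subset_Icc_self
        have e : ∀ t, η t * (u.coef B i t + K T - K t)
            = (η t * u.coef B i t + η t * K T) - η t * K t :=
          fun t => by ring
        simp_rw [e]
        rw [integral_sub (i1.fun_add (i3.mul_const _)) i2, integral_add i1 (i3.mul_const _),
          integral_mul_const]
        linarith
    refine ⟨fun i t ht => ?_, ae_eq_of_coef_eq (B := B) (u.memLp_slice T hTT) MemLp.zero fun i => ?_⟩
    · have e : ∀ s, B.dualCoef (fun x => -M (s, x)) (fun x => -G (s, x)) i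
          = -B.dualCoef (fun x => M (s, x)) (fun x => G (s, x)) i := fun s => by
        rw [EigenBasis.dualCoef, EigenBasis.dualCoef, ← integral_neg]
        congr 1
        ext x; ring
      simp_rw [e]
      rw [intervalIntegral.integral_neg, key i t ht, key i 0 h0, intervalIntegral.integral_same]
      ring
    · have := key i T hTT
      rw [sub_self] at this
      simpa [SpaceH.coef] using this
  · rintro ⟨h1, h2⟩ φ hφ
    have h3 := h1.test hT.le hM.neg hG.neg φ
    have h4 : ∫ x, u.val T x * φ.val T x ∂volΩ = 0 := by
      refine (integral_congr_ae ?_).trans (integral_zero ℝ ℝ (μ := volΩ))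
      filter_upwards [h2] with x hx
      rw [hx]; simp
    have h5 : ∫ x, u.val 0 x * φ.val 0 x ∂volΩ = 0 := by
      refine (integral_congr_ae ?_).trans (integral_zero ℝ ℝ (μ := volΩ))
      filter_upwards [hφ] with x hx
      rw [hx]; simp
    have h6 : ∫ z, (-M z * φ.hardy z + -G z * φ.grad z) ∂volQ T
        = -∫ z, (M z * φ.hardy z + G z * φ.grad z) ∂volQ T := by
      rw [← integral_neg]
      congr 1
      ext z; ring
    rw [h4, h5, h6] at h3
    linarith

end Weak

/-! ### Completeness of `ℍ` -/

section Complete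

variable {a : ℝ → ℝ} {T : ℝ}

lemma exists_subseq_ae_tendsto_zero {α : Type*} [MeasurableSpace α] {ν : Measure α}
    {f : ℕ → α → ℝ} (hf : ∀ n, Integrable (f n) ν) (h0 : ∀ n x, 0 ≤ f n x)
    (h : Tendsto (fun n => ∫ x, f n x ∂ν) atTop (𝓝 0)) :
    ∃ ns : ℕ → ℕ, StrictMono ns ∧ ∀ᵐ x ∂ν, Tendsto (fun k => f (ns k) x) atTop (𝓝 0) := by
  refine TendstoInMeasure.exists_seq_tendsto_ae (g := fun _ => (0 : ℝ)) ?_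
  refine tendstoInMeasure_of_tendsto_eLpNorm one_ne_zero (fun n => (hf n).1)
    aestronglyMeasurable_const ?_
  have e : ∀ n, eLpNorm (f n - fun _ => (0 : ℝ)) 1 ν = ENNReal.ofReal (∫ x, f n x ∂ν) := fun n => by
    have : (f n - fun _ => (0 : ℝ)) = f n := by ext x; simp
    rw [this, eLpNorm_one_eq_lintegral_enorm, ← ofReal_integral_norm_eq_lintegral_enorm (hf n)]
    congr 1
    exact integral_congr_ae (Eventually.of_forall fun x => Real.norm_of_nonneg (h0 n x))
  simp_rw [e]
  simpa using ENNReal.tendsto_ofReal h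

/-- `H¹ₐ(Ω)` is closed: the derivative passes to the limit. -/
lemma MemH1a.of_tendsto (ha : WeaklyDegenerate a) {un un' : ℕ → ℝ → ℝ} {u u' : ℝ → ℝ}
    (h : ∀ n, MemH1a a (un n) (un' n)) (hu : MemLp u 2 volΩ)
    (hu' : MemLp (fun x => √(a x) * u' x) 2 volΩ)
    (h1 : Tendsto (fun n => ∫ x, (un n x - u x) ^ 2 ∂volΩ) atTop (𝓝 0))
    (h2 : Tendsto (fun n => ∫ x, (√(a x) * un' n x - √(a x) * u' x) ^ 2 ∂volΩ) atTop (𝓝 0)) :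
    MemH1a a u u' := by
  have hmean : ∫ x, u' x ∂volΩ = 0 := by
    have e : ∀ v : ℝ → ℝ, ∫ x, √(a x) * v x * invSqrt a x ∂volΩ = ∫ x, v x ∂volΩ := fun v => by
      refine integral_congr_ae ?_
      filter_upwards [ae_volΩ_mem] with x hx
      rw [mul_right_comm, ha.sqrt_mul_invSqrt hx, one_mul]
    have := tendsto_integral_mul (fun n => (h n).2.1) hu' ha.memLp_invSqrt h2
    simp_rw [e, (ha.memH1a_iff.1 (h _)).2.1] at this
    exact (tendsto_nhds_unique this tendsto_const_nhds)
  refine ha.memH1a_iff.2 ⟨hu', hmean, ?_⟩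
  have hv := ha.memH1a_primitive hu' hmean
  set v : ℝ → ℝ := fun x => ∫ s in (0 : ℝ)..x, u' s
  set K := ∫ s, invSqrt a s ^ 2 ∂volΩ
  have hb : ∀ n, ∫ x, (u x - v x) ^ 2 ∂volΩ ≤ 2 * (∫ x, (un n x - u x) ^ 2 ∂volΩ)
      + 2 * (K * ∫ x, (√(a x) * un' n x - √(a x) * u' x) ^ 2 ∂volΩ) := fun n => by
    have hd := ha.ae_sq_le ((h n).sub ha hv)
    simp only [mul_sub] at hd
    have i1 : Integrable (fun x => 2 * (un n x - u x) ^ 2) volΩ :=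
      (((h n).1.sub hu).integrable_sq).const_mul 2
    have : ∀ c : ℝ, c = ∫ _x : ℝ, c ∂volΩ := fun c => by simp
    rw [this (2 * (K * _)), ← integral_const_mul, ← integral_add i1 (integrable_const _)]
    refine integral_mono_ae (hu.sub hv.1).integrable_sq (i1.add (integrable_const _)) ?_
    filter_upwards [hd] with x hx
    nlinarith [sq_nonneg (un n x - u x + (un n x - v x))]
  have hlim : Tendsto (fun n => 2 * (∫ x, (un n x - u x) ^ 2 ∂volΩ)
      + 2 * (K * ∫ x, (√(a x) * un' n x - √(a x) * u' x) ^ 2 ∂volΩ)) atTop (𝓝 0) := by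
    simpa using (h1.const_mul 2).add ((h2.const_mul K).const_mul 2)
  have hz := ae_eq_zero_of_integral_sq (hu.sub hv.1) (ge_of_tendsto' hlim hb)
  filter_upwards [hz] with x hx
  simpa [sub_eq_zero] using hx

/-- A sequence that is Cauchy in `L²` with summable rate converges in `L²` to its pointwise limit. -/
lemma exists_limit_of_summable {α : Type*} [MeasurableSpace α] {ν : Measure α}
    {f : ℕ → α → ℝ} (hf : ∀ n, MemLp (f n) 2 ν) {b : ℕ → ℝ} (hb0 : ∀ n, 0 ≤ b n)
    (hb : Summable b)
    (h : ∀ N n, N ≤ n → ∫ x, (f n x - f N x) ^ 2 ∂ν ≤ b N ^ 2) :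
    (∀ᵐ x ∂ν, Tendsto (fun n => f n x) atTop (𝓝 (limUnder atTop fun n => f n x))) ∧
      ∀ g : α → ℝ, (∀ᵐ x ∂ν, Tendsto (fun n => f n x) atTop (𝓝 (g x))) →
        MemLp g 2 ν ∧ Tendsto (fun n => ∫ x, (f n x - g x) ^ 2 ∂ν) atTop (𝓝 0) := by
  have hm : ∀ n, AEStronglyMeasurable (f n) ν := fun n => (hf n).1
  have hs : Summable fun N => 2 * b N + (1 / 2 : ℝ) ^ N :=
    (hb.mul_left 2).add summable_geometric_two
  have hB : ∑' N, ENNReal.ofReal (2 * b N + (1 / 2 : ℝ) ^ N) ≠ ⊤ := hs.tsum_ofReal_ne_top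
  have hle : ∀ N n, N ≤ n → eLpNorm (f n - f N) 2 ν ≤ ENNReal.ofReal (b N) := fun N n hNn => by
    rw [eLpNorm_two_eq ((hf n).sub (hf N))]
    refine ENNReal.ofReal_le_ofReal ?_
    rw [← Real.sqrt_sq (hb0 N)]
    exact Real.sqrt_le_sqrt (h N n hNn)
  have hc : ∀ N n m, N ≤ n → N ≤ m →
      eLpNorm (f n - f m) 2 ν < ENNReal.ofReal (2 * b N + (1 / 2 : ℝ) ^ N) := fun N n m hn hm' => by
    have e : f n - f m = (f n - f N) - (f m - f N) := by abel
    rw [e]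
    refine (eLpNorm_sub_le ((hm n).sub (hm N)) ((hm m).sub (hm N)) (by norm_num)).trans_lt ?_
    refine (add_le_add (hle N n hn) (hle N m hm')).trans_lt ?_
    have hp : (0 : ℝ) < (1 / 2) ^ N := by positivity
    rw [← ENNReal.ofReal_add (hb0 N) (hb0 N)]
    exact (ENNReal.ofReal_lt_ofReal_iff (by linarith [hb0 N])).2 (by linarith)
  refine ⟨?_, fun g hg => ?_⟩
  · filter_upwards [Lp.ae_tendsto_of_cauchy_eLpNorm hm (by norm_num) hB hc] with x hx
    exact tendsto_nhds_limUnder hx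
  · have h1 := Lp.cauchy_tendsto_of_tendsto hm g hB hc hg
    have hgm : AEStronglyMeasurable g ν := aestronglyMeasurable_of_tendsto_ae atTop hm hg
    have h2 := Lp.memLp_of_cauchy_tendsto (by norm_num) hf g hgm h1
    exact ⟨h2, (tendsto_eLpNorm_two_iff fun n => (hf n).sub h2).1 h1⟩

/-- `ℍ` is complete. -/
theorem SpaceH.exists_limit (ha : WeaklyDegenerate a) (y : ℕ → SpaceH a T)
    {b : ℕ → ℝ} (hb0 : ∀ n, 0 ≤ b n) (hb : Summable b)
    (h1 : ∀ N n, N ≤ n → ∀ t ∈ Icc 0 T, ∫ x, ((y n).val t x - (y N).val t x) ^ 2 ∂volΩ ≤ b N ^ 2)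
    (h2 : ∀ N n, N ≤ n → ∫ z, ((y n).fn z - (y N).fn z) ^ 2 ∂volQ T ≤ b N ^ 2)
    (h3 : ∀ N n, N ≤ n → ∫ z, ((y n).grad z - (y N).grad z) ^ 2 ∂volQ T ≤ b N ^ 2) :
    ∃ u : SpaceH a T,
      (∀ t ∈ Icc 0 T, Tendsto (fun n => ∫ x, ((y n).val t x - u.val t x) ^ 2 ∂volΩ) atTop (𝓝 0)) ∧
      Tendsto (fun n => ∫ z, ((y n).fn z - u.fn z) ^ 2 ∂volQ T) atTop (𝓝 0) ∧
      Tendsto (fun n => ∫ z, ((y n).grad z - u.grad z) ^ 2 ∂volQ T) atTop (𝓝 0) := by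
  set val : ℝ → ℝ → ℝ := fun t x => limUnder atTop fun n => (y n).val t x with hval
  set dx : ℝ → ℝ → ℝ := fun t x => limUnder atTop fun n => (y n).dx t x with hdx
  have hs : ∀ t ∈ Icc 0 T, MemLp (val t) 2 volΩ ∧
      Tendsto (fun n => ∫ x, ((y n).val t x - val t x) ^ 2 ∂volΩ) atTop (𝓝 0) := fun t ht => by
    have := exists_limit_of_summable (fun n => (y n).memLp_slice t ht) hb0 hb
      (fun N n hNn => h1 N n hNn t ht)
    exact this.2 _ this.1
  obtain ⟨hf1, hf2⟩ := exists_limit_of_summable (fun n => (y n).memLp_fn) hb0 hb h2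
  obtain ⟨hv1, hv2⟩ := hf2 (fun z => val z.1 z.2) hf1
  obtain ⟨hg1, hg2⟩ := exists_limit_of_summable (fun n => (y n).memLp_grad) hb0 hb h3
  obtain ⟨hd1, hd2⟩ := hg2 (fun z => √(a z.2) * dx z.1 z.2) (by
    filter_upwards [hg1, ae_volQ_mem] with z hz hzm
    have hconv : Tendsto (fun n => (y n).dx z.1 z.2) atTop
        (𝓝 (invSqrt a z.2 * limUnder atTop fun n => (y n).grad z)) := by
      refine (hz.const_mul (invSqrt a z.2)).congr fun n => ?_
      rw [SpaceH.grad, ← mul_assoc, mul_comm (invSqrt a z.2), ha.sqrt_mul_invSqrt hzm.2, one_mul]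
    have := hconv.limUnder_eq
    simp only [hdx, this]
    exact hconv.const_mul _ |>.congr fun n => by rfl)
  have hcontr : ∀ N, ∀ t ∈ Icc 0 T, eLpNorm ((y N).val t - val t) 2 volΩ
      ≤ ENNReal.ofReal (b N) := fun N t ht => by
    have hm := ((y N).memLp_slice t ht).sub (hs t ht).1
    have hlim : Tendsto (fun n => √(∫ x, ((y n).val t x - val t x) ^ 2 ∂volΩ) + b N) atTop
        (𝓝 (b N)) := by simpa using (hs t ht).2.sqrt.add_const (b N)
    rw [eLpNorm_two_eq hm]
    refine ENNReal.ofReal_le_ofReal (ge_of_tendsto hlim ?_)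
    filter_upwards [eventually_ge_atTop N] with n hn
    have k1 := sqrt_integral_sq_add_le (((y N).memLp_slice t ht).sub ((y n).memLp_slice t ht))
      (((y n).memLp_slice t ht).sub (hs t ht).1)
    simp only [Pi.sub_apply, sub_add_sub_cancel] at k1 ⊢
    have k2 : √(∫ x, ((y N).val t x - (y n).val t x) ^ 2 ∂volΩ) ≤ b N := by
      rw [← Real.sqrt_sq (hb0 N)]
      simp_rw [sub_sq_comm ((y N).val t _)]
      exact Real.sqrt_le_sqrt (h1 N n hn t ht)
    linarith
  have hbt : Tendsto (fun N => ENNReal.ofReal (b N)) atTop (𝓝 0) := by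
    simpa using ENNReal.tendsto_ofReal hb.tendsto_atTop_zero
  let u : SpaceH a T :=
    { val := val
      dx := dx
      memLp_val := hv1
      memLp_dx := hd1
      memLp_slice := fun t ht => (hs t ht).1
      memH1a := by
        obtain ⟨ns, hns, hae⟩ := exists_subseq_ae_tendsto_zero
          (f := fun n t => ∫ x, (√(a x) * (y n).dx t x - √(a x) * dx t x) ^ 2 ∂volΩ)
          (ν := volume.restrict (Ioo 0 T))
          (fun n => integrable_slice_integral ((y n).memLp_grad.sub hd1).integrable_sq)
          (fun n t => integral_nonneg fun x => sq_nonneg _)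
          (hd2.congr fun n => integral_volQ ((y n).memLp_grad.sub hd1).integrable_sq)
        filter_upwards [hae, ae_all_iff.2 fun n => (y n).memH1a, ae_memLp_slice hd1,
          ae_mem_Icc_of_Ioo] with t k1 k2 k3 ht
        exact MemH1a.of_tendsto ha (fun k => k2 (ns k)) (hs t ht).1 k3
          ((hs t ht).2.comp hns.tendsto_atTop) k1
      continuous_slice := fun t₀ ht₀ => by
        -- a uniform limit of continuous functions is continuous
        rw [ENNReal.tendsto_nhds_zero]
        intro ε hε
        have hε3 : (0 : ENNReal) < ε / 3 := ENNReal.div_pos hε.ne' (by simp)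
        obtain ⟨N, hN⟩ := ((ENNReal.tendsto_nhds_zero.1 hbt) _ hε3).exists
        filter_upwards [(ENNReal.tendsto_nhds_zero.1 ((y N).continuous_slice t₀ ht₀)) _ hε3,
          self_mem_nhdsWithin] with t ht htI
        have e : val t - val t₀ = ((y N).val t - (y N).val t₀)
            - (((y N).val t - val t) - ((y N).val t₀ - val t₀)) := by abel
        have m1 := ((y N).memLp_slice t htI).sub (hs t htI).1
        have m2 := ((y N).memLp_slice t₀ ht₀).sub (hs t₀ ht₀).1
        have m3 := ((y N).memLp_slice t htI).sub ((y N).memLp_slice t₀ ht₀)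
        rw [e]
        calc _ ≤ _ := eLpNorm_sub_le m3.1 (m1.sub m2).1 (by norm_num)
          _ ≤ _ := add_le_add_right (eLpNorm_sub_le m1.1 m2.1 (by norm_num)) _
          _ ≤ ε / 3 + (ε / 3 + ε / 3) := add_le_add ht (add_le_add
            ((hcontr N t htI).trans hN) ((hcontr N t₀ ht₀).trans hN))
          _ = ε := by rw [← add_assoc]; exact ENNReal.add_thirds ε }
  exact ⟨u, fun t ht => (hs t ht).2, hv2, hd2⟩

end Complete

/-! ### Linear problems -/

section Linear

variable {a : ℝ → ℝ} {T : ℝ}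

lemma integrable_sub_sq {α : Type*} [MeasurableSpace α] {ν : Measure α} {f g : α → ℝ}
    (hf : MemLp f 2 ν) (hg : MemLp g 2 ν) : Integrable (fun x => (f x - g x) ^ 2) ν :=
  (hf.sub hg).integrable_sq

/-- The solution of `c' + l c + m = 0`, `c(0) = c₀`, with its energy estimates. -/
lemma exists_duhamel (hT : 0 ≤ T) {l : ℝ} (hl : 0 < l) {m : ℝ → ℝ}
    (hm : MemLp m 2 (volume.restrict (Ioo 0 T))) (c₀ : ℝ) :
    ∃ c : ℝ → ℝ, Continuous c ∧ c 0 = c₀ ∧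
      (∀ t ∈ Icc 0 T, c t = c 0 - ∫ s in (0 : ℝ)..t, (l * c s + m s)) ∧
      (∀ t ∈ Icc 0 T, c t ^ 2 ≤ c₀ ^ 2 + (∫ s in Ioo 0 T, m s ^ 2) / l) ∧
      l * (∫ s in Ioo 0 T, c s ^ 2) ≤ c₀ ^ 2 + (∫ s in Ioo 0 T, m s ^ 2) / l := by
  set m' : ℝ → ℝ := (Ioo 0 T).indicator m
  have hmi : Integrable m (volume.restrict (Ioo 0 T)) := hm.integrable (by norm_num)
  have hm' : Integrable m' volume := (integrable_indicator_iff measurableSet_Ioo).2 hmi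
  have hexp : Continuous fun s : ℝ => Real.exp (l * s) := by fun_prop
  have hem : ∀ x y : ℝ, IntervalIntegrable (fun s => Real.exp (l * s) * m' s) volume x y :=
    fun x y => hm'.intervalIntegrable.continuousOn_mul hexp.continuousOn
  set D : ℝ → ℝ := fun t => c₀ - ∫ s in (0 : ℝ)..t, Real.exp (l * s) * m' s with hD
  have hDc : Continuous D := continuous_const.sub (intervalIntegral.continuous_primitive hem 0)
  set c : ℝ → ℝ := fun t => Real.exp (-l * t) * D t with hc
  have hcc : Continuous c := (by fun_prop : Continuous fun t : ℝ => Real.exp (-l * t)).mul hDc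
  have hθ : ContDiff ℝ 1 fun t : ℝ => Real.exp (-l * t) := by fun_prop
  have hθd : ∀ t, deriv (fun t : ℝ => Real.exp (-l * t)) t = -l * Real.exp (-l * t) := fun t => by
    have h1 : HasDerivAt (fun t : ℝ => -l * t) (-l) t := by
      simpa using (hasDerivAt_id t).const_mul (-l)
    rw [h1.exp.deriv]; ring
  have hc0 : c 0 = c₀ := by simp [hc, hD]
  have heq : ∀ t ∈ Icc 0 T, c t = c 0 - ∫ s in (0 : ℝ)..t, (l * c s + m s) := fun t ht => by
    have h1 := mul_primitive_eq_integral ht.1 (m := fun s => Real.exp (l * s) * m' s)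
      (n := fun _ => 0) (C := D) (D := fun _ => 1) hθ
      ((intervalIntegrable_iff_integrableOn_Ioo_of_le ht.1).1 (hem 0 t)) (integrable_zero _ _ _)
      (fun s _ => by simp [hD]) (fun s _ => by simp)
    rw [intervalIntegral_eq_Ioo ht.1]
    have h2 : ∫ s in Ioo 0 t, (deriv (fun t : ℝ => Real.exp (-l * t)) s * (D s * 1)
        - Real.exp (-l * s) * (1 * (Real.exp (l * s) * m' s) + D s * 0))
        = - ∫ s in Ioo 0 t, (l * c s + m s) := by
      rw [← integral_neg]
      refine setIntegral_congr_fun measurableSet_Ioo fun s hs => ?_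
      have e1 : m' s = m s := indicator_of_mem (show s ∈ Ioo 0 T from ⟨hs.1, hs.2.trans_le ht.2⟩) m
      have e2 : Real.exp (-l * s) * Real.exp (l * s) = 1 := by
        rw [← Real.exp_add]; simp
      simp only [hθd, hc, e1]
      linear_combination (-m s) * e2
    rw [h2] at h1
    have e3 : c 0 = Real.exp (-l * 0) * (D 0 * 1) := by simp [hc]
    have e4 : c t = Real.exp (-l * t) * (D t * 1) := by simp [hc]
    linarith
  have hci : ∀ t, Integrable (fun s => c s ^ 2) (volume.restrict (Ioo 0 t)) := fun t =>
    ((hcc.pow 2).integrableOn_Icc (a := 0) (b := t)).mono_set Ioo_subset_Icc_self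
  have henergy : ∀ t ∈ Icc 0 T, c t ^ 2 + l * (∫ s in Ioo 0 t, c s ^ 2)
      ≤ c₀ ^ 2 + (∫ s in Ioo 0 T, m s ^ 2) / l := fun t ht => by
    have hsub : Ioo 0 t ⊆ Ioo 0 T := Ioo_subset_Ioo_right ht.2
    have hmt := hm.mono_measure (Measure.restrict_mono hsub le_rfl)
    have hct : Integrable c (volume.restrict (Ioo 0 t)) :=
      (hcc.integrableOn_Icc (a := 0) (b := t)).mono_set Ioo_subset_Icc_self
    have hn : Integrable (fun s => l * c s + m s) (volume.restrict (Ioo 0 t)) :=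
      (hct.const_mul l).add (hmt.integrable (by norm_num))
    have hct' : ∀ s ∈ Icc 0 t, c s = c 0 - ∫ r in (0 : ℝ)..s, (l * c r + m r) :=
      fun s hs => heq s ⟨hs.1, hs.2.trans ht.2⟩
    have h1 := mul_primitive_eq_integral ht.1 (θ := fun _ => 1) contDiff_const hn hn hct' hct'
    simp only [deriv_const, zero_mul, one_mul, zero_sub] at h1
    have hmem : MemLp c 2 (volume.restrict (Ioo 0 t)) :=
      (memLp_two_iff_integrable_sq hct.1).2 (hci t)
    have i2 : Integrable (fun s => -(l * c s ^ 2) + m s ^ 2 / l) (volume.restrict (Ioo 0 t)) :=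
      (((hci t).const_mul l).neg).add (hmt.integrable_sq.div_const l)
    have i0 : Integrable (fun s => -(l * c s ^ 2)) (volume.restrict (Ioo 0 t)) :=
      ((hci t).const_mul l).neg
    have i1 : Integrable (fun s => -(c s * (l * c s + m s) + c s * (l * c s + m s)))
        (volume.restrict (Ioo 0 t)) := by
      have := integrable_mul_of_memLp_two hmem ((hmem.const_mul l).add hmt)
      exact (this.add this).neg
    have h2 := integral_mono i1 i2 fun s => by
      have : 0 ≤ (l * c s + m s) ^ 2 / l := by positivity
      have e : (l * c s + m s) ^ 2 / l = l * c s ^ 2 + 2 * (c s * m s) + m s ^ 2 / l := by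
        field_simp; ring
      simp only
      linarith
    rw [← h1, integral_add i0 (hmt.integrable_sq.div_const l),
      integral_neg, integral_const_mul, integral_div, hc0] at h2
    have h3 : (∫ s in Ioo 0 t, m s ^ 2) / l ≤ (∫ s in Ioo 0 T, m s ^ 2) / l :=
      div_le_div_of_nonneg_right (setIntegral_mono_set hm.integrable_sq
        (Eventually.of_forall fun _ => sq_nonneg _) hsub.eventuallyLE) hl.le
    nlinarith
  refine ⟨c, hcc, hc0, heq, fun t ht => ?_, ?_⟩
  · have : 0 ≤ l * ∫ s in Ioo 0 t, c s ^ 2 :=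
      mul_nonneg hl.le (integral_nonneg fun s => sq_nonneg _)
    linarith [henergy t ht]
  · linarith [henergy T (right_mem_Icc.2 hT), sq_nonneg (c T)]

variable {ha : WeaklyDegenerate a} (B : EigenBasis ha)

lemma exists_finset_sum_eigenfunctions (T : ℝ) {c : B.ι → ℝ → ℝ} (hc : ∀ i, Continuous (c i))
    (s : Finset B.ι) : ∃ u : SpaceH a T, (∀ t x, u.val t x = ∑ i ∈ s, c i t * B.e i x) ∧
      ∀ t x, u.dx t x = ∑ i ∈ s, c i t * (B.w i x * invSqrt a x) := by
  classical
  induction s using Finset.induction_on with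
  | empty =>
    exact ⟨SpaceH.tensor T (continuous_const (y := (0 : ℝ))) ha
      (MemH1a.finset_sum ha ∅ fun i => B.memH1a_e i), by simp [SpaceH.tensor], by
        simp [SpaceH.tensor]⟩
  | insert i s hi ih =>
    obtain ⟨u, h1, h2⟩ := ih
    refine ⟨u.sub ha (SpaceH.tensor T (hc i).neg ha (B.memH1a_e i)), fun t x => ?_, fun t x => ?_⟩
    · rw [Finset.sum_insert hi, ← h1]; simp only [SpaceH.sub, SpaceH.tensor, Pi.neg_apply]; ring
    · rw [Finset.sum_insert hi, ← h2]; simp only [SpaceH.sub, SpaceH.tensor, Pi.neg_apply]; ring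

open Classical in
lemma EigenBasis.integral_sum_mul_e (s : Finset B.ι) (c : B.ι → ℝ) (j : B.ι) :
    ∫ x, (∑ i ∈ s, c i * B.e i x) * B.e j x ∂volΩ = if j ∈ s then c j else 0 := by
  simp_rw [Finset.sum_mul, mul_assoc]
  rw [integral_finsetSum s fun i _ =>
    (integrable_mul_of_memLp_two (B.memLp_e i) (B.memLp_e j)).const_mul (c i)]
  simp_rw [integral_const_mul, B.integral_e_mul_e]
  simp

lemma EigenBasis.integral_sum_sq (s : Finset B.ι) (c : B.ι → ℝ) :
    ∫ x, (∑ i ∈ s, c i * B.e i x) ^ 2 ∂volΩ = ∑ i ∈ s, c i ^ 2 := by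
  classical
  have hm : MemLp (fun x => ∑ i ∈ s, c i * B.e i x) 2 volΩ :=
    memLp_finsetSum s fun i _ => (B.memLp_e i).const_mul (c i)
  have e : ∀ x, (∑ i ∈ s, c i * B.e i x) ^ 2
      = ∑ j ∈ s, c j * ((∑ i ∈ s, c i * B.e i x) * B.e j x) := fun x => by
    rw [sq]
    nth_rewrite 2 [Finset.sum_congr rfl fun i _ => rfl]
    rw [Finset.mul_sum]
    exact Finset.sum_congr rfl fun j _ => by ring
  simp_rw [e]
  rw [integral_finsetSum s fun j _ =>
    (integrable_mul_of_memLp_two hm (B.memLp_e j)).const_mul (c j)]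
  refine Finset.sum_congr rfl fun j hj => ?_
  rw [integral_const_mul, B.integral_sum_mul_e, if_pos hj, sq]

lemma EigenBasis.integral_grad_sum_sq (s : Finset B.ι) (c : B.ι → ℝ) :
    ∫ x, (√(a x) * ∑ i ∈ s, c i * (B.w i x * invSqrt a x)) ^ 2 ∂volΩ
      = ∑ i ∈ s, B.lam i * c i ^ 2 := by
  classical
  have hu : MemH1a a (fun x => ∑ i ∈ s, c i * B.e i x)
      (fun x => ∑ i ∈ s, c i * (B.w i x * invSqrt a x)) :=
    MemH1a.finset_sum ha s fun i => (B.memH1a_e i).const_mul ha (c i)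
  have e : (fun x => (√(a x) * ∑ i ∈ s, c i * (B.w i x * invSqrt a x)) ^ 2) =ᵐ[volΩ]
      fun x => ∑ j ∈ s, c j * ((√(a x) * ∑ i ∈ s, c i * (B.w i x * invSqrt a x)) * B.w j x) := by
    filter_upwards [ae_volΩ_mem] with x hx
    have : √(a x) * ∑ i ∈ s, c i * (B.w i x * invSqrt a x) = ∑ i ∈ s, c i * B.w i x := by
      rw [Finset.mul_sum]
      refine Finset.sum_congr rfl fun i _ => ?_
      linear_combination c i * B.w i x * ha.sqrt_mul_invSqrt hx
    rw [this, sq]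
    nth_rewrite 2 [Finset.sum_congr rfl fun i _ => rfl]
    rw [Finset.mul_sum]
    exact Finset.sum_congr rfl fun j _ => by ring
  rw [integral_congr_ae e, integral_finsetSum s fun j _ =>
    (integrable_mul_of_memLp_two hu.2.1 (B.memLp_w j)).const_mul (c j)]
  refine Finset.sum_congr rfl fun j hj => ?_
  rw [integral_const_mul, B.integral_grad_mul_w hu, B.integral_sum_mul_e, if_pos hj]
  ring

variable {B}

lemma memLp_dualCoef {M G : ℝ × ℝ → ℝ} (hM : MemLp M 2 (volQ T)) (hG : MemLp G 2 (volQ T))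
    (i : B.ι) : MemLp (fun s => B.dualCoef (fun x => M (s, x)) (fun x => G (s, x)) i) 2
      (volume.restrict (Ioo 0 T)) := by
  have hm := (integrable_dualCoef (B := B) hM hG i).1
  rw [memLp_two_iff_integrable_sq hm]
  refine Integrable.mono' (((integrable_slice_integral hM.integrable_sq).add
    (integrable_slice_integral hG.integrable_sq)).const_mul (B.lam i * pairingConst ha))
    (hm.pow 2) ?_
  filter_upwards [ae_memLp_slice hM, ae_memLp_slice hG] with s h1 h2
  have := B.sum_dualCoef_sq_le h1 h2 {i}
  rw [Finset.sum_singleton, div_le_iff₀ (B.lam_pos i)] at this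
  rw [Real.norm_of_nonneg (sq_nonneg _)]
  calc _ ≤ _ := this
    _ = _ := by simp only [Pi.add_apply]; ring

lemma summable_integral_dualCoef_sq {M G : ℝ × ℝ → ℝ} (hM : MemLp M 2 (volQ T))
    (hG : MemLp G 2 (volQ T)) : Summable fun i : B.ι =>
      (∫ s in Ioo 0 T, B.dualCoef (fun x => M (s, x)) (fun x => G (s, x)) i ^ 2) / B.lam i := by
  have hi := ((integrable_slice_integral hM.integrable_sq).add
    (integrable_slice_integral hG.integrable_sq)).const_mul (pairingConst ha)
  refine summable_of_sum_le (c := ∫ s in Ioo 0 T, pairingConst ha *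
    ((∫ x, M (s, x) ^ 2 ∂volΩ) + ∫ x, G (s, x) ^ 2 ∂volΩ))
    (fun i => div_nonneg (integral_nonneg fun s => sq_nonneg _) (B.lam_pos i).le) fun F => ?_
  have hd : ∀ i, Integrable (fun s => B.dualCoef (fun x => M (s, x)) (fun x => G (s, x)) i ^ 2
      / B.lam i) (volume.restrict (Ioo 0 T)) := fun i =>
    (memLp_dualCoef hM hG i).integrable_sq.div_const _
  simp_rw [← integral_div]
  rw [← integral_finsetSum F fun i _ => hd i]
  refine integral_mono_ae (integrable_finsetSum F fun i _ => hd i) hi ?_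
  filter_upwards [ae_memLp_slice hM, ae_memLp_slice hG] with s h1 h2
  exact B.sum_dualCoef_sq_le h1 h2 F

/-- The linear problem `u_t - (a u_x)_x + M/√a - (√a G)_x = 0`, `u(0) = y₀` is solvable: each
eigenfunction coefficient is given by Duhamel's formula. -/
theorem exists_linear_solution (B : EigenBasis ha) (hT : 0 ≤ T) {M G : ℝ × ℝ → ℝ}
    (hM : MemLp M 2 (volQ T)) (hG : MemLp G 2 (volQ T)) {y₀ : ℝ → ℝ} (hy₀ : MemLp y₀ 2 volΩ) :
    ∃ u : SpaceH a T, BalanceLaw B u M (fun z => u.grad z + G z) ∧ u.val 0 =ᵐ[volΩ] y₀ := by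
  classical
  have h0T : (0 : ℝ) ∈ Icc 0 T := left_mem_Icc.2 hT
  set m : B.ι → ℝ → ℝ := fun i s => B.dualCoef (fun x => M (s, x)) (fun x => G (s, x)) i
  set d : B.ι → ℝ := fun i => ∫ x, y₀ x * B.e i x ∂volΩ
  choose c hcc hc0 heq hsup hint using fun i =>
    exists_duhamel hT (B.lam_pos i) (memLp_dualCoef hM hG i) (d i)
  set β : B.ι → ℝ := fun i => d i ^ 2 + (∫ s in Ioo 0 T, m i s ^ 2) / B.lam i
  have hβ0 : ∀ i, 0 ≤ β i := fun i => add_nonneg (sq_nonneg _)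
    (div_nonneg (integral_nonneg fun s => sq_nonneg _) (B.lam_pos i).le)
  have hβ : Summable β := by
    refine Summable.add ?_ (summable_integral_dualCoef_sq hM hG)
    simpa only [sq] using (B.hasSum_parseval hy₀ hy₀).summable
  choose F hF using fun N : ℕ => summable_iff_vanishing_norm.1 hβ ((1 / 4 : ℝ) ^ N) (by positivity)
  set S : ℕ → Finset B.ι := fun N => (Finset.range (N + 1)).biUnion F
  have hSmono : ∀ N n, N ≤ n → S N ⊆ S n := fun N n h =>
    Finset.biUnion_subset_biUnion_of_subset_left F (Finset.range_mono (by omega))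
  have hFS : ∀ N, F N ⊆ S N := fun N =>
    Finset.subset_biUnion_of_mem F (Finset.mem_range.2 (Nat.lt_succ_self N))
  have htail : ∀ N (t : Finset B.ι), Disjoint t (S N) → ∑ i ∈ t, β i ≤ (1 / 4 : ℝ) ^ N :=
    fun N t ht => (le_abs_self _).trans (hF N t (ht.mono_right (hFS N))).le
  choose y hyv hyd using fun s => exists_finset_sum_eigenfunctions B T hcc s
  have hdiffv : ∀ N n, N ≤ n → ∀ t x, (y (S n)).val t x - (y (S N)).val t x
      = ∑ i ∈ S n \ S N, c i t * B.e i x := fun N n h t x => by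
    rw [hyv, hyv, ← Finset.sum_sdiff (hSmono N n h)]; ring
  have hdiffd : ∀ N n, N ≤ n → ∀ z, (y (S n)).grad z - (y (S N)).grad z
      = √(a z.2) * ∑ i ∈ S n \ S N, c i z.1 * (B.w i z.2 * invSqrt a z.2) := fun N n h z => by
    simp only [SpaceH.grad]
    rw [hyd, hyd, ← Finset.sum_sdiff (hSmono N n h)]; ring
  have k1 : ∀ N n, N ≤ n → ∀ t ∈ Icc 0 T,
      ∫ x, ((y (S n)).val t x - (y (S N)).val t x) ^ 2 ∂volΩ ≤ (1 / 4 : ℝ) ^ N :=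
    fun N n h t ht => by
      simp_rw [hdiffv N n h]
      rw [B.integral_sum_sq]
      exact (Finset.sum_le_sum fun i _ => hsup i t ht).trans (htail N _ Finset.sdiff_disjoint)
  have k2 : ∀ N n, N ≤ n →
      ∫ z, ((y (S n)).fn z - (y (S N)).fn z) ^ 2 ∂volQ T ≤ T * (1 / 4 : ℝ) ^ N := fun N n h => by
    rw [integral_volQ (integrable_sub_sq (y (S n)).memLp_fn (y (S N)).memLp_fn)]
    have e : T * (1 / 4 : ℝ) ^ N = ∫ _ in Ioo 0 T, (1 / 4 : ℝ) ^ N := by simp [hT]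
    rw [e]
    refine integral_mono_ae (integrable_slice_integral
      (integrable_sub_sq (y (S n)).memLp_fn (y (S N)).memLp_fn)) (integrable_const _) ?_
    filter_upwards [ae_mem_Icc_of_Ioo] with t ht using k1 N n h t ht
  have k3 : ∀ N n, N ≤ n →
      ∫ z, ((y (S n)).grad z - (y (S N)).grad z) ^ 2 ∂volQ T ≤ (1 / 4 : ℝ) ^ N := fun N n h => by
    rw [integral_volQ (integrable_sub_sq (y (S n)).memLp_grad (y (S N)).memLp_grad)]
    have hci : ∀ i, Integrable (fun t => B.lam i * c i t ^ 2) (volume.restrict (Ioo 0 T)) :=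
      fun i => ((((hcc i).pow 2).integrableOn_Icc (a := 0) (b := T)).mono_set
        Ioo_subset_Icc_self).const_mul _
    simp only [hdiffd N n h, B.integral_grad_sum_sq]
    rw [integral_finsetSum _ fun i _ => hci i]
    simp_rw [integral_const_mul]
    exact (Finset.sum_le_sum fun i _ => hint i).trans (htail N _ Finset.sdiff_disjoint)
  have hpow : ∀ N : ℕ, (0 : ℝ) ≤ (1 / 4 : ℝ) ^ N := fun N => by positivity
  have hrate : ∀ N : ℕ, (√(1 + T) * (1 / 2 : ℝ) ^ N) ^ 2 = (1 / 4 : ℝ) ^ N + T * (1 / 4) ^ N :=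
    fun N => by
      rw [mul_pow, Real.sq_sqrt (by linarith), ← pow_mul, mul_comm N, pow_mul]
      norm_num; ring
  obtain ⟨u, hu, -, -⟩ := SpaceH.exists_limit ha (fun N => y (S N))
    (b := fun N => √(1 + T) * (1 / 2 : ℝ) ^ N) (fun n => by positivity)
    (summable_geometric_two.mul_left _)
    (fun N n h t ht => (k1 N n h t ht).trans (by
      rw [hrate]; nlinarith [mul_nonneg hT (hpow N)]))
    (fun N n h => (k2 N n h).trans (by rw [hrate]; linarith [hpow N]))
    (fun N n h => (k3 N n h).trans (by rw [hrate]; nlinarith [mul_nonneg hT (hpow N)]))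
  have hcoef : ∀ i, ∀ t ∈ Icc 0 T, u.coef B i t = c i t := fun i t ht => by
    have h1 := tendsto_integral_mul (fun n => (y (S n)).memLp_slice t ht) (u.memLp_slice t ht)
      (B.memLp_e i) (hu t ht)
    refine tendsto_nhds_unique h1 ?_
    rw [tendsto_iff_dist_tendsto_zero]
    have h2 : Tendsto (fun n : ℕ => (1 / 2 : ℝ) ^ n) atTop (𝓝 0) :=
      tendsto_pow_atTop_nhds_zero_of_lt_one (by norm_num) (by norm_num)
    refine squeeze_zero (fun _ => dist_nonneg) (fun n => ?_) h2
    simp_rw [hyv, B.integral_sum_mul_e]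
    split_ifs with hi
    · rw [dist_self]; positivity
    · have h3 := htail n {i} (Finset.disjoint_singleton_left.2 hi)
      rw [Finset.sum_singleton] at h3
      have h4 := (hsup i t ht).trans h3
      rw [Real.dist_eq, zero_sub, abs_neg]
      refine abs_le_of_sq_le_sq (h4.trans (le_of_eq ?_)) (by positivity)
      rw [← pow_mul, mul_comm n, pow_mul]; norm_num
  refine ⟨u, fun i t ht => ?_, ?_⟩
  · rw [hcoef i t ht, hcoef i 0 h0T, heq i t ht]
    congr 1
    rw [intervalIntegral_eq_Ioo ht.1, intervalIntegral_eq_Ioo ht.1]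
    refine integral_congr_ae
      (ae_restrict_of_ae_restrict_of_subset (Ioo_subset_Ioo_right ht.2) ?_)
    filter_upwards [u.memH1a, ae_memLp_slice hM, ae_memLp_slice hG, ae_mem_Icc_of_Ioo]
      with s h1 h2 h3 hs
    have i1 : Integrable (fun x => M (s, x) * (B.e i x * invSqrt a x) + G (s, x) * B.w i x) volΩ :=
      (integrable_mul_of_memLp_two h2 (B.memLp_e_mul i)).add
        (integrable_mul_of_memLp_two h3 (B.memLp_w i))
    have i2 := integrable_mul_of_memLp_two h1.2.1 (B.memLp_w i)
    have e1 := B.integral_grad_mul_w h1 i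
    have e2 : ∫ x, u.val s x * B.e i x ∂volΩ = c i s := hcoef i s hs
    rw [e2] at e1
    rw [← e1, EigenBasis.dualCoef, EigenBasis.dualCoef, ← integral_add i2 i1]
    congr 1
    ext x
    simp only [SpaceH.grad]; ring
  · refine ae_eq_of_coef_eq (B := B) (u.memLp_slice 0 h0T) hy₀ fun i => ?_
    exact (hcoef i 0 h0T).trans (hc0 i)

end Linear

/-! ### Energy estimates and the semilinear problem -/

section Semilinear

variable {a : ℝ → ℝ} {T : ℝ} {ha : WeaklyDegenerate a} {B : EigenBasis ha}

lemma SpaceH.aestronglyMeasurable_dx (ha : WeaklyDegenerate a) (u : SpaceH a T) :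
    AEStronglyMeasurable (fun z => u.dx z.1 z.2) (volQ T) := by
  refine (u.memLp_grad.1.mul (aestronglyMeasurable_of_snd ha.memLp_invSqrt.1)).congr ?_
  filter_upwards [ae_volQ_mem] with z hz
  simp only [Pi.mul_apply, SpaceH.grad]
  linear_combination u.dx z.1 z.2 * ha.sqrt_mul_invSqrt hz.2

/-- The weighted energy `∫ e^{-2ρt} (ρ u² + a u_x²)` of `u ∈ ℍ`. -/
def SpaceH.energy (ρ : ℝ) (u : SpaceH a T) : ℝ :=
  ∫ z, Real.exp (-2 * ρ * z.1) * (ρ * u.fn z ^ 2 + u.grad z ^ 2) ∂volQ T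

lemma contDiff_weight (ρ : ℝ) : ContDiff ℝ 1 fun t : ℝ => Real.exp (-2 * ρ * t) := by fun_prop

lemma deriv_weight (ρ t : ℝ) :
    deriv (fun t : ℝ => Real.exp (-2 * ρ * t)) t = -2 * ρ * Real.exp (-2 * ρ * t) := by
  have h1 : HasDerivAt (fun t : ℝ => -2 * ρ * t) (-2 * ρ) t := by
    simpa using (hasDerivAt_id t).const_mul (-2 * ρ)
  rw [h1.exp.deriv]; ring

lemma SpaceH.integrable_energy (ρ : ℝ) (u : SpaceH a T) : Integrable
    (fun z => Real.exp (-2 * ρ * z.1) * (ρ * u.fn z ^ 2 + u.grad z ^ 2)) (volQ T) :=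
  integrable_bounded_time_mul (contDiff_weight ρ).continuous
    ((u.memLp_fn.integrable_sq.const_mul ρ).add u.memLp_grad.integrable_sq)

lemma memLp_sqrt_mul_of_le (ha : WeaklyDegenerate a) {K : ℝ} (o : SpaceH a T) {k : ℝ × ℝ → ℝ}
    (hk : AEStronglyMeasurable k (volQ T))
    (hkK : ∀ᵐ z ∂volQ T, |k z| ≤ K * (|o.val z.1 z.2| + |o.dx z.1 z.2|)) :
    MemLp (fun z => √(a z.2) * k z) 2 (volQ T) := by
  have h1 : MemLp (fun z => |√(a z.2) * o.fn z| + |o.grad z|) 2 (volQ T) :=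
    (memLp_sqrt_snd_mul ha o.memLp_fn).abs.add o.memLp_grad.abs
  refine memLp_two_of_abs_le h1
    ((aestronglyMeasurable_of_snd ha.aestronglyMeasurable_sqrt).mul hk) K ?_
  filter_upwards [hkK] with z hz
  rw [abs_of_nonneg (add_nonneg (abs_nonneg (√(a z.2) * o.fn z)) (abs_nonneg _)), abs_mul,
    SpaceH.grad, abs_mul, abs_mul, abs_of_nonneg (Real.sqrt_nonneg _), SpaceH.fn]
  calc _ ≤ _ := mul_le_mul_of_nonneg_left hz (Real.sqrt_nonneg _)
    _ = _ := by ring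

lemma memLp_bounded_mul {b f : ℝ × ℝ → ℝ} {K : ℝ} (hb : AEStronglyMeasurable b (volQ T))
    (hbK : ∀ᵐ z ∂volQ T, |b z| ≤ K) (hf : MemLp f 2 (volQ T)) :
    MemLp (fun z => b z * f z) 2 (volQ T) := by
  refine memLp_two_of_abs_le hf (hb.mul hf.1) K ?_
  filter_upwards [hbK] with z hz
  rw [abs_mul]
  exact mul_le_mul_of_nonneg_right hz (abs_nonneg _)

/-- Young's inequality for the terms of the energy balance at one point. -/
lemma energy_density_le {K ρ k f b o wo ho d wd hd : ℝ} (hK : 0 ≤ K)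
    (hk : |k| * |d| ≤ K * (|o| * |d| + |wo| * |hd|)) (hb : |b| ≤ K) :
    -2 * ρ * d ^ 2 - (((k - f) * d + (wd + b * ho) * wd) + ((k - f) * d + (wd + b * ho) * wd))
      ≤ (-2 * ρ + K + 1) * d ^ 2 + (-3 / 2) * wd ^ 2 + 1 / 8 * wo ^ 2
        + 8 * K ^ 2 * hd ^ 2 + K * o ^ 2 + f ^ 2 + 2 * K ^ 2 * ho ^ 2 := by
  have q1 : -(k * d) ≤ K * (|o| * |d| + |wo| * |hd|) :=
    (neg_le_abs _).trans ((abs_mul k d).trans_le hk)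
  have q2 : -(b * ho * wd) ≤ K * (|ho| * |wd|) := by
    calc -(b * ho * wd) ≤ |b * ho * wd| := neg_le_abs _
      _ = |b| * (|ho| * |wd|) := by rw [abs_mul, abs_mul, mul_assoc]
      _ ≤ _ := mul_le_mul_of_nonneg_right hb (by positivity)
  have r1 : 2 * (|o| * |d|) ≤ o ^ 2 + d ^ 2 := by
    rw [← sq_abs o, ← sq_abs d]
    linarith [two_mul_le_add_sq |o| |d|]
  have r2 : 2 * (K * (|wo| * |hd|)) ≤ 1 / 8 * wo ^ 2 + 8 * K ^ 2 * hd ^ 2 := by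
    rw [← sq_abs wo, ← sq_abs hd]
    nlinarith [sq_nonneg (|wo| - 8 * (K * |hd|))]
  have r3 : 2 * (K * (|ho| * |wd|)) ≤ 1 / 2 * wd ^ 2 + 2 * K ^ 2 * ho ^ 2 := by
    rw [← sq_abs wd, ← sq_abs ho]
    nlinarith [sq_nonneg (|wd| - 2 * (K * |ho|))]
  have r4 : 2 * (f * d) ≤ f ^ 2 + d ^ 2 := by linarith [two_mul_le_add_sq f d]
  have r5 := mul_le_mul_of_nonneg_left r1 hK
  linarith

/-- The energy estimate. If `d` solves `d_t - (a d_x)_x + k - (b o)_x = f`, `d(0) = 0`, where the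
lower order terms `k`, `b o` are controlled by `o` and `o_x`, then the energy of `d` is at most a
quarter of the energy of `o`, up to the contribution of `f`. The terms `o_x d` and `o d_x` are
absorbed with the Hardy inequality with small constants, and `ρ` is large enough to absorb the
rest. -/
theorem exists_energy_estimate (B : EigenBasis ha) {K : ℝ} (hK : 0 ≤ K) :
    ∃ ρ : ℝ, 1 ≤ ρ ∧ ∀ (T : ℝ) (d o : SpaceH a T) (k f b : ℝ × ℝ → ℝ), 0 ≤ T →
      AEStronglyMeasurable k (volQ T) →
      (∀ᵐ z ∂volQ T, |k z| ≤ K * (|o.val z.1 z.2| + |o.dx z.1 z.2|)) →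
      MemLp f 2 (volQ T) → AEStronglyMeasurable b (volQ T) → (∀ᵐ z ∂volQ T, |b z| ≤ K) →
      BalanceLaw B d (fun z => √(a z.2) * (k z - f z)) (fun z => d.grad z + b z * o.hardy z) →
      d.val 0 =ᵐ[volΩ] 0 →
      Real.exp (-2 * ρ * T) * (∫ x, d.val T x ^ 2 ∂volΩ) + d.energy ρ
        ≤ o.energy ρ / 4 + ∫ z, Real.exp (-2 * ρ * z.1) * f z ^ 2 ∂volQ T := by
  have hK2 : (0 : ℝ) < 1 / (8 * K ^ 2 + 1) / 8 := by positivity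
  obtain ⟨C, hC0, hC⟩ := SpaceH.integral_hardy_le ha hK2
  set ρ : ℝ := 4 * (K + 8 * K ^ 2 * C + 1)
  have hKC : 0 ≤ 8 * K ^ 2 * C := by positivity
  refine ⟨ρ, by simp only [ρ]; linarith, fun T d o k f b hT hk hkK hf hb hbK hd hd0 => ?_⟩
  set θ : ℝ → ℝ := fun t => Real.exp (-2 * ρ * t) with hθ
  have hθ0 : ∀ t, 0 ≤ θ t := fun t => (Real.exp_pos _).le
  have hθc : Continuous θ := (contDiff_weight ρ).continuous
  have hM : MemLp (fun z => √(a z.2) * (k z - f z)) 2 (volQ T) := by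
    simpa only [mul_sub, Pi.sub_def] using
      (memLp_sqrt_mul_of_le ha o hk hkK).sub (memLp_sqrt_snd_mul ha hf)
  have hG : MemLp (fun z => d.grad z + b z * o.hardy z) 2 (volQ T) :=
    d.memLp_grad.add (memLp_bounded_mul hb hbK (o.memLp_hardy ha))
  have key := BalanceLaw.duality hT hd hd hM hG hM hG (contDiff_weight ρ)
  simp only [deriv_weight] at key
  have e0 : ∫ x, d.val 0 x * d.val 0 x ∂volΩ = 0 := by
    refine (integral_congr_ae ?_).trans (integral_zero _ _)
    filter_upwards [hd0] with x hx
    simp [hx]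
  rw [e0, mul_zero, sub_zero] at key
  simp_rw [← sq] at key
  have I : ∀ {g : ℝ × ℝ → ℝ}, MemLp g 2 (volQ T) →
      Integrable (fun z => θ z.1 * g z ^ 2) (volQ T) := fun {g} hg =>
    integrable_bounded_time_mul hθc hg.integrable_sq
  set Ho := ∫ z, θ z.1 * o.hardy z ^ 2 ∂volQ T
  set Hd := ∫ z, θ z.1 * d.hardy z ^ 2 ∂volQ T
  set Wo := ∫ z, θ z.1 * o.grad z ^ 2 ∂volQ T
  set Wd := ∫ z, θ z.1 * d.grad z ^ 2 ∂volQ T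
  set Uo := ∫ z, θ z.1 * o.fn z ^ 2 ∂volQ T
  set Ud := ∫ z, θ z.1 * d.fn z ^ 2 ∂volQ T
  set Fs := ∫ z, θ z.1 * f z ^ 2 ∂volQ T
  have hen : ∀ u : SpaceH a T, u.energy ρ = ρ * (∫ z, θ z.1 * u.fn z ^ 2 ∂volQ T)
      + ∫ z, θ z.1 * u.grad z ^ 2 ∂volQ T := fun u => by
    rw [SpaceH.energy, ← integral_const_mul,
      ← integral_add ((I u.memLp_fn).const_mul ρ) (I u.memLp_grad)]
    congr 1
    ext z; simp only [hθ]; ring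
  have hHo : Ho ≤ 1 / (8 * K ^ 2 + 1) / 8 * Wo + C * Uo := hC T o θ hθc hθ0
  have hHd : Hd ≤ 1 / (8 * K ^ 2 + 1) / 8 * Wd + C * Ud := hC T d θ hθc hθ0
  have hnn : ∀ g : ℝ × ℝ → ℝ, 0 ≤ ∫ z, θ z.1 * g z ^ 2 ∂volQ T := fun g =>
    integral_nonneg fun z => mul_nonneg (hθ0 _) (sq_nonneg _)
  have hmain : θ T * (∫ x, d.val T x ^ 2 ∂volΩ) ≤ -2 * ρ * Ud - 2 * Wd
      + (1 / 8 * Wo + 8 * K ^ 2 * Hd) + (K * Uo + K * Ud) + (Fs + Ud) + (1 / 2 * Wd + 2 * K ^ 2 * Ho)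
      := by
    rw [key]
    have hrhs : -2 * ρ * Ud - 2 * Wd
        + (1 / 8 * Wo + 8 * K ^ 2 * Hd) + (K * Uo + K * Ud) + (Fs + Ud)
        + (1 / 2 * Wd + 2 * K ^ 2 * Ho) = ∫ z, ((-2 * ρ + K + 1) * (θ z.1 * d.fn z ^ 2)
          + (-3 / 2) * (θ z.1 * d.grad z ^ 2) + 1 / 8 * (θ z.1 * o.grad z ^ 2)
          + 8 * K ^ 2 * (θ z.1 * d.hardy z ^ 2) + K * (θ z.1 * o.fn z ^ 2)
          + 1 * (θ z.1 * f z ^ 2) + 2 * K ^ 2 * (θ z.1 * o.hardy z ^ 2)) ∂volQ T := by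
      have j1 := (I d.memLp_fn).const_mul (-2 * ρ + K + 1)
      have j2 := (I d.memLp_grad).const_mul (-3 / 2)
      have j3 := (I o.memLp_grad).const_mul (1 / 8)
      have j4 := (I (d.memLp_hardy ha)).const_mul (8 * K ^ 2)
      have j5 := (I o.memLp_fn).const_mul K
      have j6 := (I hf).const_mul 1
      have j7 := (I (o.memLp_hardy ha)).const_mul (2 * K ^ 2)
      rw [integral_add (((((j1.fun_add j2).fun_add j3).fun_add j4).fun_add j5).fun_add j6) j7,
        integral_add ((((j1.fun_add j2).fun_add j3).fun_add j4).fun_add j5) j6,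
        integral_add (((j1.fun_add j2).fun_add j3).fun_add j4) j5,
        integral_add ((j1.fun_add j2).fun_add j3) j4,
        integral_add (j1.fun_add j2) j3, integral_add j1 j2]
      simp_rw [integral_const_mul]
      ring
    rw [hrhs]
    refine integral_mono_ae ?_ ?_ ?_
    · have h1 : Integrable (fun z => -2 * ρ * θ z.1 * d.fn z ^ 2) (volQ T) := by
        simpa only [mul_assoc] using (I d.memLp_fn).const_mul (-2 * ρ)
      have h2 : Integrable (fun z => √(a z.2) * (k z - f z) * d.hardy z
          + (d.grad z + b z * o.hardy z) * d.grad z) (volQ T) :=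
        (integrable_mul_of_memLp_two hM (d.memLp_hardy ha)).add
          (integrable_mul_of_memLp_two hG d.memLp_grad)
      exact h1.sub (integrable_bounded_time_mul hθc (h2.add h2))
    · have j1 := (I d.memLp_fn).const_mul (-2 * ρ + K + 1)
      have j2 := (I d.memLp_grad).const_mul (-3 / 2)
      have j3 := (I o.memLp_grad).const_mul (1 / 8)
      have j4 := (I (d.memLp_hardy ha)).const_mul (8 * K ^ 2)
      have j5 := (I o.memLp_fn).const_mul K
      have j6 := (I hf).const_mul 1
      have j7 := (I (o.memLp_hardy ha)).const_mul (2 * K ^ 2)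
      exact ((((((j1.fun_add j2).fun_add j3).fun_add j4).fun_add j5).fun_add j6).fun_add j7)
    · filter_upwards [hkK, hbK, d.sqrt_mul_hardy ha, ae_volQ_mem] with z h1 h2 h3 hz
      have hsr := ha.sqrt_mul_invSqrt hz.2
      have hr0 : 0 ≤ invSqrt a z.2 := inv_nonneg.2 (Real.sqrt_nonneg _)
      have hs0 : 0 ≤ √(a z.2) := Real.sqrt_nonneg _
      have p1 : |o.dx z.1 z.2| * |d.fn z| = |o.grad z| * |d.hardy z| := by
        rw [SpaceH.grad, SpaceH.hardy, abs_mul, abs_mul, abs_of_nonneg hr0, abs_of_nonneg hs0]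
        change _ = √(a z.2) * |o.dx z.1 z.2| * (|d.fn z| * invSqrt a z.2)
        linear_combination (-(|o.dx z.1 z.2| * |d.fn z|)) * hsr
      have q1 : |k z| * |d.fn z| ≤ K * (|o.fn z| * |d.fn z| + |o.grad z| * |d.hardy z|) := by
        calc |k z| * |d.fn z| ≤ K * (|o.val z.1 z.2| + |o.dx z.1 z.2|) * |d.fn z| :=
            mul_le_mul_of_nonneg_right h1 (abs_nonneg _)
          _ = _ := by rw [← p1, SpaceH.fn, SpaceH.fn]; ring
      have hprod : √(a z.2) * (k z - f z) * d.hardy z = (k z - f z) * d.fn z := by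
        rw [← h3]; ring
      have hfin : -2 * ρ * d.fn z ^ 2 - ((√(a z.2) * (k z - f z) * d.hardy z
            + (d.grad z + b z * o.hardy z) * d.grad z)
          + (√(a z.2) * (k z - f z) * d.hardy z + (d.grad z + b z * o.hardy z) * d.grad z))
          ≤ (-2 * ρ + K + 1) * d.fn z ^ 2 + (-3 / 2) * d.grad z ^ 2 + 1 / 8 * o.grad z ^ 2
            + 8 * K ^ 2 * d.hardy z ^ 2 + K * o.fn z ^ 2 + f z ^ 2
            + 2 * K ^ 2 * o.hardy z ^ 2 := by
        rw [hprod]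
        exact energy_density_le hK q1 h2
      have := mul_le_mul_of_nonneg_left hfin (hθ0 z.1)
      refine le_of_eq_of_le ?_ (this.trans_eq ?_) <;> simp only [hθ] <;> ring
  have hK1 : 8 * K ^ 2 * (1 / (8 * K ^ 2 + 1) / 8) ≤ 1 / 8 := by
    have : 8 * K ^ 2 * (1 / (8 * K ^ 2 + 1)) ≤ 1 := by
      rw [mul_one_div, div_le_one (by positivity)]; linarith
    linarith
  have t1 : 8 * K ^ 2 * Hd ≤ 1 / 8 * Wd + 8 * K ^ 2 * C * Ud := by
    have := mul_le_mul_of_nonneg_left hHd (by positivity : 0 ≤ 8 * K ^ 2)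
    have h2 := mul_le_mul_of_nonneg_right hK1 (hnn d.grad)
    nlinarith
  have t2 : 2 * K ^ 2 * Ho ≤ 1 / 32 * Wo + 8 * K ^ 2 * C / 4 * Uo := by
    have := mul_le_mul_of_nonneg_left hHo (by positivity : 0 ≤ 8 * K ^ 2)
    have h2 := mul_le_mul_of_nonneg_right hK1 (hnn o.grad)
    nlinarith
  rw [hen d, hen o]
  change θ T * _ + (ρ * Ud + Wd) ≤ (ρ * Uo + Wo) / 4 + Fs
  have s1 : (K + 1 + 8 * K ^ 2 * C) * Ud ≤ ρ * Ud :=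
    mul_le_mul_of_nonneg_right (by simp only [ρ]; linarith) (hnn _)
  have s2 : (K + 8 * K ^ 2 * C / 4) * Uo ≤ ρ / 4 * Uo :=
    mul_le_mul_of_nonneg_right (by simp only [ρ]; linarith) (hnn _)
  have s3 : 0 ≤ Wo := hnn _
  have s4 : 0 ≤ Wd := hnn _
  linarith

end Semilinear

section WellPosed

variable {a : ℝ → ℝ} {T K : ℝ} {ha : WeaklyDegenerate a} {B : EigenBasis ha}
  {Φ : ℝ × ℝ → ℝ → ℝ → ℝ} {b f f' : ℝ × ℝ → ℝ}

/-- The conditions on the lower order terms of the equation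
`u_t - (a u_x)_x + Φ(t, x, u, u_x) - (b u)_x = f`: the coefficient `b` is bounded, and `Φ` is
Lipschitz in its last two arguments and vanishes if they do. -/
structure LowerOrderTerms (T K : ℝ) (Φ : ℝ × ℝ → ℝ → ℝ → ℝ) (b : ℝ × ℝ → ℝ) : Prop where
  nonneg : 0 ≤ K
  zero : ∀ z, Φ z 0 0 = 0
  lipschitz : ∀ᵐ z ∂volQ T, ∀ s p s' p', |Φ z s p - Φ z s' p'| ≤ K * (|s - s'| + |p - p'|)
  measurable : ∀ s p : ℝ × ℝ → ℝ, AEStronglyMeasurable s (volQ T) →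
    AEStronglyMeasurable p (volQ T) → AEStronglyMeasurable (fun z => Φ z (s z) (p z)) (volQ T)
  measurable_coef : AEStronglyMeasurable b (volQ T)
  bounded : ∀ᵐ z ∂volQ T, |b z| ≤ K

/-- The function `√a (Φ(·, u, u_x) - f)`. -/
def reaction (Φ : ℝ × ℝ → ℝ → ℝ → ℝ) (f : ℝ × ℝ → ℝ) (u : SpaceH a T) (z : ℝ × ℝ) : ℝ :=
  √(a z.2) * (Φ z (u.val z.1 z.2) (u.dx z.1 z.2) - f z)

/-- The equation `u_t - (a u_x)_x + Φ(t, x, u, u_x) - (b u)_x = f`. -/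
def Solves (B : EigenBasis ha) (Φ : ℝ × ℝ → ℝ → ℝ → ℝ) (b f : ℝ × ℝ → ℝ) (u : SpaceH a T) : Prop :=
  BalanceLaw B u (reaction Φ f u) (fun z => u.grad z + b z * u.hardy z)

lemma ae_volQ_of_le {S : ℝ} (hS : S ≤ T) {p : ℝ × ℝ → Prop} (hp : ∀ᵐ z ∂volQ T, p z) :
    ∀ᵐ z ∂volQ S, p z :=
  ae_restrict_of_ae_restrict_of_subset (prod_mono (Ioo_subset_Ioo_right hS) Subset.rfl) hp

lemma volQ_mono {S : ℝ} (hS : S ≤ T) : volQ S ≤ volQ T :=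
  Measure.restrict_mono (prod_mono (Ioo_subset_Ioo_right hS) Subset.rfl) le_rfl

namespace LowerOrderTerms

lemma aestronglyMeasurable_term (h : LowerOrderTerms T K Φ b) (ha : WeaklyDegenerate a)
    (u : SpaceH a T) :
    AEStronglyMeasurable (fun z => Φ z (u.val z.1 z.2) (u.dx z.1 z.2)) (volQ T) :=
  h.measurable _ _ u.memLp_val.1 (u.aestronglyMeasurable_dx ha)

lemma memLp_reaction (h : LowerOrderTerms T K Φ b) (ha : WeaklyDegenerate a)
    (hf : MemLp f 2 (volQ T)) (u : SpaceH a T) : MemLp (reaction Φ f u) 2 (volQ T) := by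
  have h1 := memLp_sqrt_mul_of_le ha (K := K) u (h.aestronglyMeasurable_term ha u) (by
    filter_upwards [h.lipschitz] with z hz
    simpa [h.zero] using hz (u.val z.1 z.2) (u.dx z.1 z.2) 0 0)
  have h2 := h1.sub (memLp_sqrt_snd_mul ha hf)
  simp only [Pi.sub_def, ← mul_sub] at h2
  exact h2

lemma memLp_coef_mul_hardy (h : LowerOrderTerms T K Φ b) (ha : WeaklyDegenerate a)
    (u : SpaceH a T) : MemLp (fun z => b z * u.hardy z) 2 (volQ T) :=
  memLp_bounded_mul h.measurable_coef h.bounded (u.memLp_hardy ha)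

lemma memLp_flux (h : LowerOrderTerms T K Φ b) (ha : WeaklyDegenerate a) (u v : SpaceH a T) :
    MemLp (fun z => u.grad z + b z * v.hardy z) 2 (volQ T) :=
  u.memLp_grad.add (h.memLp_coef_mul_hardy ha v)

end LowerOrderTerms

lemma SpaceH.energy_restrict_le {ρ : ℝ} (hρ : 0 ≤ ρ) {S : ℝ} (hS : S ≤ T) (u : SpaceH a T) :
    (u.restrict hS).energy ρ ≤ u.energy ρ :=
  integral_mono_measure (volQ_mono hS) (Eventually.of_forall fun z => by positivity)
    (u.integrable_energy ρ)

/-- The map that freezes the lower order terms at `o` is a contraction in the energy norm. -/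
theorem exists_contraction (B : EigenBasis ha) (hK : 0 ≤ K) :
    ∃ ρ : ℝ, 1 ≤ ρ ∧ ∀ (T : ℝ) (Φ : ℝ × ℝ → ℝ → ℝ → ℝ) (b f f' : ℝ × ℝ → ℝ)
      (u v o o' : SpaceH a T), LowerOrderTerms T K Φ b →
      MemLp f 2 (volQ T) → MemLp f' 2 (volQ T) →
      BalanceLaw B u (reaction Φ f o) (fun z => u.grad z + b z * o.hardy z) →
      BalanceLaw B v (reaction Φ f' o') (fun z => v.grad z + b z * o'.hardy z) →
      u.val 0 =ᵐ[volΩ] v.val 0 → ∀ (S : ℝ) (hS : S ∈ Icc 0 T),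
        Real.exp (-2 * ρ * S) * (∫ x, (u.val S x - v.val S x) ^ 2 ∂volΩ)
            + ((u.sub ha v).restrict (S := S) hS.2).energy ρ
          ≤ (o.sub ha o').energy ρ / 4
            + ∫ z, Real.exp (-2 * ρ * z.1) * (f z - f' z) ^ 2 ∂volQ T := by
  obtain ⟨ρ, hρ, key⟩ := exists_energy_estimate B hK
  refine ⟨ρ, hρ, fun T Φ b f f' u v o o' h hf hf' hu hv h0 S hS => ?_⟩
  have hd := (hu.sub hv (h.memLp_reaction ha hf o) (h.memLp_flux ha u o)
    (h.memLp_reaction ha hf' o') (h.memLp_flux ha v o')).restrict hS.2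
  have hkm := (h.aestronglyMeasurable_term ha o).sub (h.aestronglyMeasurable_term ha o')
  have hle := volQ_mono hS.2
  have k1 := key S ((u.sub ha v).restrict hS.2) ((o.sub ha o').restrict hS.2)
    (fun z => Φ z (o.val z.1 z.2) (o.dx z.1 z.2) - Φ z (o'.val z.1 z.2) (o'.dx z.1 z.2))
    (fun z => f z - f' z) b hS.1 (hkm.mono_measure hle)
    (ae_volQ_of_le hS.2 (by
      filter_upwards [h.lipschitz] with z hz using hz _ _ _ _))
    ((hf.sub hf').mono_measure hle) (h.measurable_coef.mono_measure hle)
    (ae_volQ_of_le hS.2 h.bounded)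
    (hd.congr (Eventually.of_forall fun z => by simp only [reaction]; ring)
      (Eventually.of_forall fun z => by
        change _ = (u.sub ha v).grad z + b z * (o.sub ha o').hardy z
        simp only [SpaceH.grad_sub, SpaceH.hardy_sub]; ring))
    (by
      filter_upwards [h0] with x hx
      change u.val 0 x - v.val 0 x = 0
      rw [hx, sub_self])
  refine k1.trans (add_le_add ?_ ?_)
  · have := (o.sub ha o').energy_restrict_le (zero_le_one.trans hρ) hS.2
    linarith
  · exact integral_mono_measure hle (Eventually.of_forall fun z => by positivity)
      (integrable_bounded_time_mul (contDiff_weight ρ).continuous (hf.sub hf').integrable_sq)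

lemma SpaceH.integral_sq_add_le_energy {ρ : ℝ} (hρ : 1 ≤ ρ) (u : SpaceH a T) :
    (∫ z, u.fn z ^ 2 ∂volQ T) + (∫ z, u.grad z ^ 2 ∂volQ T)
      ≤ Real.exp (2 * ρ * T) * u.energy ρ := by
  rw [← integral_add u.memLp_fn.integrable_sq u.memLp_grad.integrable_sq, SpaceH.energy,
    ← integral_const_mul]
  refine integral_mono_ae (u.memLp_fn.integrable_sq.add u.memLp_grad.integrable_sq)
    ((u.integrable_energy ρ).const_mul _) ?_
  filter_upwards [ae_volQ_mem] with z hz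
  rw [← mul_assoc, ← Real.exp_add]
  have h1 : 1 ≤ Real.exp (2 * ρ * T + -2 * ρ * z.1) :=
    Real.one_le_exp (by nlinarith [hz.1.2])
  have h2 : u.fn z ^ 2 ≤ ρ * u.fn z ^ 2 := le_mul_of_one_le_left (sq_nonneg _) hρ
  calc u.fn z ^ 2 + u.grad z ^ 2 ≤ ρ * u.fn z ^ 2 + u.grad z ^ 2 := by linarith
    _ ≤ _ := le_mul_of_one_le_left (by positivity) h1

lemma SpaceH.energy_le {ρ : ℝ} (hρ : 0 ≤ ρ) (u : SpaceH a T) :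
    u.energy ρ ≤ ρ * (∫ z, u.fn z ^ 2 ∂volQ T) + ∫ z, u.grad z ^ 2 ∂volQ T := by
  rw [← integral_const_mul, ← integral_add (u.memLp_fn.integrable_sq.const_mul ρ)
    u.memLp_grad.integrable_sq, SpaceH.energy]
  refine integral_mono_ae (u.integrable_energy ρ)
    ((u.memLp_fn.integrable_sq.const_mul ρ).add u.memLp_grad.integrable_sq) ?_
  filter_upwards [ae_volQ_mem] with z hz
  refine mul_le_of_le_one_left (by positivity) (Real.exp_le_one_iff.2 ?_)
  nlinarith [mul_nonneg hρ hz.1.1.le]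

lemma SpaceH.energy_nonneg {ρ : ℝ} (hρ : 0 ≤ ρ) (u : SpaceH a T) : 0 ≤ u.energy ρ :=
  integral_nonneg fun z => by positivity

/-- Solutions depend continuously on the right-hand side. -/
theorem exists_stability_const (B : EigenBasis ha) (hT : 0 ≤ T) (h : LowerOrderTerms T K Φ b) :
    ∃ C : ℝ, 0 ≤ C ∧ ∀ (f f' : ℝ × ℝ → ℝ) (u v : SpaceH a T), MemLp f 2 (volQ T) →
      MemLp f' 2 (volQ T) → Solves B Φ b f u → Solves B Φ b f' v → u.val 0 =ᵐ[volΩ] v.val 0 →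
      (∫ z, (u.fn z - v.fn z) ^ 2 ∂volQ T) + (∫ z, (u.grad z - v.grad z) ^ 2 ∂volQ T)
        ≤ C * ∫ z, (f z - f' z) ^ 2 ∂volQ T := by
  obtain ⟨ρ, hρ, key⟩ := exists_contraction B h.nonneg
  have hρ0 : 0 ≤ ρ := zero_le_one.trans hρ
  refine ⟨Real.exp (2 * ρ * T) * 2, by positivity, fun f f' u v hf hf' hu hv h0 => ?_⟩
  have k1 := key T Φ b f f' u v u v h hf hf' hu hv h0 T (right_mem_Icc.2 hT)
  have k2 : ((u.sub ha v).restrict (S := T) le_rfl).energy ρ = (u.sub ha v).energy ρ := rfl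
  have k3 : 0 ≤ Real.exp (-2 * ρ * T) * (∫ x, (u.val T x - v.val T x) ^ 2 ∂volΩ) :=
    mul_nonneg (Real.exp_pos _).le (integral_nonneg fun x => sq_nonneg _)
  have k4 := (u.sub ha v).integral_sq_add_le_energy hρ
  have k5 : ∫ z, Real.exp (-2 * ρ * z.1) * (f z - f' z) ^ 2 ∂volQ T
      ≤ ∫ z, (f z - f' z) ^ 2 ∂volQ T := by
    refine integral_mono_ae (integrable_bounded_time_mul (contDiff_weight ρ).continuous
      (hf.sub hf').integrable_sq) (hf.sub hf').integrable_sq ?_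
    filter_upwards [ae_volQ_mem] with z hz
    refine mul_le_of_le_one_left (sq_nonneg _) (Real.exp_le_one_iff.2 ?_)
    nlinarith [mul_nonneg hρ0 hz.1.1.le]
  simp only [SpaceH.fn_sub, SpaceH.grad_sub] at k4
  refine k4.trans ?_
  rw [mul_assoc (Real.exp _) 2]
  refine mul_le_mul_of_nonneg_left ?_ (Real.exp_pos _).le
  have k6 := (u.sub ha v).energy_nonneg hρ0
  rw [k2] at k1
  linarith

lemma integral_sub_sq_le_of_geometric {α : Type*} [MeasurableSpace α] {ν : Measure α}
    {f : ℕ → α → ℝ} (hf : ∀ n, MemLp (f n) 2 ν) {L : ℝ} (hL : 0 ≤ L)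
    (h : ∀ n, ∫ x, (f (n + 1) x - f n x) ^ 2 ∂ν ≤ (L * (1 / 2) ^ n) ^ 2) (N n : ℕ) (hn : N ≤ n) :
    ∫ x, (f n x - f N x) ^ 2 ∂ν ≤ (2 * L * (1 / 2) ^ N) ^ 2 := by
  have hp : ∀ n : ℕ, (0 : ℝ) ≤ L * (1 / 2) ^ n := fun n => by positivity
  have key : √(∫ x, (f n x - f N x) ^ 2 ∂ν) ≤ 2 * L * (1 / 2) ^ N - 2 * (L * (1 / 2) ^ n) := by
    induction n, hn using Nat.le_induction with
    | base => simp [mul_assoc]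
    | succ n hn ih =>
      have h1 := sqrt_integral_sq_add_le ((hf (n + 1)).sub (hf n)) ((hf n).sub (hf N))
      simp only [Pi.sub_apply, sub_add_sub_cancel] at h1
      have h2 := Real.sqrt_le_sqrt (h n)
      rw [Real.sqrt_sq (hp n)] at h2
      have h3 : L * (1 / 2) ^ (n + 1) = L * (1 / 2) ^ n / 2 := by rw [pow_succ]; ring
      linarith
  refine (Real.sqrt_le_left (by positivity)).1 (key.trans ?_)
  linarith [hp n]

lemma ae_eq_of_tendsto_integral_sq {α : Type*} [MeasurableSpace α] {ν : Measure α}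
    {F : ℕ → α → ℝ} {g g' : α → ℝ} (hF : ∀ n, MemLp (F n) 2 ν) (hg : MemLp g 2 ν)
    (hg' : MemLp g' 2 ν) (h : Tendsto (fun n => ∫ x, (F n x - g x) ^ 2 ∂ν) atTop (𝓝 0))
    (h' : Tendsto (fun n => ∫ x, (F n x - g' x) ^ 2 ∂ν) atTop (𝓝 0)) : g =ᵐ[ν] g' := by
  have hlim : Tendsto (fun n => 2 * (∫ x, (F n x - g x) ^ 2 ∂ν)
      + 2 * ∫ x, (F n x - g' x) ^ 2 ∂ν) atTop (𝓝 0) := by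
    simpa using (h.const_mul 2).add (h'.const_mul 2)
  have hb : ∀ n, ∫ x, (g x - g' x) ^ 2 ∂ν ≤ 2 * (∫ x, (F n x - g x) ^ 2 ∂ν)
      + 2 * ∫ x, (F n x - g' x) ^ 2 ∂ν := fun n => by
    have i1 := (integrable_sub_sq (hF n) hg).const_mul 2
    have i2 := (integrable_sub_sq (hF n) hg').const_mul 2
    rw [← integral_const_mul, ← integral_const_mul, ← integral_add i1 i2]
    refine integral_mono (integrable_sub_sq hg hg') (i1.add i2) fun x => ?_
    nlinarith [sq_nonneg (F n x - g x + (F n x - g' x))]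
  have hz := ae_eq_zero_of_integral_sq (hg.sub hg') (ge_of_tendsto' hlim hb)
  filter_upwards [hz] with x hx
  simpa [sub_eq_zero] using hx

lemma SpaceH.ae_dx_eq (ha : WeaklyDegenerate a) {u v : SpaceH a T} (h : u.grad =ᵐ[volQ T] v.grad) :
    ∀ᵐ z ∂volQ T, u.dx z.1 z.2 = v.dx z.1 z.2 := by
  filter_upwards [h, ae_volQ_mem] with z h1 hz
  exact mul_left_cancel₀ (Real.sqrt_ne_zero'.2 (ha.pos_of_mem hz.2)) h1

/-- The semilinear problem is solvable, by Picard iteration. -/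
theorem exists_solution (B : EigenBasis ha) (hT : 0 ≤ T) (h : LowerOrderTerms T K Φ b)
    (hf : MemLp f 2 (volQ T)) {y₀ : ℝ → ℝ} (hy₀ : MemLp y₀ 2 volΩ) :
    ∃ u : SpaceH a T, Solves B Φ b f u ∧ u.val 0 =ᵐ[volΩ] y₀ := by
  obtain ⟨ρ, hρ, key⟩ := exists_contraction B h.nonneg
  have hρ0 : 0 ≤ ρ := zero_le_one.trans hρ
  choose step hstep hstep0 using fun o : SpaceH a T =>
    exists_linear_solution B hT (h.memLp_reaction ha hf o) (h.memLp_coef_mul_hardy ha o) hy₀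
  obtain ⟨w, -, hw0⟩ := exists_linear_solution (T := T) (M := 0) (G := 0) B hT MemLp.zero
    MemLp.zero hy₀
  have hcontr : ∀ (o o' : SpaceH a T) (S : ℝ) (hS : S ∈ Icc 0 T),
      Real.exp (-2 * ρ * S) * (∫ x, ((step o).val S x - (step o').val S x) ^ 2 ∂volΩ)
          + (((step o).sub ha (step o')).restrict (S := S) hS.2).energy ρ
        ≤ (o.sub ha o').energy ρ / 4 := fun o o' S hS => by
    have := key T Φ b f f (step o) (step o') o o' h hf hf (hstep o) (hstep o')
      ((hstep0 o).trans (hstep0 o').symm) S hS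
    simpa using this
  have hcE : ∀ o o' : SpaceH a T, ((step o).sub ha (step o')).energy ρ
      ≤ (o.sub ha o').energy ρ / 4 := fun o o' => by
    have h1 := hcontr o o' T (right_mem_Icc.2 hT)
    have h2 : 0 ≤ Real.exp (-2 * ρ * T)
        * (∫ x, ((step o).val T x - (step o').val T x) ^ 2 ∂volΩ) :=
      mul_nonneg (Real.exp_pos _).le (integral_nonneg fun x => sq_nonneg _)
    exact (le_add_of_nonneg_left h2).trans h1
  have hcS : ∀ o o' : SpaceH a T, ∀ S ∈ Icc 0 T,
      ∫ x, ((step o).val S x - (step o').val S x) ^ 2 ∂volΩ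
        ≤ Real.exp (2 * ρ * T) * (o.sub ha o').energy ρ := fun o o' S hS => by
    have h1 := hcontr o o' S hS
    have h2 := (((step o).sub ha (step o')).restrict hS.2).energy_nonneg hρ0
    have h3 := (o.sub ha o').energy_nonneg hρ0
    have h4 : Real.exp (-2 * ρ * S) * (∫ x, ((step o).val S x - (step o').val S x) ^ 2 ∂volΩ)
        ≤ (o.sub ha o').energy ρ := by linarith
    have h5 := mul_le_mul_of_nonneg_left h4 (Real.exp_pos (2 * ρ * T)).le
    refine le_trans ?_ h5
    rw [← mul_assoc, ← Real.exp_add]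
    refine le_mul_of_one_le_left (integral_nonneg fun x => sq_nonneg _) (Real.one_le_exp ?_)
    nlinarith [hS.2]
  set y : ℕ → SpaceH a T := fun n => step^[n] w with hy
  have hy1 : ∀ n, y (n + 1) = step (y n) := fun n => Function.iterate_succ_apply' step n w
  set E₀ := ((y 1).sub ha (y 0)).energy ρ
  have hE : ∀ n, ((y (n + 1)).sub ha (y n)).energy ρ ≤ E₀ * (1 / 4) ^ n := fun n => by
    induction n with
    | zero => simp [E₀]
    | succ n ih =>
      have h1 := hcE (y (n + 1)) (y n)
      rw [← hy1, ← hy1] at h1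
      rw [pow_succ]; linarith
  have hE₀ : 0 ≤ E₀ := SpaceH.energy_nonneg hρ0 _
  set L := √(Real.exp (2 * ρ * T) * E₀)
  have hL : ∀ n : ℕ, (L * (1 / 2) ^ n) ^ 2 = Real.exp (2 * ρ * T) * (E₀ * (1 / 4) ^ n) := fun n => by
    rw [mul_pow, Real.sq_sqrt (by positivity), ← pow_mul, mul_comm n, pow_mul, mul_assoc]
    norm_num
  have hQ : ∀ n, (∫ z, ((y (n + 1)).fn z - (y n).fn z) ^ 2 ∂volQ T)
      + (∫ z, ((y (n + 1)).grad z - (y n).grad z) ^ 2 ∂volQ T) ≤ (L * (1 / 2) ^ n) ^ 2 := fun n => by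
    have h1 := ((y (n + 1)).sub ha (y n)).integral_sq_add_le_energy hρ
    simp only [SpaceH.fn_sub, SpaceH.grad_sub] at h1
    rw [hL]
    exact h1.trans (mul_le_mul_of_nonneg_left (hE n) (Real.exp_pos _).le)
  have hshift : ∀ n : ℕ, (L * (1 / 2) ^ (n + 1)) ^ 2 ≤ (L * (1 / 2) ^ n) ^ 2 := fun n => by
    rw [hL, hL, pow_succ]
    have : 0 ≤ Real.exp (2 * ρ * T) * (E₀ * (1 / 4) ^ n) := by positivity
    nlinarith
  have hnn : ∀ g : ℝ × ℝ → ℝ, 0 ≤ ∫ z, g z ^ 2 ∂volQ T :=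
    fun g => integral_nonneg fun z => sq_nonneg _
  obtain ⟨u, -, hu1, hu2⟩ := SpaceH.exists_limit ha (fun n => y (n + 1))
    (b := fun n => 2 * L * (1 / 2) ^ n) (fun n => by positivity)
    (summable_geometric_two.mul_left _)
    (fun N n hNn t ht => integral_sub_sq_le_of_geometric
      (fun n => (y (n + 1)).memLp_slice t ht) (Real.sqrt_nonneg _) (fun n => by
        rw [hL, hy1 (n + 1), hy1 n]
        refine (hcS _ _ t ht).trans (mul_le_mul_of_nonneg_left ?_ (Real.exp_pos _).le)
        rw [← hy1]; exact hE n) N n hNn)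
    (fun N n hNn => integral_sub_sq_le_of_geometric (fun n => (y (n + 1)).memLp_fn)
      (Real.sqrt_nonneg _) (fun n => by
        have h2 := hnn fun z => (y (n + 1 + 1)).grad z - (y (n + 1)).grad z
        linarith [hQ (n + 1), hshift n]) N n hNn)
    (fun N n hNn => integral_sub_sq_le_of_geometric (fun n => (y (n + 1)).memLp_grad)
      (Real.sqrt_nonneg _) (fun n => by
        have h2 := hnn fun z => (y (n + 1 + 1)).fn z - (y (n + 1)).fn z
        linarith [hQ (n + 1), hshift n]) N n hNn)
  have hlim : Tendsto (fun n => Real.exp (2 * ρ * T)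
      * ((ρ * (∫ z, ((y (n + 1)).fn z - u.fn z) ^ 2 ∂volQ T)
        + ∫ z, ((y (n + 1)).grad z - u.grad z) ^ 2 ∂volQ T) / 4)) atTop (𝓝 0) := by
    simpa using (((hu1.const_mul ρ).add hu2).div_const 4).const_mul (Real.exp (2 * ρ * T))
  have hstepu : ∀ n, (∫ z, ((y (n + 1 + 1)).fn z - (step u).fn z) ^ 2 ∂volQ T)
      + (∫ z, ((y (n + 1 + 1)).grad z - (step u).grad z) ^ 2 ∂volQ T)
      ≤ Real.exp (2 * ρ * T) * ((ρ * (∫ z, ((y (n + 1)).fn z - u.fn z) ^ 2 ∂volQ T)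
        + ∫ z, ((y (n + 1)).grad z - u.grad z) ^ 2 ∂volQ T) / 4) := fun n => by
    have h1 := ((step (y (n + 1))).sub ha (step u)).integral_sq_add_le_energy hρ
    have h2 := ((y (n + 1)).sub ha u).energy_le hρ0
    simp only [SpaceH.fn_sub, SpaceH.grad_sub] at h1 h2
    rw [hy1 (n + 1)]
    refine h1.trans (mul_le_mul_of_nonneg_left ((hcE _ _).trans ?_) (Real.exp_pos _).le)
    linarith
  have hfn : u.fn =ᵐ[volQ T] (step u).fn := by
    refine ae_eq_of_tendsto_integral_sq (fun n => (y (n + 1 + 1)).memLp_fn) u.memLp_fn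
      (step u).memLp_fn (hu1.comp (tendsto_add_atTop_nat 1))
      (squeeze_zero (fun n => hnn _) (fun n => ?_) hlim)
    have h2 := hnn fun z => (y (n + 1 + 1)).grad z - (step u).grad z
    linarith [hstepu n]
  have hgrad : u.grad =ᵐ[volQ T] (step u).grad := by
    refine ae_eq_of_tendsto_integral_sq (fun n => (y (n + 1 + 1)).memLp_grad) u.memLp_grad
      (step u).memLp_grad (hu2.comp (tendsto_add_atTop_nat 1))
      (squeeze_zero (fun n => hnn _) (fun n => ?_) hlim)
    have h2 := hnn fun z => (y (n + 1 + 1)).fn z - (step u).fn z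
    linarith [hstepu n]
  refine ⟨step u, (hstep u).congr ?_ ?_, hstep0 u⟩
  · filter_upwards [hfn, SpaceH.ae_dx_eq ha hgrad] with z h1 h2
    have h3 : u.val z.1 z.2 = (step u).val z.1 z.2 := h1
    rw [reaction, reaction, h2, h3]
  · filter_upwards [hfn] with z h1
    have h3 : u.val z.1 z.2 = (step u).val z.1 z.2 := h1
    simp only [SpaceH.hardy, h3]

end WellPosed

/-! ### Time reversal -/

section Reversal

variable {a : ℝ → ℝ} {T : ℝ} {ha : WeaklyDegenerate a} {B : EigenBasis ha}

lemma measurePreserving_reflect (T : ℝ) : MeasurePreserving (fun t : ℝ => T - t)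
    (volume.restrict (Ioo 0 T)) (volume.restrict (Ioo 0 T)) := by
  have h := (Measure.measurePreserving_sub_left (volume : Measure ℝ) T).restrict_preimage
    (s := Ioo 0 T) measurableSet_Ioo
  have e : (fun t : ℝ => T - t) ⁻¹' Ioo 0 T = Ioo 0 T := by
    ext t; simp only [mem_preimage, mem_Ioo]; constructor <;> intro h <;> constructor <;> linarith
  rwa [e] at h

lemma measurePreserving_reflect_volQ (T : ℝ) :
    MeasurePreserving (fun z : ℝ × ℝ => (T - z.1, z.2)) (volQ T) (volQ T) := by
  rw [volQ_eq_prod]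
  exact (measurePreserving_reflect T).prod (MeasurePreserving.id volΩ)

/-- The function `t ↦ u(T - t)`. -/
def SpaceH.reverse (u : SpaceH a T) : SpaceH a T where
  val t := u.val (T - t)
  dx t := u.dx (T - t)
  memLp_val := u.memLp_val.comp_measurePreserving (measurePreserving_reflect_volQ T)
  memLp_dx := u.memLp_dx.comp_measurePreserving (measurePreserving_reflect_volQ T)
  memH1a := (measurePreserving_reflect T).quasiMeasurePreserving.ae u.memH1a
  memLp_slice t ht := u.memLp_slice (T - t) ⟨by linarith [ht.2], by linarith [ht.1]⟩
  continuous_slice t₀ ht₀ := by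
    have h1 : Tendsto (fun t : ℝ => T - t) (𝓝[Icc 0 T] t₀) (𝓝[Icc 0 T] (T - t₀)) := by
      refine tendsto_nhdsWithin_iff.2 ⟨((continuous_const.sub continuous_id).tendsto t₀).mono_left
        nhdsWithin_le_nhds, ?_⟩
      filter_upwards [self_mem_nhdsWithin] with t ht
      exact ⟨by linarith [ht.2], by linarith [ht.1]⟩
    exact (u.continuous_slice (T - t₀) ⟨by linarith [ht₀.2], by linarith [ht₀.1]⟩).comp h1

lemma BalanceLaw.reverse {u : SpaceH a T} {M G : ℝ × ℝ → ℝ} (hu : BalanceLaw B u M G)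
    (hM : MemLp M 2 (volQ T)) (hG : MemLp G 2 (volQ T)) :
    BalanceLaw B u.reverse (fun z => -M (T - z.1, z.2)) (fun z => -G (T - z.1, z.2)) := by
  intro i t ht
  have h0T : (0 : ℝ) ∈ Icc 0 T := left_mem_Icc.2 (ht.1.trans ht.2)
  have hTT : T ∈ Icc 0 T := right_mem_Icc.2 (ht.1.trans ht.2)
  have htT : T - t ∈ Icc 0 T := ⟨by linarith [ht.2], by linarith [ht.1]⟩
  have hi := integrable_dualCoef (B := B) hM hG i
  have e1 : ∀ s, u.reverse.coef B i s = u.coef B i (T - s) := fun s => rfl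
  have e2 : ∀ s, B.dualCoef (fun x => -M (T - s, x)) (fun x => -G (T - s, x)) i
      = -B.dualCoef (fun x => M (T - s, x)) (fun x => G (T - s, x)) i := fun s => by
    rw [EigenBasis.dualCoef, EigenBasis.dualCoef, ← integral_neg]
    congr 1
    ext x; ring
  simp only [e1, e2, sub_zero]
  rw [hu i (T - t) htT, hu i T hTT, intervalIntegral.integral_neg,
    intervalIntegral.integral_comp_sub_left
      (fun s => B.dualCoef (fun x => M (s, x)) (fun x => G (s, x)) i), sub_zero,
    ← intervalIntegral.integral_add_adjacent_intervals (intervalIntegrable_of_Ioo hi h0T htT)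
      (intervalIntegrable_of_Ioo hi htT hTT)]
  ring

end Reversal

/-! ### Weak solutions of the state and the adjoint equation -/

section WeakSolutions

variable {a : ℝ → ℝ} {T K : ℝ} {ha : WeaklyDegenerate a} {B : EigenBasis ha}
  {Φ : ℝ × ℝ → ℝ → ℝ → ℝ} {b c f : ℝ × ℝ → ℝ}

/-- The terms of the weak formulation, in terms of `φ/√a` and `√a φ_x`. -/
lemma LowerOrderTerms.integral_pairing (h : LowerOrderTerms T K Φ b) (ha : WeaklyDegenerate a)
    (hf : MemLp f 2 (volQ T)) (u φ : SpaceH a T) :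
    ∫ z, (reaction Φ f u z * φ.hardy z + (u.grad z + b z * u.hardy z) * φ.grad z) ∂volQ T
      = (∫ z, a z.2 * u.dx z.1 z.2 * φ.dx z.1 z.2 ∂volQ T)
        + (∫ z, Φ z (u.val z.1 z.2) (u.dx z.1 z.2) * φ.val z.1 z.2 ∂volQ T)
        + (∫ z, b z * u.val z.1 z.2 * φ.dx z.1 z.2 ∂volQ T)
        - ∫ z, f z * φ.val z.1 z.2 ∂volQ T := by
  have hfh := integrable_mul_of_memLp_two (memLp_sqrt_snd_mul ha hf) (φ.memLp_hardy ha)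
  have hr := integrable_mul_of_memLp_two (h.memLp_reaction ha hf u) (φ.memLp_hardy ha)
  have hΦ : Integrable (fun z => reaction Φ f u z * φ.hardy z + √(a z.2) * f z * φ.hardy z)
    (volQ T) := hr.add hfh
  have hg := integrable_mul_of_memLp_two u.memLp_grad φ.memLp_grad
  have hb := integrable_mul_of_memLp_two (h.memLp_coef_mul_hardy ha u) φ.memLp_grad
  have e1 : ∫ z, a z.2 * u.dx z.1 z.2 * φ.dx z.1 z.2 ∂volQ T
      = ∫ z, u.grad z * φ.grad z ∂volQ T := by
    refine integral_congr_ae ?_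
    filter_upwards [ae_volQ_mem] with z hz
    simp only [SpaceH.grad]
    linear_combination (-(u.dx z.1 z.2 * φ.dx z.1 z.2)) * Real.mul_self_sqrt (ha.pos_of_mem hz.2).le
  have e2 : ∫ z, Φ z (u.val z.1 z.2) (u.dx z.1 z.2) * φ.val z.1 z.2 ∂volQ T
      = ∫ z, (reaction Φ f u z * φ.hardy z + √(a z.2) * f z * φ.hardy z) ∂volQ T := by
    refine integral_congr_ae ?_
    filter_upwards [ae_volQ_mem] with z hz
    simp only [reaction, SpaceH.hardy]
    linear_combination (-(Φ z (u.val z.1 z.2) (u.dx z.1 z.2) * φ.val z.1 z.2))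
      * ha.sqrt_mul_invSqrt hz.2
  have e3 : ∫ z, b z * u.val z.1 z.2 * φ.dx z.1 z.2 ∂volQ T
      = ∫ z, b z * u.hardy z * φ.grad z ∂volQ T := by
    refine integral_congr_ae ?_
    filter_upwards [ae_volQ_mem] with z hz
    simp only [SpaceH.grad, SpaceH.hardy]
    linear_combination (-(b z * u.val z.1 z.2 * φ.dx z.1 z.2)) * ha.sqrt_mul_invSqrt hz.2
  have e4 : ∫ z, f z * φ.val z.1 z.2 ∂volQ T = ∫ z, √(a z.2) * f z * φ.hardy z ∂volQ T := by
    refine integral_congr_ae ?_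
    filter_upwards [ae_volQ_mem] with z hz
    simp only [SpaceH.hardy]
    linear_combination (-(f z * φ.val z.1 z.2)) * ha.sqrt_mul_invSqrt hz.2
  rw [e1, e2, e3, e4, ← integral_add hg hΦ, ← integral_add (hg.fun_add hΦ) hb,
    ← integral_sub ((hg.fun_add hΦ).fun_add hb) hfh]
  congr 1
  ext z; ring

lemma AdmissibleNonlinearity.lowerOrderTerms {F : ℝ × ℝ → ℝ} (hF : AdmissibleNonlinearity F)
    (T : ℝ) : ∃ K : ℝ, LowerOrderTerms T K (fun _ s p => F (s, p)) 0 := by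
  obtain ⟨K, hK, h⟩ := hF.lipschitz
  exact ⟨K, hK.le, fun _ => hF.zero, Eventually.of_forall fun z => h, fun s p hs hp =>
    hF.contDiff.continuous.comp_aestronglyMeasurable (hs.prodMk hp), aestronglyMeasurable_const,
    Eventually.of_forall fun z => by simpa using hK.le⟩

lemma lowerOrderTerms_linear (hc : AEStronglyMeasurable c (volQ T))
    (hb : AEStronglyMeasurable b (volQ T)) (hcK : ∀ z, |c z| ≤ K) (hbK : ∀ z, |b z| ≤ K) :
    LowerOrderTerms T K (fun z s _ => c z * s) b := by
  have hK : 0 ≤ K := (abs_nonneg _).trans (hcK 0)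
  refine ⟨hK, fun z => mul_zero _, Eventually.of_forall fun z s p s' p' => ?_,
    fun s p hs _ => hc.mul hs, hb, Eventually.of_forall hbK⟩
  rw [← mul_sub, abs_mul]
  exact mul_le_mul (hcK z) (le_add_of_nonneg_right (abs_nonneg _)) (abs_nonneg _) hK

lemma isWeakSolution_iff (B : EigenBasis ha) (hT : 0 < T) {F : ℝ × ℝ → ℝ}
    (hF : AdmissibleNonlinearity F) {y₀ : ℝ → ℝ} (hy₀ : MemLp y₀ 2 volΩ)
    (hf : MemLp f 2 (volQ T)) (y : SpaceH a T) :
    IsWeakSolution a F T y₀ f y ↔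
      Solves B (fun _ s p => F (s, p)) 0 f y ∧ y.val 0 =ᵐ[volΩ] y₀ := by
  obtain ⟨K, h⟩ := hF.lowerOrderTerms T
  rw [Solves, ← forward_weak_iff hT y (h.memLp_reaction ha hf y) (h.memLp_flux ha y y) hy₀]
  refine forall₂_congr fun φ _ => ?_
  rw [h.integral_pairing ha hf y φ.toSpaceH]
  simp only [Pi.zero_apply, zero_mul, integral_zero]
  constructor <;> intro h <;> linarith

lemma isAdjointWeakSolution_iff (B : EigenBasis ha) (hT : 0 < T)
    (h : LowerOrderTerms T K (fun z s _ => c z * s) b) (hf : MemLp f 2 (volQ T))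
    (p : SpaceH a T) :
    IsAdjointWeakSolution a c b T f p ↔
      BalanceLaw B p (fun z => -reaction (fun z s _ => c z * s) f p z)
        (fun z => -(p.grad z + b z * p.hardy z)) ∧ p.val T =ᵐ[volΩ] 0 := by
  rw [← backward_weak_iff hT p (h.memLp_reaction ha hf p) (h.memLp_flux ha p p)]
  refine forall₂_congr fun φ _ => ?_
  rw [h.integral_pairing ha hf p φ.toSpaceH]
  constructor <;> intro h <;> linarith

theorem exists_adjointWeakSolution (ha : WeaklyDegenerate a) (hT : 0 < T)
    (hc : AEStronglyMeasurable c (volQ T)) (hb : AEStronglyMeasurable b (volQ T))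
    (hcK : ∀ z, |c z| ≤ K) (hbK : ∀ z, |b z| ≤ K) (hf : MemLp f 2 (volQ T)) :
    ∃ p : SpaceH a T, IsAdjointWeakSolution a c b T f p := by
  obtain ⟨B⟩ : Nonempty (EigenBasis ha) := inferInstance
  have hr := measurePreserving_reflect_volQ T
  have h' := lowerOrderTerms_linear (hc.comp_measurePreserving hr) (hb.comp_measurePreserving hr)
    (fun z => hcK _) (fun z => hbK _)
  have hf' := hf.comp_measurePreserving hr
  obtain ⟨q, hq, hq0⟩ := exists_solution B hT.le h' hf' (MemLp.zero (p := 2) (μ := volΩ))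
  refine ⟨q.reverse, (isAdjointWeakSolution_iff B hT (lowerOrderTerms_linear hc hb hcK hbK) hf
    q.reverse).2 ⟨?_, ?_⟩⟩
  · refine (hq.reverse (h'.memLp_reaction ha hf' q) (h'.memLp_flux ha q q)).congr
      (Eventually.of_forall fun z => ?_) (Eventually.of_forall fun z => ?_) <;>
    simp [reaction, SpaceH.reverse, SpaceH.grad, SpaceH.hardy]
  · change q.val (T - T) =ᵐ[volΩ] 0
    rw [sub_self]; exact hq0

theorem exists_weakSolution (ha : WeaklyDegenerate a) (hT : 0 < T) {F : ℝ × ℝ → ℝ}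
    (hF : AdmissibleNonlinearity F) {y₀ : ℝ → ℝ} (hy₀ : MemLp y₀ 2 volΩ)
    (hf : MemLp f 2 (volQ T)) : ∃ y : SpaceH a T, IsWeakSolution a F T y₀ f y := by
  obtain ⟨B⟩ : Nonempty (EigenBasis ha) := inferInstance
  obtain ⟨K, h⟩ := hF.lowerOrderTerms T
  obtain ⟨y, hy⟩ := exists_solution B hT.le h hf hy₀
  exact ⟨y, (isWeakSolution_iff B hT hF hy₀ hf y).2 hy⟩

/-- Weak solutions depend continuously on the right-hand side. -/
theorem exists_weakSolution_stability_const (ha : WeaklyDegenerate a) (hT : 0 < T) {F : ℝ × ℝ → ℝ}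
    (hF : AdmissibleNonlinearity F) {y₀ : ℝ → ℝ} (hy₀ : MemLp y₀ 2 volΩ) :
    ∃ C : ℝ, 0 ≤ C ∧ ∀ (f f' : ℝ × ℝ → ℝ) (y y' : SpaceH a T), MemLp f 2 (volQ T) →
      MemLp f' 2 (volQ T) → IsWeakSolution a F T y₀ f y → IsWeakSolution a F T y₀ f' y' →
      (∫ z, (y.fn z - y'.fn z) ^ 2 ∂volQ T) + (∫ z, (y.grad z - y'.grad z) ^ 2 ∂volQ T)
        ≤ C * ∫ z, (f z - f' z) ^ 2 ∂volQ T := by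
  obtain ⟨B⟩ : Nonempty (EigenBasis ha) := inferInstance
  obtain ⟨K, h⟩ := hF.lowerOrderTerms T
  obtain ⟨C, hC, key⟩ := exists_stability_const B hT.le h
  refine ⟨C, hC, fun f f' y y' hf hf' hy hy' => ?_⟩
  rw [isWeakSolution_iff B hT hF hy₀ hf] at hy
  rw [isWeakSolution_iff B hT hF hy₀ hf'] at hy'
  exact key f f' y y' hf hf' hy.1 hy'.1 (hy.2.trans hy'.2.symm)

/-- Testing the difference of two weak solutions `y'`, `y` with an adjoint state `p`. -/
theorem integral_mul_sub_eq (ha : WeaklyDegenerate a) (hT : 0 < T) {F : ℝ × ℝ → ℝ}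
    (hF : AdmissibleNonlinearity F) {y₀ : ℝ → ℝ} (hy₀ : MemLp y₀ 2 volΩ) {g g' : ℝ × ℝ → ℝ}
    (hg : MemLp g 2 (volQ T)) (hg' : MemLp g' 2 (volQ T)) {y y' p : SpaceH a T}
    (hy : IsWeakSolution a F T y₀ g y) (hy' : IsWeakSolution a F T y₀ g' y')
    (h : LowerOrderTerms T K (fun z s _ => c z * s) b) (hf : MemLp f 2 (volQ T))
    (hp : IsAdjointWeakSolution a c b T f p) :
    ∫ z, f z * (y'.fn z - y.fn z) ∂volQ T = (∫ z, (g' z - g z) * p.fn z ∂volQ T)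
      - ∫ z, (√(a z.2) * (F (y'.val z.1 z.2, y'.dx z.1 z.2) - F (y.val z.1 z.2, y.dx z.1 z.2)
        - c z * (y'.val z.1 z.2 - y.val z.1 z.2) - b z * (y'.dx z.1 z.2 - y.dx z.1 z.2)))
        * p.hardy z ∂volQ T := by
  obtain ⟨B⟩ : Nonempty (EigenBasis ha) := inferInstance
  obtain ⟨K', h'⟩ := hF.lowerOrderTerms T
  rw [isWeakSolution_iff B hT hF hy₀ hg] at hy
  rw [isWeakSolution_iff B hT hF hy₀ hg'] at hy'
  rw [isAdjointWeakSolution_iff B hT h hf] at hp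
  have m1 := h'.memLp_reaction ha hg y
  have m2 := h'.memLp_reaction ha hg' y'
  have n1 := h'.memLp_flux ha y y
  have n2 := h'.memLp_flux ha y' y'
  have hd := hy'.1.sub hy.1 m2 n2 m1 n1
  have m3 := (h.memLp_reaction ha hf p).neg
  have n3 := (h.memLp_flux ha p p).neg
  have key := BalanceLaw.duality hT.le hd hp.1 (m2.sub m1) (n2.sub n1) m3 n3
    (θ := fun _ => 1) contDiff_const
  have e1 : ∫ x, (y'.sub ha y).val T x * p.val T x ∂volΩ = 0 := by
    refine (integral_congr_ae ?_).trans (integral_zero _ _)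
    filter_upwards [hp.2] with x hx
    simp [hx]
  have e2 : ∫ x, (y'.sub ha y).val 0 x * p.val 0 x ∂volΩ = 0 := by
    refine (integral_congr_ae ?_).trans (integral_zero _ _)
    filter_upwards [hy.2, hy'.2] with x h1 h2
    simp [SpaceH.sub, h1, h2]
  rw [e1, e2] at key
  simp only [mul_zero, sub_zero, deriv_const, zero_mul, one_mul, zero_sub, integral_neg] at key
  rw [eq_comm, neg_eq_zero] at key
  have i1 : Integrable (fun z => f z * (y'.fn z - y.fn z)) (volQ T) :=
    integrable_mul_of_memLp_two hf (y'.memLp_fn.sub y.memLp_fn)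
  have i2 : Integrable (fun z => (g' z - g z) * p.fn z) (volQ T) :=
    integrable_mul_of_memLp_two (hg'.sub hg) p.memLp_fn
  have j1 := (integrable_mul_of_memLp_two (m2.sub m1) (p.memLp_hardy ha)).add
    (integrable_mul_of_memLp_two (n2.sub n1) p.memLp_grad)
  have j2 := (integrable_mul_of_memLp_two m3 ((y'.sub ha y).memLp_hardy ha)).add
    (integrable_mul_of_memLp_two n3 (y'.sub ha y).memLp_grad)
  have i3 : Integrable (fun z => _) (volQ T) := j1.add j2
  have i23 := i3.fun_add i2
  have e3 := integral_sub i23 i1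
  rw [integral_add i3 i2] at e3
  have e4 := e3.trans (congrArg (· - _) (congrArg (· + _) key))
  rw [zero_add] at e4
  rw [eq_sub_iff_add_eq, add_comm, ← eq_sub_iff_add_eq]
  refine (integral_congr_ae ?_).trans e4
  filter_upwards [ae_volQ_mem] with z hz
  have hs := ha.sqrt_mul_invSqrt hz.2
  simp only [reaction, SpaceH.hardy, SpaceH.grad, SpaceH.fn, SpaceH.sub, Pi.add_apply,
    Pi.sub_apply, Pi.neg_apply, Pi.zero_apply]
  linear_combination ((g' z - g z) * p.val z.1 z.2
    - f z * (y'.val z.1 z.2 - y.val z.1 z.2)) * hs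

end WeakSolutions

/-! ### The linearization error of the nonlinearity -/

section Linearization

variable {F : ℝ × ℝ → ℝ}

/-- The error of the first-order Taylor expansion of `F` at `q`. -/
def taylorError (F : ℝ × ℝ → ℝ) (q q' : ℝ × ℝ) : ℝ :=
  F q' - F q - partialD 0 F q * (q'.1 - q.1) - partialD 1 F q * (q'.2 - q.2)

lemma AdmissibleNonlinearity.continuous_partialD (hF : AdmissibleNonlinearity F) (i : Fin 2) :
    Continuous (partialD i F) :=
  (hF.contDiff.continuous_fderiv (by norm_num)).clm_apply continuous_const

lemma AdmissibleNonlinearity.exists_abs_partialD_le (hF : AdmissibleNonlinearity F) :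
    ∃ M : ℝ, ∀ i q, |partialD i F q| ≤ M := by
  obtain ⟨M, -, h⟩ := hF.bounded
  refine ⟨M, fun i q => ?_⟩
  have h1 : |partialD i F q| ≤ ∑ i, |partialD i F q| :=
    Finset.single_le_sum (f := fun i => |partialD i F q|) (fun _ _ => abs_nonneg _)
      (Finset.mem_univ i)
  have h2 : 0 ≤ ∑ i, ∑ j, |partialD i (partialD j F) q| :=
    Finset.sum_nonneg fun i _ => Finset.sum_nonneg fun j _ => abs_nonneg _
  linarith [h q]

lemma AdmissibleNonlinearity.exists_abs_taylorError_le (hF : AdmissibleNonlinearity F) :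
    ∃ K : ℝ, ∀ q q', |taylorError F q q'| ≤ K * (|q'.1 - q.1| + |q'.2 - q.2|) := by
  obtain ⟨M, hM⟩ := hF.exists_abs_partialD_le
  obtain ⟨K, -, hK⟩ := hF.lipschitz
  refine ⟨K + M, fun q q' => ?_⟩
  have h1 := hK q'.1 q'.2 q.1 q.2
  have h2 : |partialD 0 F q * (q'.1 - q.1)| ≤ M * |q'.1 - q.1| := by
    rw [abs_mul]; exact mul_le_mul_of_nonneg_right (hM 0 q) (abs_nonneg _)
  have h3 : |partialD 1 F q * (q'.2 - q.2)| ≤ M * |q'.2 - q.2| := by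
    rw [abs_mul]; exact mul_le_mul_of_nonneg_right (hM 1 q) (abs_nonneg _)
  rw [taylorError]
  have h4 := abs_sub (F q' - F q - partialD 0 F q * (q'.1 - q.1)) (partialD 1 F q * (q'.2 - q.2))
  have h5 := abs_sub (F q' - F q) (partialD 0 F q * (q'.1 - q.1))
  linarith

lemma AdmissibleNonlinearity.tendsto_taylorError_div (hF : AdmissibleNonlinearity F) (q : ℝ × ℝ) :
    Tendsto (fun q' => taylorError F q q' / (|q'.1 - q.1| + |q'.2 - q.2|)) (𝓝 q) (𝓝 0) := by
  have hd : HasFDerivAt F (fderiv ℝ F q) q := (hF.contDiff.differentiable (by norm_num) q).hasFDerivAt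
  have h1 : (fun q' => taylorError F q q') =o[𝓝 q] fun q' => q' - q := by
    refine hd.isLittleO.congr_left fun q' => ?_
    have e : q' - q = (q'.1 - q.1) • ((1, 0) : ℝ × ℝ) + (q'.2 - q.2) • ((0, 1) : ℝ × ℝ) := by
      ext <;> simp
    rw [e, map_add, map_smul, map_smul, taylorError, partialD, partialD]
    simp only [smul_eq_mul, Matrix.cons_val_zero, Matrix.cons_val_one]
    ring
  refine (h1.trans_isBigO (Asymptotics.IsBigO.of_bound 1 (Eventually.of_forall fun q' => ?_))
    ).tendsto_div_nhds_zero
  rw [one_mul, Prod.norm_def,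
    Real.norm_of_nonneg (by positivity : 0 ≤ |q'.1 - q.1| + |q'.2 - q.2|)]
  exact max_le (le_add_of_nonneg_right (abs_nonneg _)) (le_add_of_nonneg_left (abs_nonneg _))

variable {a : ℝ → ℝ} {T : ℝ}

/-- The pair `(u, u_x)`. -/
def SpaceH.jet (u : SpaceH a T) (z : ℝ × ℝ) : ℝ × ℝ := (u.val z.1 z.2, u.dx z.1 z.2)

lemma SpaceH.aestronglyMeasurable_jet (ha : WeaklyDegenerate a) (u : SpaceH a T) :
    AEStronglyMeasurable u.jet (volQ T) :=
  u.memLp_val.1.prodMk (u.aestronglyMeasurable_dx ha)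

/-- If `y_t - y = O(t)` in `ℍ`, then the pairing of the linearization error at `y` with `p` is
`o(t)`. The quotient of the error by `|y_t - y| + |(y_t - y)_x|` is bounded and tends to `0`
almost everywhere along subsequences; multiplied by `p/√a ∈ L²(Q)`, it tends to `0` in `L²(Q)`. -/
theorem tendsto_integral_taylorError (ha : WeaklyDegenerate a) (hF : AdmissibleNonlinearity F)
    {y : SpaceH a T} {Y : ℝ → SpaceH a T} {C : ℝ}
    (hY : ∀ t, (∫ z, ((Y t).fn z - y.fn z) ^ 2 ∂volQ T)
      + (∫ z, ((Y t).grad z - y.grad z) ^ 2 ∂volQ T) ≤ C * t ^ 2) (p : SpaceH a T) :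
    Tendsto (fun t => t⁻¹ * ∫ z, √(a z.2) * taylorError F (y.jet z) ((Y t).jet z) * p.hardy z
      ∂volQ T) (𝓝[≠] 0) (𝓝 0) := by
  obtain ⟨K, hK⟩ := hF.exists_abs_taylorError_le
  obtain ⟨A, hA⟩ := ha.bounded
  have hnn : ∀ g : ℝ × ℝ → ℝ, 0 ≤ ∫ z, g z ^ 2 ∂volQ T :=
    fun g => integral_nonneg fun z => sq_nonneg _
  have hC : 0 ≤ C := by
    have h1 := hY 1
    have h2 := hnn fun z => (Y 1).fn z - y.fn z
    have h3 := hnn fun z => (Y 1).grad z - y.grad z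
    linarith
  set δ : ℝ → ℝ × ℝ → ℝ := fun t z => |((Y t).jet z).1 - (y.jet z).1| + |((Y t).jet z).2 - (y.jet z).2|
    with hδ
  have hδ0 : ∀ t z, 0 ≤ δ t z := fun t z => by positivity
  set ψ : ℝ → ℝ × ℝ → ℝ := fun t z => taylorError F (y.jet z) ((Y t).jet z) / δ t z with hψ
  have hψK : ∀ t z, |ψ t z| ≤ K := fun t z => by
    simp only [hψ]
    rw [abs_div, abs_of_nonneg (hδ0 t z)]
    rcases (hδ0 t z).eq_or_lt with h0 | h0
    · rw [← h0, div_zero]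
      have h1 := hK (0, 0) (1, 0)
      have h2 := (abs_nonneg _).trans h1
      simp at h2; exact h2
    · rw [div_le_iff₀ h0]; exact hK _ _
  have hψδ : ∀ t z, taylorError F (y.jet z) ((Y t).jet z) = ψ t z * δ t z := fun t z => by
    rcases (hδ0 t z).eq_or_lt with h0 | h0
    · rw [← h0, mul_zero]
      have h1 := hK (y.jet z) ((Y t).jet z)
      change _ ≤ K * δ t z at h1
      rw [← h0, mul_zero] at h1
      exact abs_nonpos_iff.1 h1
    · rw [hψ, div_mul_cancel₀ _ h0.ne']
  have hj : ∀ u : SpaceH a T, AEMeasurable (fun z => (u.jet z).1) (volQ T) ∧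
      AEMeasurable (fun z => (u.jet z).2) (volQ T) := fun u =>
    ⟨u.memLp_val.1.aemeasurable, (u.aestronglyMeasurable_dx ha).aemeasurable⟩
  have hcomp : ∀ {G : ℝ × ℝ → ℝ}, Continuous G → ∀ u : SpaceH a T,
      AEMeasurable (fun z => G (u.jet z)) (volQ T) := fun {G} hG u =>
    (hG.comp_aestronglyMeasurable (u.aestronglyMeasurable_jet ha)).aemeasurable
  have hψm : ∀ t, AEStronglyMeasurable (ψ t) (volQ T) := fun t => by
    refine AEMeasurable.aestronglyMeasurable (AEMeasurable.div ?_ ?_)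
    · exact (((hcomp hF.contDiff.continuous (Y t)).sub (hcomp hF.contDiff.continuous y)).sub
        ((hcomp (hF.continuous_partialD 0) y).mul ((hj (Y t)).1.sub (hj y).1))).sub
        ((hcomp (hF.continuous_partialD 1) y).mul ((hj (Y t)).2.sub (hj y).2))
    · simp only [hδ, ← Real.norm_eq_abs]
      exact ((hj (Y t)).1.sub (hj y).1).norm.add ((hj (Y t)).2.sub (hj y).2).norm
  have hψp : ∀ t, MemLp (fun z => ψ t z * p.hardy z) 2 (volQ T) := fun t =>
    memLp_bounded_mul (hψm t) (Eventually.of_forall (hψK t)) (p.memLp_hardy ha)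
  -- the weighted difference `√a (|y_t - y| + |(y_t - y)_x|)` is `O(t)` in `L²(Q)`
  have hδe : ∀ t z, √(a z.2) * δ t z
      = |√(a z.2) * ((Y t).fn z - y.fn z)| + |(Y t).grad z - y.grad z| := fun t z => by
    simp only [hδ, SpaceH.jet, SpaceH.grad, SpaceH.fn, ← mul_sub]
    rw [abs_mul, abs_mul, abs_of_nonneg (Real.sqrt_nonneg _)]; ring
  have hδL : ∀ t, MemLp (fun z => √(a z.2) * δ t z) 2 (volQ T) := fun t => by
    simp only [hδe]
    exact (memLp_sqrt_snd_mul ha ((Y t).memLp_fn.sub y.memLp_fn)).abs.add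
      ((Y t).memLp_grad.sub y.memLp_grad).abs
  have hδI : ∀ t, ∫ z, (√(a z.2) * δ t z) ^ 2 ∂volQ T ≤ (2 * (A ^ 2 + 1) * C) * t ^ 2 := fun t => by
    have i1 := (integrable_sub_sq (Y t).memLp_fn y.memLp_fn).const_mul (2 * A ^ 2)
    have i2 := (integrable_sub_sq (Y t).memLp_grad y.memLp_grad).const_mul 2
    have h1 : ∫ z, (√(a z.2) * δ t z) ^ 2 ∂volQ T ≤ ∫ z, (2 * A ^ 2 * ((Y t).fn z - y.fn z) ^ 2
        + 2 * ((Y t).grad z - y.grad z) ^ 2) ∂volQ T := by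
      refine integral_mono_ae (hδL t).integrable_sq (i1.add i2) ?_
      filter_upwards [ae_volQ_mem] with z hz
      rw [hδe]
      have h2 := sq_nonneg (|√(a z.2) * ((Y t).fn z - y.fn z)| - |(Y t).grad z - y.grad z|)
      have h3 := sq_abs (√(a z.2) * ((Y t).fn z - y.fn z))
      have h4 := sq_abs ((Y t).grad z - y.grad z)
      have h5 : (√(a z.2) * ((Y t).fn z - y.fn z)) ^ 2 ≤ A ^ 2 * ((Y t).fn z - y.fn z) ^ 2 := by
        rw [mul_pow]
        exact mul_le_mul_of_nonneg_right (pow_le_pow_left₀ (Real.sqrt_nonneg _)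
          (hA z.2 (Ioo_subset_Icc_self hz.2)) 2) (sq_nonneg _)
      nlinarith
    rw [integral_add i1 i2, integral_const_mul, integral_const_mul] at h1
    have h6 := hnn fun z => (Y t).fn z - y.fn z
    have h7 := hnn fun z => (Y t).grad z - y.grad z
    have h8 := mul_le_mul_of_nonneg_left (hY t) (by positivity : 0 ≤ 2 * (A ^ 2 + 1))
    nlinarith [mul_nonneg (sq_nonneg A) h7]
  -- the quotients, multiplied by `p/√a`, tend to `0` in `L²(Q)`
  have hψ0 : Tendsto (fun t => ∫ z, (ψ t z * p.hardy z) ^ 2 ∂volQ T) (𝓝[≠] 0) (𝓝 0) := by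
    refine tendsto_of_subseq_tendsto fun ts hts => ?_
    have hts0 : Tendsto (fun n => C * ts n ^ 2) atTop (𝓝 0) := by
      have h0 : Tendsto ts atTop (𝓝 0) := hts.mono_right nhdsWithin_le_nhds
      simpa using (h0.pow 2).const_mul C
    obtain ⟨ns, hns, hae⟩ := exists_subseq_ae_tendsto_zero
      (f := fun n z => ((Y (ts n)).fn z - y.fn z) ^ 2 + ((Y (ts n)).grad z - y.grad z) ^ 2)
      (ν := volQ T) (fun n => (integrable_sub_sq (Y (ts n)).memLp_fn y.memLp_fn).add
        (integrable_sub_sq (Y (ts n)).memLp_grad y.memLp_grad))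
      (fun n z => by positivity)
      (squeeze_zero (fun n => integral_nonneg fun z => by positivity) (fun n => by
        rw [integral_add (integrable_sub_sq (Y (ts n)).memLp_fn y.memLp_fn)
          (integrable_sub_sq (Y (ts n)).memLp_grad y.memLp_grad)]
        exact hY (ts n)) hts0)
    refine ⟨ns, ?_⟩
    have hdom := tendsto_integral_of_dominated_convergence (μ := volQ T) (f := fun _ => (0 : ℝ))
      (F := fun n z => (ψ (ts (ns n)) z * p.hardy z) ^ 2) (fun z => K ^ 2 * p.hardy z ^ 2)
      (fun n => ((hψp (ts (ns n))).1.pow 2)) ((p.memLp_hardy ha).integrable_sq.const_mul _)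
      (fun n => Eventually.of_forall fun z => by
        rw [Real.norm_of_nonneg (sq_nonneg _), mul_pow, ← sq_abs (ψ _ z)]
        exact mul_le_mul_of_nonneg_right (pow_le_pow_left₀ (abs_nonneg _) (hψK _ z) 2)
          (sq_nonneg _)) ?_
    · simpa using hdom
    · filter_upwards [hae, ae_volQ_mem] with z hz hzm
      have hsq : ∀ {g : ℕ → ℝ}, Tendsto (fun n => g n ^ 2) atTop (𝓝 0) → Tendsto g atTop (𝓝 0) :=
        fun {g} hg => by
          have := hg.sqrt
          simp only [Real.sqrt_sq_eq_abs, Real.sqrt_zero] at this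
          exact (tendsto_zero_iff_abs_tendsto_zero g).2 this
      have h1 : Tendsto (fun n => (Y (ts (ns n))).fn z - y.fn z) atTop (𝓝 0) :=
        hsq (squeeze_zero (fun n => sq_nonneg _)
          (fun n => le_add_of_nonneg_right (sq_nonneg _)) hz)
      have h2 : Tendsto (fun n => (Y (ts (ns n))).grad z - y.grad z) atTop (𝓝 0) :=
        hsq (squeeze_zero (fun n => sq_nonneg _)
          (fun n => le_add_of_nonneg_left (sq_nonneg _)) hz)
      have h3 : Tendsto (fun n => (Y (ts (ns n))).dx z.1 z.2 - y.dx z.1 z.2) atTop (𝓝 0) := by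
        have := h2.const_mul (invSqrt a z.2)
        rw [mul_zero] at this
        refine this.congr fun n => ?_
        simp only [SpaceH.grad]
        linear_combination ((Y (ts (ns n))).dx z.1 z.2 - y.dx z.1 z.2)
          * ha.sqrt_mul_invSqrt hzm.2
      have h4 : Tendsto (fun n => (Y (ts (ns n))).jet z) atTop (𝓝 (y.jet z)) := by
        refine Tendsto.prodMk_nhds ?_ ?_
        · exact tendsto_sub_nhds_zero_iff.1 h1
        · exact tendsto_sub_nhds_zero_iff.1 h3
      have h5 := (((hF.tendsto_taylorError_div (y.jet z)).comp h4).mul_const (p.hardy z)).pow 2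
      simpa [hψ, hδ, Function.comp_def] using h5
  have hbound : ∀ t, |t⁻¹ * ∫ z, √(a z.2) * taylorError F (y.jet z) ((Y t).jet z) * p.hardy z
      ∂volQ T| ≤ √(∫ z, (ψ t z * p.hardy z) ^ 2 ∂volQ T) * √(2 * (A ^ 2 + 1) * C) := fun t => by
    have e : ∫ z, √(a z.2) * taylorError F (y.jet z) ((Y t).jet z) * p.hardy z ∂volQ T
        = ∫ z, ψ t z * p.hardy z * (√(a z.2) * δ t z) ∂volQ T := by
      congr 1
      ext z
      rw [hψδ]; ring
    rw [e, abs_mul]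
    have h1 := abs_integral_mul_le (hψp t) (hδL t)
    have h2 : √(∫ z, (√(a z.2) * δ t z) ^ 2 ∂volQ T) ≤ √(2 * (A ^ 2 + 1) * C) * |t| := by
      rw [← Real.sqrt_sq_eq_abs, ← Real.sqrt_mul (by positivity)]
      exact Real.sqrt_le_sqrt (hδI t)
    have h3 := h1.trans (mul_le_mul_of_nonneg_left h2 (Real.sqrt_nonneg _))
    rcases eq_or_ne t 0 with rfl | ht
    · simp only [inv_zero, abs_zero, zero_mul]; positivity
    · calc _ ≤ |t⁻¹| * _ := mul_le_mul_of_nonneg_left h3 (abs_nonneg _)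
        _ = (|t⁻¹| * |t|) * (√(∫ z, (ψ t z * p.hardy z) ^ 2 ∂volQ T)
            * √(2 * (A ^ 2 + 1) * C)) := by ring
        _ = _ := by rw [← abs_mul, inv_mul_cancel₀ ht, abs_one, one_mul]
  refine squeeze_zero_norm hbound ?_
  simpa using hψ0.sqrt.mul_const (√(2 * (A ^ 2 + 1) * C))

end Linearization

/-! ### Extension by zero -/

section Extend

variable {T : ℝ} {A : Set ℝ} {g g' : ℝ × ℝ → ℝ}

/-- The extension by zero of a function on `(0,T) × A`. -/
def extend (A : Set ℝ) (g : ℝ × ℝ → ℝ) (z : ℝ × ℝ) : ℝ :=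
  A.indicator (fun x => g (z.1, x)) z.2

lemma extend_eq_indicator (A : Set ℝ) (g : ℝ × ℝ → ℝ) :
    extend A g = (univ ×ˢ A).indicator g := by
  ext z
  by_cases h : z.2 ∈ A <;> simp [extend, indicator, h]

lemma volCyl_le (hA : A ⊆ Ioo 0 1) : volCyl T A ≤ volQ T :=
  Measure.restrict_mono (prod_mono Subset.rfl hA) le_rfl

lemma volQ_restrict (hm : MeasurableSet A) (hA : A ⊆ Ioo 0 1) :
    (volQ T).restrict (univ ×ˢ A) = volCyl T A := by
  rw [Measure.restrict_restrict (MeasurableSet.univ.prod hm), prod_inter_prod, univ_inter,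
    inter_eq_left.2 hA]

lemma memLp_extend (hm : MeasurableSet A) (hA : A ⊆ Ioo 0 1) (hg : MemLp g 2 (volCyl T A)) :
    MemLp (extend A g) 2 (volQ T) := by
  rw [extend_eq_indicator, memLp_indicator_iff_restrict (MeasurableSet.univ.prod hm),
    volQ_restrict hm hA]
  exact hg

lemma integral_extend_mul (hm : MeasurableSet A) (hA : A ⊆ Ioo 0 1) (g k : ℝ × ℝ → ℝ) :
    ∫ z, extend A g z * k z ∂volQ T = ∫ z, g z * k z ∂volCyl T A := by
  rw [← volQ_restrict hm hA, ← integral_indicator (MeasurableSet.univ.prod hm),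
    extend_eq_indicator]
  congr 1
  ext z
  rw [indicator_mul_left]

lemma extend_congr (hm : MeasurableSet A) (hA : A ⊆ Ioo 0 1) (h : g =ᵐ[volCyl T A] g') :
    extend A g =ᵐ[volQ T] extend A g' := by
  rw [← volQ_restrict hm hA] at h
  rw [extend_eq_indicator, extend_eq_indicator]
  exact (ae_eq_restrict_iff_indicator_ae_eq (MeasurableSet.univ.prod hm)).1 h

end Extend

/-! ### The derivative of the cost functionals -/

namespace Data

variable {P : Data}

/-- The standing assumptions on the data. -/
structure Admissible (P : Data) : Prop where
  pos : 0 < P.T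
  diffusion : WeaklyDegenerate P.a
  nonlinearity : AdmissibleNonlinearity P.F
  region : MeasurableSet P.ω ∧ P.ω ⊆ Ioo 0 1
  controlRegion : ∀ i, MeasurableSet (P.ωf i) ∧ P.ωf i ⊆ Ioo 0 1
  observationRegion : ∀ i, MeasurableSet (P.ωd i) ∧ P.ωd i ⊆ Ioo 0 1

lemma source_eq (g : Fin 2 → ℝ × ℝ → ℝ) (z : ℝ × ℝ) :
    P.source g z = extend P.ω P.h z + ∑ i, extend (P.ωf i) (g i) z := rfl

namespace Admissible

lemma memLp_source (hP : P.Admissible) {g : Fin 2 → ℝ × ℝ → ℝ}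
    (hg : ∀ i, MemLp (g i) 2 (volCyl P.T (P.ωf i))) : MemLp (P.source g) 2 (volQ P.T) :=
  (memLp_extend hP.region.1 hP.region.2 (Lp.memLp P.h)).add
    (memLp_finsetSum _ fun i _ => memLp_extend (hP.controlRegion i).1 (hP.controlRegion i).2 (hg i))

lemma memLp_source_controls (hP : P.Admissible) (v : P.Controls) :
    MemLp (P.source fun i => v i) 2 (volQ P.T) :=
  hP.memLp_source fun i => Lp.memLp (v i)

lemma exists_isState (hP : P.Admissible) (v : P.Controls) : ∃ y, P.IsState (fun i => v i) y :=
  exists_weakSolution hP.diffusion hP.pos hP.nonlinearity (Lp.memLp P.y₀)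
    (hP.memLp_source_controls v)

lemma state_ae_eq (hP : P.Admissible) {v : P.Controls} {y : SpaceH P.a P.T}
    (hy : P.IsState (fun i => v i) y) : ∀ᵐ z ∂volQ P.T, P.state v z.1 z.2 = y.fn z := by
  have hex : ∃ y, P.IsState (fun i => v i) y := ⟨y, hy⟩
  rw [state, dif_pos hex]
  obtain ⟨C, -, hC⟩ := exists_weakSolution_stability_const hP.diffusion hP.pos hP.nonlinearity
    (Lp.memLp P.y₀)
  have hf := hP.memLp_source_controls v
  have h1 := hC _ _ _ _ hf hf hex.choose_spec hy
  have h2 : 0 ≤ ∫ z, (hex.choose.grad z - y.grad z) ^ 2 ∂volQ P.T :=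
    integral_nonneg fun z => sq_nonneg _
  simp only [sub_self, ne_eq, OfNat.ofNat_ne_zero, not_false_eq_true, zero_pow, integral_zero,
    mul_zero] at h1
  have h3 := ae_eq_zero_of_integral_sq (hex.choose.memLp_fn.sub y.memLp_fn)
    (by simp only [Pi.sub_apply]; linarith)
  filter_upwards [h3] with z hz
  exact sub_eq_zero.1 hz

lemma cost_eq (hP : P.Admissible) {v : P.Controls} {y : SpaceH P.a P.T}
    (hy : P.IsState (fun i => v i) y) (i : Fin 2) :
    P.cost i v = P.α i / 2 * (∫ z, (y.fn z - P.yd i z) ^ 2 ∂volCyl P.T (P.ωd i))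
      + P.μ i / 2 * ∫ z, v i z ^ 2 ∂volCyl P.T (P.ωf i) := by
  rw [cost]
  simp only [sq_abs]
  congr 2
  refine integral_congr_ae ?_
  filter_upwards [ae_mono (volCyl_le (hP.observationRegion i).2) (hP.state_ae_eq hy)] with z hz
  rw [hz]

/-- The effect of a change of the control `vⁱ` on the right-hand side. -/
lemma source_update_ae_eq (hP : P.Admissible) (v : P.Controls) (i : Fin 2)
    (w : L2Cyl P.T (P.ωf i)) (t : ℝ) : ∀ᵐ z ∂volQ P.T,
      P.source (fun j => Function.update v i (v i + t • w) j) z - P.source (fun j => v j) z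
        = t * extend (P.ωf i) w z := by
  have h1 : ((v i + t • w : L2Cyl P.T (P.ωf i)) : ℝ × ℝ → ℝ)
      =ᵐ[volCyl P.T (P.ωf i)] fun z => v i z + t * w z := by
    filter_upwards [Lp.coeFn_add (v i) (t • w), Lp.coeFn_smul t w] with z k1 k2
    rw [k1, Pi.add_apply, k2, Pi.smul_apply, smul_eq_mul]
  filter_upwards [extend_congr (hP.controlRegion i).1 (hP.controlRegion i).2 h1] with z hz
  rw [source_eq, source_eq, add_sub_add_left_eq_sub, ← Finset.sum_sub_distrib,
    Finset.sum_eq_single i]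
  · rw [Function.update_self, hz]
    by_cases hA : z.2 ∈ P.ωf i <;> simp [extend, hA]
  · intro j _ hj
    rw [Function.update_of_ne hj, sub_self]
  · simp

lemma lowerOrderTerms_adjoint (hP : P.Admissible) (y : SpaceH P.a P.T) :
    ∃ K, (∀ z, |partialD 0 P.F (y.jet z)| ≤ K) ∧ (∀ z, |partialD 1 P.F (y.jet z)| ≤ K) ∧
      AEStronglyMeasurable (fun z => partialD 0 P.F (y.jet z)) (volQ P.T) ∧
      AEStronglyMeasurable (fun z => partialD 1 P.F (y.jet z)) (volQ P.T) := by
  obtain ⟨M, hM⟩ := hP.nonlinearity.exists_abs_partialD_le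
  have hj := y.aestronglyMeasurable_jet hP.diffusion
  exact ⟨M, fun z => hM 0 _, fun z => hM 1 _,
    (hP.nonlinearity.continuous_partialD 0).comp_aestronglyMeasurable hj,
    (hP.nonlinearity.continuous_partialD 1).comp_aestronglyMeasurable hj⟩

lemma memLp_observation (hP : P.Admissible) (y : SpaceH P.a P.T) (i : Fin 2) :
    MemLp (fun z => y.fn z - P.yd i z) 2 (volCyl P.T (P.ωd i)) :=
  (y.memLp_fn.mono_measure (volCyl_le (hP.observationRegion i).2)).sub (Lp.memLp (P.yd i))

lemma memLp_adjoint_rhs (hP : P.Admissible) (y : SpaceH P.a P.T) (i : Fin 2) :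
    MemLp (extend (P.ωd i) fun z => P.α i * (y.fn z - P.yd i z)) 2 (volQ P.T) :=
  memLp_extend (hP.observationRegion i).1 (hP.observationRegion i).2
    ((hP.memLp_observation y i).const_mul _)

lemma exists_isAdjointState (hP : P.Admissible) (y : SpaceH P.a P.T) (i : Fin 2) :
    ∃ p, P.IsAdjointState i y p := by
  obtain ⟨K, h0, h1, m0, m1⟩ := hP.lowerOrderTerms_adjoint y
  exact exists_adjointWeakSolution hP.diffusion hP.pos m0 m1 h0 h1 (hP.memLp_adjoint_rhs y i)

/-- The derivative of the cost `J_i` with respect to `vⁱ` is represented by `pⁱ + μ_i vⁱ`. -/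
theorem hasLineDerivAt_cost (hP : P.Admissible) {v : P.Controls} {y p : SpaceH P.a P.T} {i : Fin 2}
    (hy : P.IsState (fun j => v j) y) (hp : P.IsAdjointState i y p) (w : L2Cyl P.T (P.ωf i)) :
    HasLineDerivAt ℝ (fun u => P.cost i (Function.update v i u))
      (∫ z, (p.fn z + P.μ i * v i z) * w z ∂volCyl P.T (P.ωf i)) (v i) w := by
  have ha := hP.diffusion
  obtain ⟨hωf, hωf'⟩ := hP.controlRegion i
  obtain ⟨hωd, hωd'⟩ := hP.observationRegion i
  choose Y hY using fun t : ℝ => hP.exists_isState (Function.update v i (v i + t • w))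
  obtain ⟨C, hC0, hC⟩ := exists_weakSolution_stability_const ha hP.pos hP.nonlinearity
    (Lp.memLp P.y₀)
  set W := ∫ z, extend (P.ωf i) w z ^ 2 ∂volQ P.T
  have hstab : ∀ t, (∫ z, ((Y t).fn z - y.fn z) ^ 2 ∂volQ P.T)
      + (∫ z, ((Y t).grad z - y.grad z) ^ 2 ∂volQ P.T) ≤ (C * W) * t ^ 2 := fun t => by
    refine (hC _ _ _ _ (hP.memLp_source_controls _) (hP.memLp_source_controls v) (hY t) hy).trans
      (le_of_eq ?_)
    have : ∫ z, (P.source (fun j => Function.update v i (v i + t • w) j) z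
        - P.source (fun j => v j) z) ^ 2 ∂volQ P.T = t ^ 2 * W := by
      rw [← integral_const_mul]
      refine integral_congr_ae ?_
      filter_upwards [hP.source_update_ae_eq v i w t] with z hz
      rw [hz, mul_pow]
    rw [this]; ring
  obtain ⟨K, c0, c1, m0, m1⟩ := hP.lowerOrderTerms_adjoint y
  set R : ℝ → ℝ := fun t => ∫ z, √(P.a z.2) * taylorError P.F (y.jet z) ((Y t).jet z) * p.hardy z
    ∂volQ P.T
  have hR : Tendsto (fun t => t⁻¹ * R t) (𝓝[≠] 0) (𝓝 0) :=
    tendsto_integral_taylorError ha hP.nonlinearity hstab p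
  have mY : ∀ t, MemLp (fun z => (Y t).fn z - y.fn z) 2 (volCyl P.T (P.ωd i)) := fun t =>
    ((Y t).memLp_fn.sub y.memLp_fn).mono_measure (volCyl_le hωd')
  have my := hP.memLp_observation y i
  have mv : MemLp (v i) 2 (volCyl P.T (P.ωf i)) := Lp.memLp (v i)
  have mw : MemLp w 2 (volCyl P.T (P.ωf i)) := Lp.memLp w
  have mp : MemLp p.fn 2 (volCyl P.T (P.ωf i)) := p.memLp_fn.mono_measure (volCyl_le hωf')
  set D := ∫ z, p.fn z * w z ∂volCyl P.T (P.ωf i)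
  set V := ∫ z, v i z * w z ∂volCyl P.T (P.ωf i)
  set S := ∫ z, w z ^ 2 ∂volCyl P.T (P.ωf i)
  set q : ℝ → ℝ := fun t => ∫ z, ((Y t).fn z - y.fn z) ^ 2 ∂volCyl P.T (P.ωd i)
  have hdual : ∀ t, P.α i * (∫ z, (y.fn z - P.yd i z) * ((Y t).fn z - y.fn z)
      ∂volCyl P.T (P.ωd i)) = t * D - R t := fun t => by
    have key := integral_mul_sub_eq ha hP.pos hP.nonlinearity (Lp.memLp P.y₀)
      (hP.memLp_source_controls v) (hP.memLp_source_controls _) hy (hY t)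
      (lowerOrderTerms_linear m0 m1 c0 c1) (hP.memLp_adjoint_rhs y i) hp
    rw [integral_extend_mul hωd hωd'] at key
    have e1 : ∫ z, (P.source (fun j => Function.update v i (v i + t • w) j) z
        - P.source (fun j => v j) z) * p.fn z ∂volQ P.T = t * D := by
      have : t * D = t * ∫ z, w z * p.fn z ∂volCyl P.T (P.ωf i) := by
        simp only [D, mul_comm]
      rw [this, ← integral_extend_mul hωf hωf', ← integral_const_mul]
      refine integral_congr_ae ?_
      filter_upwards [hP.source_update_ae_eq v i w t] with z hz
      rw [hz, mul_assoc]
    rw [e1] at key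
    rw [← integral_const_mul]
    simp only [← mul_assoc]
    exact key
  have hcost : ∀ t, P.cost i (Function.update v i (v i + t • w)) = P.cost i v
      + (P.α i / 2 * q t + (t * D - R t)) + P.μ i / 2 * (2 * t * V + t ^ 2 * S) := fun t => by
    rw [hP.cost_eq (hY t), hP.cost_eq hy, ← hdual t]
    have e1 : ∫ z, ((Y t).fn z - P.yd i z) ^ 2 ∂volCyl P.T (P.ωd i)
        = (∫ z, (y.fn z - P.yd i z) ^ 2 ∂volCyl P.T (P.ωd i)) + q t
          + 2 * ∫ z, (y.fn z - P.yd i z) * ((Y t).fn z - y.fn z) ∂volCyl P.T (P.ωd i) := by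
      rw [← integral_const_mul, ← integral_add my.integrable_sq (mY t).integrable_sq,
        ← integral_add (my.integrable_sq.fun_add (mY t).integrable_sq)
          ((integrable_mul_of_memLp_two my (mY t)).const_mul 2)]
      congr 1
      ext z; ring
    have e2 : ∫ z, (Function.update v i (v i + t • w)) i z ^ 2 ∂volCyl P.T (P.ωf i)
        = (∫ z, v i z ^ 2 ∂volCyl P.T (P.ωf i)) + (2 * t * V + t ^ 2 * S) := by
      have j1 := (integrable_mul_of_memLp_two mv mw).const_mul (2 * t)
      have j2 := mw.integrable_sq.const_mul (t ^ 2)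
      rw [Function.update_self, ← integral_const_mul, ← integral_const_mul,
        ← integral_add j1 j2, ← integral_add mv.integrable_sq (j1.fun_add j2)]
      refine integral_congr_ae ?_
      filter_upwards [Lp.coeFn_add (v i) (t • w), Lp.coeFn_smul t w] with z k1 k2
      rw [k1, Pi.add_apply, k2, Pi.smul_apply, smul_eq_mul]; ring
    rw [e1, e2]; ring
  have hv : Function.update v i (v i + (0 : ℝ) • w) = v := by simp
  have hderiv : ∫ z, (p.fn z + P.μ i * v i z) * w z ∂volCyl P.T (P.ωf i) = D + P.μ i * V := by
    rw [← integral_const_mul, ← integral_add (integrable_mul_of_memLp_two mp mw)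
      ((integrable_mul_of_memLp_two mv mw).const_mul _)]
    congr 1
    ext z; ring
  rw [hderiv, HasLineDerivAt, hasDerivAt_iff_tendsto_slope_zero]
  have hq0 : ∀ t, 0 ≤ q t := fun t => integral_nonneg fun z => sq_nonneg _
  have hq1 : ∀ t, q t ≤ (C * W) * t ^ 2 := fun t => by
    have h1 : q t ≤ ∫ z, ((Y t).fn z - y.fn z) ^ 2 ∂volQ P.T :=
      integral_mono_measure (volCyl_le hωd') (Eventually.of_forall fun z => sq_nonneg _)
        (integrable_sub_sq (Y t).memLp_fn y.memLp_fn)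
    have h2 : 0 ≤ ∫ z, ((Y t).grad z - y.grad z) ^ 2 ∂volQ P.T :=
      integral_nonneg fun z => sq_nonneg _
    linarith [hstab t]
  have hid : Tendsto (fun t : ℝ => t) (𝓝[≠] 0) (𝓝 0) := tendsto_id.mono_left nhdsWithin_le_nhds
  have hq : Tendsto (fun t => t⁻¹ * q t) (𝓝[≠] 0) (𝓝 0) := by
    have h1 : Tendsto (fun t : ℝ => C * W * |t|) (𝓝[≠] 0) (𝓝 0) := by
      simpa using hid.abs.const_mul (C * W)
    refine squeeze_zero_norm' ?_ h1
    filter_upwards [self_mem_nhdsWithin] with t ht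
    have ht' : t ≠ 0 := ht
    rw [norm_mul, norm_inv, Real.norm_eq_abs, Real.norm_of_nonneg (hq0 t),
      inv_mul_le_iff₀ (abs_pos.2 ht')]
    calc q t ≤ _ := hq1 t
      _ = _ := by rw [← sq_abs t]; ring
  have hlim : Tendsto (fun t => P.α i / 2 * (t⁻¹ * q t) + (D - t⁻¹ * R t)
      + (P.μ i * V + P.μ i / 2 * S * t)) (𝓝[≠] 0) (𝓝 (P.α i / 2 * 0 + (D - 0)
        + (P.μ i * V + P.μ i / 2 * S * 0))) :=
    ((hq.const_mul _).add (hR.const_sub D)).add ((hid.const_mul _).const_add _)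
  have e : P.α i / 2 * 0 + (D - 0) + (P.μ i * V + P.μ i / 2 * S * 0) = D + P.μ i * V := by ring
  rw [e] at hlim
  refine hlim.congr' ?_
  filter_upwards [self_mem_nhdsWithin] with t ht
  have ht' : t ≠ 0 := ht
  simp only [zero_add, hv, hcost, smul_eq_mul]
  field_simp
  ring

lemma isState_congr {g g' : Fin 2 → ℝ × ℝ → ℝ} (h : P.source g =ᵐ[volQ P.T] P.source g')
    {y : SpaceH P.a P.T} (hy : P.IsState g y) : P.IsState g' y := by
  intro φ hφ
  rw [hy φ hφ]
  congr 1
  refine integral_congr_ae ?_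
  filter_upwards [h] with z hz
  rw [hz]

lemma source_congr (hP : P.Admissible) {g g' : Fin 2 → ℝ × ℝ → ℝ}
    (h : ∀ i, g i =ᵐ[volCyl P.T (P.ωf i)] g' i) : P.source g =ᵐ[volQ P.T] P.source g' := by
  have := ae_all_iff.2 fun i => extend_congr (hP.controlRegion i).1 (hP.controlRegion i).2 (h i)
  filter_upwards [this] with z hz
  rw [source_eq, source_eq]
  simp only [hz]

/-- If `y` is the state and the `pⁱ` are the adjoint states, then a pair of controls is a Nash
quasi-equilibrium if and only if the representatives `pⁱ + μ_i vⁱ` of the derivatives vanish. -/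
lemma isNashQuasiEquilibrium_iff (hP : P.Admissible) (hμ : ∀ i, 0 < P.μ i) {v : P.Controls}
    {y : SpaceH P.a P.T} {p : Fin 2 → SpaceH P.a P.T} (hy : P.IsState (fun j => v j) y)
    (hp : ∀ i, P.IsAdjointState i y (p i)) :
    P.IsNashQuasiEquilibrium v ↔
      ∀ i, ∀ᵐ z ∂volCyl P.T (P.ωf i), v i z = -(1 / P.μ i) * (p i).val z.1 z.2 := by
  refine forall_congr' fun i => ?_
  have hμi := (hμ i).ne'
  have mg : MemLp (fun z => (p i).fn z + P.μ i * v i z) 2 (volCyl P.T (P.ωf i)) :=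
    ((p i).memLp_fn.mono_measure (volCyl_le (hP.controlRegion i).2)).add
      ((Lp.memLp (v i)).const_mul _)
  constructor
  · intro h
    have h1 := (hP.hasLineDerivAt_cost hy (hp i) (mg.toLp _)).unique (h (mg.toLp _))
    have h2 : ∫ z, ((p i).fn z + P.μ i * v i z) ^ 2 ∂volCyl P.T (P.ωf i) ≤ 0 := by
      rw [← h1]
      refine le_of_eq (integral_congr_ae ?_)
      filter_upwards [mg.coeFn_toLp] with z hz
      rw [hz, sq]
    filter_upwards [ae_eq_zero_of_integral_sq mg h2] with z hz
    have h3 : (p i).val z.1 z.2 + P.μ i * v i z = 0 := hz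
    field_simp
    linarith
  · intro h w
    have h1 := hP.hasLineDerivAt_cost hy (hp i) w
    have h2 : ∫ z, ((p i).fn z + P.μ i * v i z) * w z ∂volCyl P.T (P.ωf i) = 0 := by
      refine (integral_congr_ae ?_).trans (integral_zero _ _)
      filter_upwards [h] with z hz
      rw [hz, SpaceH.fn]
      field_simp
      ring
    rwa [h2] at h1

end Admissible

end Data

end StackelbergNash

end

theorem proposition3p1 (P : StackelbergNash.Data)
    (hT : 0 < P.T)
    (ha : StackelbergNash.WeaklyDegenerate P.a)
    (hF : StackelbergNash.AdmissibleNonlinearity P.F)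
    (hω : MeasurableSet P.ω ∧ P.ω ⊆ Set.Ioo 0 1)
    (hωf : ∀ i, MeasurableSet (P.ωf i) ∧ P.ωf i ⊆ Set.Ioo 0 1)
    (hωd : ∀ i, MeasurableSet (P.ωd i) ∧ P.ωd i ⊆ Set.Ioo 0 1)
    (hα : ∀ i, 0 < P.α i)
    (hμ : ∀ i, 0 < P.μ i)
    (v : P.Controls) :
    P.IsNashQuasiEquilibrium v ↔
      ∃ (y : StackelbergNash.SpaceH P.a P.T) (p : Fin 2 → StackelbergNash.SpaceH P.a P.T),
        P.SolvesOptimalitySystem y p ∧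
          ∀ i, ∀ᵐ z ∂(StackelbergNash.volCyl P.T (P.ωf i)),
            v i z = -(1 / P.μ i) * (p i).val z.1 z.2 := by
  have hP : P.Admissible := ⟨hT, ha, hF, hω, hωf, hωd⟩
  constructor
  · intro hv
    obtain ⟨y, hy⟩ := hP.exists_isState v
    choose p hp using hP.exists_isAdjointState y
    have hvp := (hP.isNashQuasiEquilibrium_iff hμ hy hp).1 hv
    exact ⟨y, p, ⟨StackelbergNash.Data.Admissible.isState_congr (hP.source_congr hvp) hy, hp⟩, hvp⟩
  · rintro ⟨y, p, ⟨hy, hp⟩, hvp⟩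
    exact (hP.isNashQuasiEquilibrium_iff hμ
      (StackelbergNash.Data.Admissible.isState_congr (hP.source_congr hvp).symm hy) hp).2 hvp
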